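/- \textbf{Setting.} Let $\mathfrak f_2$ be the free Lie $\mathbb Q$-algebra on $f_0,f_1$, $\hat{\mathfrak f}_2\subset\mathbb Q\langle\langle f_0,f_1\rangle\rangle$ its completion by degree, and $\exp[\hat{\mathfrak f}_2,\hat{\mathfrak f}_2]$ the set of exponentials of elements of the topological commutator of $\hat{\mathfrak f}_2$ (commutator group-like series). Let $\mathfrak P_5$ be the Lie $\mathbb Q$-algebra generated by $t_{ij}$ ($i,j\in\mathbb Z/5$) with relations $t_{ij}=t_{ji}$, $t_{ii}=0$, $\sum_{j}t_{ij}=0$ for all $i$, and $[t_{ij},t_{kl}]=0$ if $\{i,j\}\cap\{k,l\}=\emptyset$; let $\widehat{U\mathfrak P_5}$ be the completion by degree of its enveloping algebra. For $\varphi\in\mathbb Q\langle\langle f_0,f_1\rangle\rangle$, $\varphi_{ijk}\in\widehat{U\mathfrak P_5}$ is its image under $f_0\mapsto t_{ij}$, $f_1\mapsto t_{jk}$. \textbf{The map $\lambda$.} Let $\mathcal A=\mathbb Q\langle e_0,e_1\rangle\subset\mathcal A_z=\mathbb Q\langle e_0,e_z,e_1\rangle$ (noncommutative polynomials), also regarded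 as commutative algebras under the shuffle product of words, and put $$\mathcal A_z^0=\mathbb Q\oplus\mathbb Qe_z\oplus\bigoplus_{a\in\{0,z\},\,b\in\{1,z\}}e_a\mathcal A_ze_b,\qquad \mathcal A_z^{-2}=\mathbb Q\oplus e_0\mathcal A_ze_1\oplus e_0\mathcal A_ze_z,\qquad \mathcal A_z^{-1}=\mathbb Q\langle e_z\rangle\cdot\mathcal A_z^{-2}.$$ The shuffle product induces isomorphisms $\mathcal A_z^{-2}\otimes(\mathcal A_z^0\cap\mathbb Q\langle e_1,e_z\rangle)\simeq\mathcal A_z^0$ and $\mathbb Q\langle e_z\rangle\otimes\mathcal A_z^{-2}\simeq\mathcal A_z^{-1}$, with inverses $\mathrm{reg}_{z,1}$ and $\mathrm{reg}_z$. Let $\tau_z$ be the anti-automorphism of $(\mathcal A_z,\cdot)$ with $e_0\mapsto e_z-e_1$, $e_1\mapsto e_z-e_0$, $e_z\mapsto e_z$. Let $N:\mathcal A_z^0\to\mathcal A_z^{-1}$ be $\mathrm{reg}_{z,1}$ followed by $\mathrm{id}\otimes\tau_z$ and the shuffle product, and let $\lambda:\mathcal A_z^0\to\mathcal A$ be $N$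 followed by $\mathrm{reg}_z$, by $\mathrm{const}\otimes\mathrm{id}$ (where $\mathrm{const}:\mathbb Q\langle e_z\rangle\to\mathbb Q$ is the constant term), and by the substitution $e_z\mapsto e_1$. For $l\in\mathcal A$ and $\varphi\in\mathbb Q\langle\langle f_0,f_1\rangle\rangle$ let $\langle l|\varphi\rangle$ be the pairing for which the words in $e_0,e_1$ and in $f_0,f_1$ are dual. \textbf{The map $j_2$.} Use coordinates $(z,w)$ on $\mathcal M_{0,5}$ (marked points $(0,w,z,1,\infty)$) and the basis $e_{21}=d\log w$, $e_{23}=d\log(w-z)$, $e_{24}=d\log(w-1)$, $e_{31}=d\log z$, $e_{34}=d\log(z-1)$ of $H^1_{DR}(\mathcal M_{0,5})$. The reduced bar algebra $\mathcal B$ of $\mathcal M_{0,5}$ is the space of tensors $\sum_Ic_I[\omega_{i_1}|\cdots|\omega_{i_m}]$ (and their sums over $m$) on $H^1_{DR}(\mathcal M_{0,5})$ with $\sum_Ic_I[\omega_{i_1}|\cdots|\omega_{i_j}\wedge\omega_{i_{j+1}}|\cdots|\omega_{i_m}]=0$ for $1\le j<m$. It is the graded dual of $U\mathfrak P_5$,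 through the pairing $\langle\cdot|\cdot\rangle$ of tensors with words in the $t_{ij}$ for which $(e_{21},e_{23},e_{24},e_{31},e_{34})$ is dual to $(t_{21},t_{23},t_{24},t_{31},t_{34})$; the pairing extends to $\mathcal B\times\widehat{U\mathfrak P_5}$. Let $\delta$ be the deconcatenation coproduct, and let $p_2$, $p_3$ be the homomorphisms from the tensor algebra of $H^1_{DR}(\mathcal M_{0,5})$ to $\mathcal A_z$, respectively $\mathcal A$, with $$p_2:\ e_{21}\mapsto e_0,\ e_{23}\mapsto e_z,\ e_{24}\mapsto e_1,\ e_{31},e_{34}\mapsto0;\qquad p_3:\ e_{21},e_{24}\mapsto0,\ e_{23},e_{31}\mapsto-e_0,\ e_{34}\mapsto e_1-e_0.$$ Then $\mathrm{dec}_2=(p_2\otimes p_3)\circ\delta:\mathcal B\to\mathcal A_z\otimes\mathcal A$ is an isomorphism, and $j_2:\mathcal A_z\hookrightarrow\mathcal B$ is defined by $j_2(l)=\mathrm{dec}_2^{-1}(l\otimes1)$. \textbf{Proposition.} For every $l\in\mathcal A_z^0$ and every $\varphi\in\exp[\hat{\mathfrak f}_2,\hat{\mathfrak f}_2]$, $$\langle\lambda(l)\,|\,\varphi\rangle=\langle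 j_2(l)\,|\,\varphi_{243}^{-1}\,\varphi_{215}\,\varphi_{534}\rangle .$$ -/

import Mathlib

open scoped TensorProduct

noncomputable section

namespace KeyFormula

/-! ### Noncommutative polynomials, shuffle product, deconcatenation -/

/-- `ℚ⟨X⟩`: noncommutative polynomials over `ℚ`, with the words in the alphabet `X` as basis
and the concatenation product.  As a vector space it is also the tensor space `T(ℚ^X)`. -/
abbrev NC (X : Type) := MonoidAlgebra ℚ (FreeMonoid X)

/-- The word `w` as an element of `ℚ⟨X⟩`. -/
def word {X : Type} (w : List X) : NC X := MonoidAlgebra.single (FreeMonoid.ofList w) 1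

/-- The coefficient of the word `w` in `p`. -/
def cf {X : Type} (p : NC X) (w : List X) : ℚ := p.coeff (FreeMonoid.ofList w)

/-- The linear map on `ℚ⟨X⟩` with prescribed values on words. -/
def ofWords {X : Type} {M : Type} [AddCommGroup M] [Module ℚ M] (f : List X → M) :
    NC X →ₗ[ℚ] M :=
  Finsupp.linearCombination ℚ (fun w : FreeMonoid X => f w.toList) ∘ₗ
    (MonoidAlgebra.coeffLinearEquiv ℚ).toLinearMap

/-- The algebra homomorphism (for concatenation) with prescribed values on letters. -/
def ofLetters {X : Type} {A : Type} [Ring A] [Algebra ℚ A] (f : X → A) : NC X →ₐ[ℚ] A :=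
  MonoidAlgebra.lift ℚ A (FreeMonoid X) (FreeMonoid.lift f)

/-- The shuffle of two words. -/
def shuffleWords {X : Type} : List X → List X → NC X
  | [], v => word v
  | a :: u, [] => word (a :: u)
  | a :: u, b :: v =>
      word [a] * shuffleWords u (b :: v) + word [b] * shuffleWords (a :: u) v
termination_by u v => u.length + v.length

/-- The shuffle product, as a linear map `u ⊗ v ↦ u ⧢ v`. -/
def shuffle {X : Type} : NC X ⊗[ℚ] NC X →ₗ[ℚ] NC X :=
  TensorProduct.lift (ofWords fun u => ofWords fun v => shuffleWords u v)

/-- The deconcatenation coproduct. -/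
def deconc {X : Type} : NC X →ₗ[ℚ] NC X ⊗[ℚ] NC X :=
  ofWords fun w => ∑ k ∈ Finset.range (w.length + 1), word (w.take k) ⊗ₜ[ℚ] word (w.drop k)

/-! ### The algebras `𝒜 ⊂ 𝒜_z` and the map `λ` -/

/-- The indices `0, z, 1` of the letters `e_0, e_z, e_1`. -/
inductive LetterZ | zero | z | one
  deriving DecidableEq

instance : Fintype LetterZ :=
  ⟨({.zero, .z, .one} : Finset LetterZ), fun x => by cases x <;> simp⟩

/-- The indices `0, 1` of the letters `e_0, e_1` (and of `f_0, f_1`). -/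
inductive Letter | zero | one
  deriving DecidableEq

instance : Fintype Letter :=
  ⟨({.zero, .one} : Finset Letter), fun x => by cases x <;> simp⟩

/-- `𝒜_z = ℚ⟨e_0, e_z, e_1⟩`. -/
abbrev Az := NC LetterZ

/-- `𝒜 = ℚ⟨e_0, e_1⟩`. -/
abbrev A := NC Letter

def ez (a : LetterZ) : Az := word [a]

def e (a : Letter) : A := word [a]

/-- `𝒜_z^0 = ℚ ⊕ ℚ e_z ⊕ ⨁_{a ∈ {0,z}, b ∈ {1,z}} e_a 𝒜_z e_b`. -/
def Az0 : Submodule ℚ Az :=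
  Submodule.span ℚ ({1, ez .z} ∪
    {x | ∃ a ∈ ({.zero, .z} : Set LetterZ), ∃ b ∈ ({.one, .z} : Set LetterZ), ∃ p : Az,
      x = ez a * p * ez b})

/-- `𝒜_z^{-2} = ℚ ⊕ e_0 𝒜_z e_1 ⊕ e_0 𝒜_z e_z`. -/
def AzNeg2 : Submodule ℚ Az :=
  Submodule.span ℚ ({1} ∪
    {x | ∃ b ∈ ({.one, .z} : Set LetterZ), ∃ p : Az, x = ez .zero * p * ez b})

/-- The subalgebra `ℚ⟨e_a : a ∈ s⟩` of `𝒜_z`, as a subspace. -/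
def subAlphabet (s : Set LetterZ) : Submodule ℚ Az :=
  Subalgebra.toSubmodule (Algebra.adjoin ℚ (ez '' s))

/-- `ℚ⟨e_z⟩`. -/
def PolyZ : Submodule ℚ Az := subAlphabet {LetterZ.z}

/-- `𝒜_z^0 ∩ ℚ⟨e_1, e_z⟩`. -/
def Az0OneZ : Submodule ℚ Az := Az0 ⊓ subAlphabet {LetterZ.one, LetterZ.z}

/-- The anti-automorphism `τ_z` of `(𝒜_z, ·)` with
`e_0 ↦ e_z - e_1`, `e_1 ↦ e_z - e_0`, `e_z ↦ e_z`. -/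
def tauZ : Az →ₗ[ℚ] Az :=
  (MulOpposite.opLinearEquiv ℚ).symm.toLinearMap ∘ₗ
    (ofLetters fun a : LetterZ => match a with
      | .zero => MulOpposite.op (ez .z - ez .one)
      | .one => MulOpposite.op (ez .z - ez .zero)
      | .z => MulOpposite.op (ez .z)).toLinearMap

/-- The shuffle map `𝒜_z^{-2} ⊗ (𝒜_z^0 ∩ ℚ⟨e_1,e_z⟩) → 𝒜_z`, `u ⊗ v ↦ u ⧢ v`; it is injective with
image `𝒜_z^0`. -/
def shuffleZ1 : AzNeg2 ⊗[ℚ] Az0OneZ →ₗ[ℚ] Az :=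
  shuffle ∘ₗ TensorProduct.map AzNeg2.subtype Az0OneZ.subtype

/-- `reg_{z,1} : 𝒜_z^0 ≃ 𝒜_z^{-2} ⊗ (𝒜_z^0 ∩ ℚ⟨e_1,e_z⟩)`, the inverse of `shuffleZ1`. -/
def regZ1 (l : Az0) : AzNeg2 ⊗[ℚ] Az0OneZ := Function.invFun shuffleZ1 l

/-- `N`, the composite of `reg_{z,1}`, `id ⊗ τ_z` and the shuffle product; it takes its values in
`𝒜_z^{-1} = ℚ⟨e_z⟩ · 𝒜_z^{-2}`. -/
def mapN (l : Az0) : Az :=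
  shuffle (TensorProduct.map AzNeg2.subtype (tauZ ∘ₗ Az0OneZ.subtype) (regZ1 l))

/-- The shuffle map `ℚ⟨e_z⟩ ⊗ 𝒜_z^{-2} → 𝒜_z`, `u ⊗ v ↦ u ⧢ v`; it is injective with image
`𝒜_z^{-1}`. -/
def shuffleZ : PolyZ ⊗[ℚ] AzNeg2 →ₗ[ℚ] Az :=
  shuffle ∘ₗ TensorProduct.map PolyZ.subtype AzNeg2.subtype

/-- `reg_z : 𝒜_z^{-1} ≃ ℚ⟨e_z⟩ ⊗ 𝒜_z^{-2}`, the inverse of `shuffleZ`. -/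
def regZ (l : Az) : PolyZ ⊗[ℚ] AzNeg2 := Function.invFun shuffleZ l

/-- `const : ℚ⟨e_z⟩ → ℚ`, the algebra homomorphism with `e_z ↦ 0` (the constant term). -/
def constZ : PolyZ →ₗ[ℚ] ℚ :=
  (ofLetters fun _ : LetterZ => (0 : ℚ)).toLinearMap ∘ₗ PolyZ.subtype

/-- `l ↦ l|_{z → 1}`: the algebra homomorphism with `e_0 ↦ e_0`, `e_1 ↦ e_1`, `e_z ↦ e_1`. -/
def zToOne : Az →ₐ[ℚ] A :=
  ofLetters fun a => match a with
    | .zero => e .zero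
    | .one => e .one
    | .z => e .one

/-- The map `λ : 𝒜_z^0 → 𝒜`, the composite of `N`, `reg_z`, `const ⊗ id` and `|_{z → 1}`. -/
def lam (l : Az0) : A :=
  zToOne (TensorProduct.lid ℚ Az (TensorProduct.map constZ AzNeg2.subtype (regZ (mapN l))))

/-! ### Commutator group-like series -/

/-- `ℚ⟨⟨f_0, f_1⟩⟩`: a series is the family of its coefficients on words. -/
abbrev Series := List Letter → ℚ

/-- The (concatenation) product of series. -/
def Series.conv (φ ψ : Series) : Series :=
  fun w => ∑ k ∈ Finset.range (w.length + 1), φ (w.take k) * ψ (w.drop k)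

/-- Powers of a series for the product `Series.conv`. -/
def Series.cpow (ψ : Series) : ℕ → Series
  | 0 => fun w => if w.length = 0 then 1 else 0
  | n + 1 => Series.conv ψ (Series.cpow ψ n)

/-- `exp ψ = ∑ ψ^n / n!` for a series `ψ` without constant term (only the terms with `n ≤ |w|`
contribute to the coefficient of `w`). -/
def Series.cexp (ψ : Series) : Series :=
  fun w => ∑ n ∈ Finset.range (w.length + 1), Series.cpow ψ n w / (n.factorial : ℚ)

/-- The closure of a subspace of `ℚ⟨⟨f_0, f_1⟩⟩` for the topology given by the degree. -/
def degClosure (S : Submodule ℚ Series) : Submodule ℚ Series where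
  carrier := {ψ | ∀ N : ℕ, ∃ x ∈ S, ∀ w : List Letter, w.length < N → ψ w = x w}
  add_mem' := by
    intro a b ha hb N
    obtain ⟨x, hx, hx'⟩ := ha N
    obtain ⟨y, hy, hy'⟩ := hb N
    exact ⟨x + y, S.add_mem hx hy, fun w hw => by simp [hx' w hw, hy' w hw]⟩
  zero_mem' := fun N => ⟨0, S.zero_mem, fun _ _ => rfl⟩
  smul_mem' := by
    intro c a ha N
    obtain ⟨x, hx, hx'⟩ := ha N
    exact ⟨c • x, S.smul_mem c hx, fun w hw => by simp [hx' w hw]⟩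

section

attribute [local instance 100] LieRing.ofAssociativeRing

/-- The free Lie algebra `𝔣_2` inside `U𝔣_2 = ℚ⟨f_0, f_1⟩`. -/
def freeLie2 : Submodule ℚ (NC Letter) :=
  (FreeLieAlgebra.lift ℚ fun a : Letter => (word [a] : NC Letter)).range.toSubmodule

end

/-- A noncommutative polynomial as a series. -/
def toSeries : NC Letter →ₗ[ℚ] Series where
  toFun p := fun w => cf p w
  map_add' _ _ := rfl
  map_smul' _ _ := rfl

/-- The completed free Lie algebra `𝔣̂_2 ⊂ ℚ⟨⟨f_0, f_1⟩⟩`. -/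
def freeLie2Hat : Submodule ℚ Series := degClosure (freeLie2.map toSeries)

/-- The topological commutator `[𝔣̂_2, 𝔣̂_2]`. -/
def commutatorHat : Submodule ℚ Series :=
  degClosure (Submodule.span ℚ
    {ψ | ∃ x ∈ freeLie2Hat, ∃ y ∈ freeLie2Hat, ψ = Series.conv x y - Series.conv y x})

/-- The set `exp [𝔣̂_2, 𝔣̂_2]` of commutator group-like series. -/
def commGroupLike : Set Series := Series.cexp '' (commutatorHat : Set Series)

/-- The pairing `⟨l | φ⟩` of `𝒜` with `ℚ⟨⟨f_0, f_1⟩⟩`, for which words are dual to words. -/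
def pairA (l : A) (φ : Series) : ℚ := ofWords φ l

/-! ### The Lie algebra `𝔓_5` and the completion of `U𝔓_5` -/

/-- The free Lie algebra on symbols `t_{ij}`, `i, j ∈ ℤ/5`. -/
abbrev FreeT := FreeLieAlgebra ℚ (ZMod 5 × ZMod 5)

def freeT (i j : ZMod 5) : FreeT := FreeLieAlgebra.of ℚ (i, j)

/-- The defining relations of `𝔓_5`. -/
def relP5 : Set FreeT :=
  {x | ∃ i j, x = freeT i j - freeT j i} ∪ {x | ∃ i, x = freeT i i} ∪
    {x | ∃ i, x = ∑ j, freeT i j} ∪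
    {x | ∃ i j k l : ZMod 5, ({i, j} ∩ {k, l} : Set (ZMod 5)) = ∅ ∧ x = ⁅freeT i j, freeT k l⁆}

/-- The Lie ideal generated by the relations. -/
def idealP5 : LieIdeal ℚ FreeT := LieSubmodule.lieSpan ℚ FreeT relP5

/-- The Lie algebra `𝔓_5`. -/
abbrev P5 := FreeT ⧸ idealP5

/-- The universal enveloping algebra `U𝔓_5`. -/
abbrev UP5 := UniversalEnvelopingAlgebra ℚ P5

section

attribute [local instance 100] LieRing.ofAssociativeRing

/-- The generator `t_{ij}` in `U𝔓_5`. -/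
def t (i j : ZMod 5) : UP5 :=
  UniversalEnvelopingAlgebra.ι ℚ (LieSubmodule.Quotient.mk (freeT i j) : P5)

/-- The augmentation `U𝔓_5 → ℚ`. -/
def augP5 : UP5 →ₐ[ℚ] ℚ := UniversalEnvelopingAlgebra.lift ℚ (0 : P5 →ₗ⁅ℚ⁆ ℚ)

end

/-- The augmentation ideal; its `n`-th power consists of the elements all of whose
homogeneous components have degree `≥ n`. -/
def augIdeal : Ideal UP5 := RingHom.ker augP5

instance : augIdeal.IsTwoSided := by unfold augIdeal; infer_instance

/-- The completion of `U𝔓_5` by degrees, `lim_n U𝔓_5 / I^n` for the augmentation ideal `I`. -/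
def UP5Hat : Subring (∀ n : ℕ, UP5 ⧸ augIdeal ^ n) where
  carrier := {x | ∀ n, Ideal.Quotient.factor (Ideal.pow_le_pow_right (Nat.le_succ n)) (x (n + 1)) = x n}
  mul_mem' := by intro a b ha hb n; simp [ha n, hb n]
  one_mem' := by intro n; simp
  add_mem' := by intro a b ha hb n; simp [ha n, hb n]
  zero_mem' := by intro n; simp
  neg_mem' := by intro a ha n; simp [ha n]

/-- The image of `f_0`, resp. `f_1`, under `f_0 ↦ t_{ij}`, `f_1 ↦ t_{jk}`. -/
def substLetter (i j k : ZMod 5) : Letter → UP5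
  | .zero => t i j
  | .one => t j k

section

attribute [local instance 100] LieRing.ofAssociativeRing

theorem t_mem_augIdeal (i j : ZMod 5) : t i j ∈ augIdeal := by
  simp [augIdeal, RingHom.mem_ker, augP5, t]

end

theorem prod_mem_pow {I : Ideal UP5} [I.IsTwoSided] (L : List UP5) (h : ∀ x ∈ L, x ∈ I) :
    L.prod ∈ I ^ L.length := by
  induction L with
  | nil => simp [Submodule.pow_zero]
  | cons a L ih =>
    rw [List.prod_cons, List.length_cons, Ideal.IsTwoSided.pow_succ]
    exact Ideal.mul_mem_mul (h a (by simp)) (ih fun x hx => h x (by simp [hx]))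

/-- The part of degree `m` of `φ(t_{ij}, t_{jk})`. -/
def substDeg (φ : Series) (i j k : ZMod 5) (m : ℕ) : UP5 :=
  ∑ w : Fin m → Letter,
    φ (List.ofFn w) • (List.ofFn fun s => substLetter i j k (w s)).prod

theorem substDeg_mem (φ : Series) (i j k : ZMod 5) (m : ℕ) :
    substDeg φ i j k m ∈ augIdeal ^ m := by
  refine Ideal.sum_mem _ fun w _ => ?_
  rw [Algebra.smul_def]
  refine Ideal.mul_mem_left _ _ ?_
  have := prod_mem_pow (I := augIdeal) (List.ofFn fun s => substLetter i j k (w s)) (by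
    intro x hx
    obtain ⟨s, rfl⟩ := (List.mem_ofFn' _ _).1 hx
    cases h : w s <;> simp only [substLetter, h] <;> exact t_mem_augIdeal _ _)
  rwa [List.length_ofFn] at this

/-- `φ_{ijk}`, the image of `φ` under `f_0 ↦ t_{ij}`, `f_1 ↦ t_{jk}`: modulo `I ^ n` it is the sum of
the terms of degree `< n` of `φ(t_{ij}, t_{jk})`. -/
def subst (φ : Series) (i j k : ZMod 5) : UP5Hat :=
  ⟨fun n => Ideal.Quotient.mk _ (∑ m ∈ Finset.range n, substDeg φ i j k m), by
    intro n
    rw [Ideal.Quotient.factor_mk, Finset.sum_range_succ, map_add,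
      Ideal.Quotient.eq_zero_iff_mem.2 (substDeg_mem φ i j k n), add_zero]⟩

/-! ### The bar algebra of `M_{0,5}` -/

/-- The indices of the basis `e_21, e_23, e_24, e_31, e_34` of `H^1_DR(M_{0,5})`. -/
inductive LetterM | e21 | e23 | e24 | e31 | e34
  deriving DecidableEq

instance : Fintype LetterM :=
  ⟨({.e21, .e23, .e24, .e31, .e34} : Finset LetterM), fun x => by cases x <;> simp⟩

/-- The polynomial ring `ℚ[z, w]`; the variable `0` is `z` and the variable `1` is `w`. -/
abbrev PolyZW := MvPolynomial (Fin 2) ℚ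

/-- The field `ℚ(z, w)` of rational functions on `M_{0,5}`. -/
abbrev RatZW := FractionRing PolyZW

/-- The polynomial `f` with `e_{ij} = d log f`, in the coordinates `(0, w, z, 1, ∞)`. -/
def divisorEq : LetterM → PolyZW
  | .e21 => .X 1
  | .e23 => .X 1 - .X 0
  | .e24 => .X 1 - 1
  | .e31 => .X 0
  | .e34 => .X 0 - 1

/-- The coefficients of `dz` and `dw` in the form `d log f`. -/
def dlog (f : PolyZW) (s : Fin 2) : RatZW :=
  algebraMap PolyZW RatZW (MvPolynomial.pderiv s f) / algebraMap PolyZW RatZW f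

/-- The coefficient of `dz ∧ dw` in `ω_a ∧ ω_b`.  A combination of such products vanishes in
`H^2_DR(M_{0,5})` if and only if it vanishes as a differential form. -/
def wedge (a b : LetterM) : RatZW :=
  dlog (divisorEq a) 0 * dlog (divisorEq b) 1 - dlog (divisorEq a) 1 * dlog (divisorEq b) 0

/-- The reduced bar algebra `ℬ` of `M_{0,5}`: the elements of the tensor space on `H^1_DR` that
satisfy the integrability condition at every pair of adjacent places. -/
def Bar : Submodule ℚ (NC LetterM) where
  carrier := {p | ∀ u v : List LetterM,
    ∑ a, ∑ b, algebraMap ℚ RatZW (cf p (u ++ a :: b :: v)) * wedge a b = 0}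
  add_mem' := by
    intro p q hp hq u v
    have h : ∀ w, cf (p + q) w = cf p w + cf q w := fun _ => rfl
    simp only [h, map_add, add_mul, Finset.sum_add_distrib, hp u v, hq u v, add_zero]
  zero_mem' := by
    intro u v
    have h : ∀ w, cf (0 : NC LetterM) w = 0 := fun _ => rfl
    simp [h]
  smul_mem' := by
    intro c p hp u v
    have h : ∀ w, cf (c • p) w = c * cf p w := fun _ => rfl
    simp only [h, map_mul, mul_assoc, ← Finset.mul_sum, hp u v, mul_zero]

/-! ### The decomposition `dec_2` and the inclusion `j_2` -/

/-- The algebra homomorphism on the tensor algebra of `H^1_DR(M_{0,5})` with `ξ_2, ξ_22 ↦ 0`,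
`ξ_1 ↦ e_0`, `ξ_12 ↦ -e_z`, `ξ_11 ↦ -e_1`, where `ξ_1 = e_21`, `ξ_11 = -e_24`, `ξ_2 = -e_31`,
`ξ_22 = e_31 - e_34`, `ξ_12 = e_31 - e_23`. -/
def pr2 : NC LetterM →ₐ[ℚ] Az :=
  ofLetters fun a => match a with
    | .e21 => ez .zero
    | .e23 => ez .z
    | .e24 => ez .one
    | .e31 => 0
    | .e34 => 0

/-- The algebra homomorphism on the tensor algebra of `H^1_DR(M_{0,5})` with
`ξ_1, ξ_12, ξ_11 ↦ 0`, `ξ_2 ↦ e_0`, `ξ_22 ↦ -e_1`. -/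
def pr3 : NC LetterM →ₐ[ℚ] A :=
  ofLetters fun a => match a with
    | .e21 => 0
    | .e23 => -e .zero
    | .e24 => 0
    | .e31 => -e .zero
    | .e34 => e .one - e .zero

/-- The isomorphism `dec_2 : ℬ ≃ 𝒜_z ⊗ 𝒜` (as a linear map). -/
def dec2 : Bar →ₗ[ℚ] Az ⊗[ℚ] A :=
  TensorProduct.map pr2.toLinearMap pr3.toLinearMap ∘ₗ deconc ∘ₗ Bar.subtype

/-- The inclusion `j_2 : 𝒜_z → ℬ` attached to `dec_2`, `l ↦ dec_2⁻¹(l ⊗ 1)`. -/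
def j2 (l : Az) : Bar := Function.invFun dec2 (l ⊗ₜ[ℚ] 1)

/-! ### The pairing of `ℬ` with the completion of `U𝔓_5` -/

/-- The pairing `⟨e_a, t_{ij}⟩` of `H^1_DR(M_{0,5})` with the degree one part of `𝔓_5` (rows and
columns are indexed by `5, 1, 2, 3, 4`): the exponents of the differences `p_i - p_j` in the
expression of the function `f` with `e_a = d log f` as a product of cross-ratios.
It is the linear pairing for which `(e_21, e_23, e_24, e_31, e_34)` and
`(t_21, t_23, t_24, t_31, t_34)` are dual bases. -/
def resMatrix : LetterM → Matrix (Fin 5) (Fin 5) ℤ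
  | .e21 => !![0, 0, -1, 0, 1; 0, 0, 1, 0, -1; -1, 1, 0, 0, 0; 0, 0, 0, 0, 0; 1, -1, 0, 0, 0]
  | .e23 => !![0, 1, -1, -1, 1; 1, 0, 0, 0, -1; -1, 0, 0, 1, 0; -1, 0, 1, 0, 0; 1, -1, 0, 0, 0]
  | .e24 => !![0, 1, -1, 0, 0; 1, 0, 0, 0, -1; -1, 0, 0, 0, 1; 0, 0, 0, 0, 0; 0, -1, 1, 0, 0]
  | .e31 => !![0, 0, 0, -1, 1; 0, 0, 0, 1, -1; 0, 0, 0, 0, 0; -1, 1, 0, 0, 0; 1, -1, 0, 0, 0]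
  | .e34 => !![0, 1, 0, -1, 0; 1, 0, 0, 0, -1; 0, 0, 0, 0, 0; -1, 0, 0, 0, 1; 0, -1, 0, 1, 0]

/-- The pairing `⟨e_a, t_{ij}⟩`. -/
def res (a : LetterM) (i j : ZMod 5) : ℤ := resMatrix a i j

theorem res_dual : ∀ a : LetterM,
    res a 2 1 = (if a = .e21 then 1 else 0) ∧ res a 2 3 = (if a = .e23 then 1 else 0) ∧
    res a 2 4 = (if a = .e24 then 1 else 0) ∧ res a 3 1 = (if a = .e31 then 1 else 0) ∧
    res a 3 4 = (if a = .e34 then 1 else 0) := by decide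

theorem res_symm : ∀ (a : LetterM) (i j : ZMod 5), res a i j = res a j i := by decide

theorem res_self : ∀ (a : LetterM) (i : ZMod 5), res a i i = 0 := by decide

theorem res_sum : ∀ (a : LetterM) (i : ZMod 5), ∑ j, res a i j = 0 := by decide

theorem sum_letterM {M : Type} [AddCommMonoid M] (f : LetterM → M) :
    ∑ a, f a = f .e21 + (f .e23 + (f .e24 + (f .e31 + f .e34))) := by
  have h : (Finset.univ : Finset LetterM) = {.e21, .e23, .e24, .e31, .e34} := rfl
  rw [h]
  simp

theorem clear_denominators {K : Type} [Field K] (Z W : K) (y : LetterM → LetterM → K)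
    (f : LetterM → Fin 2 → K) (h1 : Z ≠ 0) (h2 : W ≠ 0) (h3 : W - Z ≠ 0) (h4 : W - 1 ≠ 0)
    (h5 : Z - 1 ≠ 0)
    (f1 : f .e21 = ![0, 1 / W]) (f2 : f .e23 = ![-1 / (W - Z), 1 / (W - Z)])
    (f3 : f .e24 = ![0, 1 / (W - 1)]) (f4 : f .e31 = ![1 / Z, 0])
    (f5 : f .e34 = ![1 / (Z - 1), 0])
    (h : ∑ a, ∑ b, y a b * (f a 0 * f b 1 - f a 1 * f b 0) = 0) :
    (y .e31 .e21 - y .e21 .e31) * ((Z - 1) * (W - 1) * (W - Z)) +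
       (y .e31 .e24 - y .e24 .e31) * ((Z - 1) * W * (W - Z)) +
       (y .e31 .e23 - y .e23 .e31) * ((Z - 1) * W * (W - 1)) +
       (y .e34 .e21 - y .e21 .e34) * (Z * (W - 1) * (W - Z)) +
       (y .e34 .e24 - y .e24 .e34) * (Z * W * (W - Z)) +
       (y .e34 .e23 - y .e23 .e34) * (Z * W * (W - 1)) -
       (y .e23 .e21 - y .e21 .e23) * (Z * (Z - 1) * (W - 1)) -
       (y .e23 .e24 - y .e24 .e23) * (Z * (Z - 1) * W) = 0 := by
  rw [← mul_zero (Z * (Z - 1) * W * (W - 1) * (W - Z)), ← h]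
  simp only [sum_letterM, f1, f2, f3, f4, f5, Matrix.cons_val_zero, Matrix.cons_val_one]
  field_simp
  ring

/-- The linear equations satisfied by the coefficients `x a b` of an integrable tensor of degree 2. -/
theorem integrable_equations (x : LetterM → LetterM → ℚ)
    (h : ∑ a, ∑ b, algebraMap ℚ RatZW (x a b) * wedge a b = 0) :
    x .e31 .e24 - x .e24 .e31 = 0 ∧ x .e34 .e21 - x .e21 .e34 = 0 ∧
    (x .e31 .e21 - x .e21 .e31) + (x .e31 .e23 - x .e23 .e31) = 0 ∧
    (x .e31 .e21 - x .e21 .e31) + (x .e23 .e21 - x .e21 .e23) = 0 ∧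
    (x .e34 .e24 - x .e24 .e34) + (x .e34 .e23 - x .e23 .e34) = 0 ∧
    (x .e34 .e24 - x .e24 .e34) + (x .e23 .e24 - x .e24 .e23) = 0 := by
  have inj : Function.Injective (algebraMap PolyZW RatZW) := IsFractionRing.injective _ _
  have key : ∀ f : PolyZW, ∀ z w : ℚ, MvPolynomial.eval ![z, w] f ≠ 0 →
      algebraMap PolyZW RatZW f ≠ 0 := by
    intro f z w hf h0
    rw [map_eq_zero_iff _ inj] at h0
    simp [h0] at hf
  have h1 := key (.X 0) 2 3 (by simp)
  have h2 := key (.X 1) 2 3 (by simp)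
  have h3 := key (.X 1 - .X 0) 2 3 (by simp; norm_num)
  have h4 := key (.X 1 - 1) 2 3 (by simp; norm_num)
  have h5 := key (.X 0 - 1) 2 3 (by simp; norm_num)
  simp only [map_sub, map_one] at h3 h4 h5
  have hd : ∀ a, dlog (divisorEq a) = ![dlog (divisorEq a) 0, dlog (divisorEq a) 1] := by
    intro a; ext s; fin_cases s <;> rfl
  have h01 : (1 : Fin 2) ≠ 0 := by decide
  have h10 : (0 : Fin 2) ≠ 1 := by decide
  have hh := clear_denominators _ _ (fun a b => algebraMap ℚ RatZW (x a b))
    (fun a => dlog (divisorEq a)) h1 h2 h3 h4 h5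
    (by rw [hd]; simp [dlog, divisorEq, MvPolynomial.pderiv_X_of_ne h01])
    (by rw [hd]; simp [dlog, divisorEq, MvPolynomial.pderiv_X_of_ne h01,
          MvPolynomial.pderiv_X_of_ne h10])
    (by rw [hd]; simp [dlog, divisorEq, MvPolynomial.pderiv_X_of_ne h01])
    (by rw [hd]; simp [dlog, divisorEq, MvPolynomial.pderiv_X_of_ne h10])
    (by rw [hd]; simp [dlog, divisorEq, MvPolynomial.pderiv_X_of_ne h10])
    h
  obtain ⟨y, hy⟩ : ∃ y : LetterM → LetterM → PolyZW, y = fun a b => MvPolynomial.C (x a b) :=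
    ⟨_, rfl⟩
  have hxy : ∀ a b, algebraMap ℚ RatZW (x a b) = algebraMap PolyZW RatZW (y a b) := by
    intro a b
    rw [hy, IsScalarTower.algebraMap_apply ℚ PolyZW RatZW, MvPolynomial.algebraMap_eq]
  have hP : algebraMap PolyZW RatZW
      ((y .e31 .e21 - y .e21 .e31) * ((.X 0 - 1) * (.X 1 - 1) * (.X 1 - .X 0)) +
       (y .e31 .e24 - y .e24 .e31) * ((.X 0 - 1) * .X 1 * (.X 1 - .X 0)) +
       (y .e31 .e23 - y .e23 .e31) * ((.X 0 - 1) * .X 1 * (.X 1 - 1)) +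
       (y .e34 .e21 - y .e21 .e34) * (.X 0 * (.X 1 - 1) * (.X 1 - .X 0)) +
       (y .e34 .e24 - y .e24 .e34) * (.X 0 * .X 1 * (.X 1 - .X 0)) +
       (y .e34 .e23 - y .e23 .e34) * (.X 0 * .X 1 * (.X 1 - 1)) -
       (y .e23 .e21 - y .e21 .e23) * (.X 0 * (.X 0 - 1) * (.X 1 - 1)) -
       (y .e23 .e24 - y .e24 .e23) * (.X 0 * (.X 0 - 1) * .X 1)) = algebraMap PolyZW RatZW 0 := by
    simp only [map_add, map_sub, map_mul, map_one, map_zero, ← hxy]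
    exact hh
  have hP' := inj hP
  have ev : ∀ z w : ℚ, _ := fun z w => congrArg (MvPolynomial.eval ![z, w]) hP'
  have hc : ∀ (z w : ℚ) a b, MvPolynomial.eval ![z, w] (y a b) = x a b := by
    intro z w a b
    simp [hy]
  simp only [map_add, map_sub, map_mul, map_one, map_zero, hc, MvPolynomial.eval_X,
    Matrix.cons_val_zero, Matrix.cons_val_one] at ev
  have e1 := ev 0 1
  have e2 := ev 0 2
  have e3 := ev 1 0
  have e4 := ev 2 0
  have e5 := ev 1 2
  have e6 := ev 2 1
  norm_num at e1 e2 e3 e4 e5 e6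
  refine ⟨?_, ?_, ?_, ?_, ?_, ?_⟩ <;> linarith

/-- Contraction of the first tensor factor with the letter dual to `a`. -/
def cut (a : LetterM) : NC LetterM →ₗ[ℚ] NC LetterM :=
  (MonoidAlgebra.coeffLinearEquiv ℚ).symm.toLinearMap ∘ₗ
    Finsupp.lcomapDomain (fun w => FreeMonoid.of a * w) (mul_right_injective _) ∘ₗ
      (MonoidAlgebra.coeffLinearEquiv ℚ).toLinearMap

theorem cf_cut (a : LetterM) (p : NC LetterM) (w : List LetterM) :
    cf (cut a p) w = cf p (a :: w) := rfl

/-- Contraction of the first tensor factor with `t_{ij}`. -/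
def contr (i j : ZMod 5) : NC LetterM →ₗ[ℚ] NC LetterM := ∑ a, (res a i j : ℚ) • cut a

theorem cf_add (p q : NC LetterM) (w : List LetterM) : cf (p + q) w = cf p w + cf q w := rfl

theorem cf_smul (c : ℚ) (p : NC LetterM) (w : List LetterM) : cf (c • p) w = c * cf p w := rfl

theorem cf_zero (w : List LetterM) : cf (0 : NC LetterM) w = 0 := rfl

theorem cf_ext {p q : NC LetterM} (h : ∀ w, cf p w = cf q w) : p = q :=
  MonoidAlgebra.ext (Finsupp.ext fun w => h w.toList)

theorem cf_contr (i j : ZMod 5) (p : NC LetterM) (w : List LetterM) :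
    cf (contr i j p) w = ∑ a, (res a i j : ℚ) * cf p (a :: w) := by
  have h : ∀ s : Finset LetterM, cf ((∑ a ∈ s, (res a i j : ℚ) • cut a) p) w =
      ∑ a ∈ s, (res a i j : ℚ) * cf p (a :: w) := by
    intro s
    induction s using Finset.induction_on with
    | empty => rfl
    | insert a s ha ih =>
      rw [Finset.sum_insert ha, Finset.sum_insert ha, LinearMap.add_apply, cf_add, ih]
      rfl
  exact h _

theorem contr_mem (i j : ZMod 5) (p : NC LetterM) (hp : p ∈ Bar) : contr i j p ∈ Bar := by
  intro u v
  have h : ∀ c : LetterM, ∑ a, ∑ b, algebraMap ℚ RatZW (cf p (c :: (u ++ a :: b :: v))) *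
      wedge a b = 0 := fun c => hp (c :: u) v
  simp only [cf_contr, map_sum, map_mul, Finset.sum_mul]
  have : ∀ a b : LetterM, ∑ c, algebraMap ℚ RatZW (res c i j : ℚ) *
      algebraMap ℚ RatZW (cf p (c :: (u ++ a :: b :: v))) * wedge a b =
      ∑ c, algebraMap ℚ RatZW (res c i j : ℚ) *
      (algebraMap ℚ RatZW (cf p (c :: (u ++ a :: b :: v))) * wedge a b) := by
    intro a b; simp only [mul_assoc]
  simp only [this]
  calc _ = ∑ a, ∑ c, ∑ b, algebraMap ℚ RatZW (res c i j : ℚ) *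
      (algebraMap ℚ RatZW (cf p (c :: (u ++ a :: b :: v))) * wedge a b) :=
        Finset.sum_congr rfl fun a _ => Finset.sum_comm
    _ = ∑ c, ∑ a, ∑ b, algebraMap ℚ RatZW (res c i j : ℚ) *
      (algebraMap ℚ RatZW (cf p (c :: (u ++ a :: b :: v))) * wedge a b) := Finset.sum_comm
    _ = 0 := by simp only [← Finset.mul_sum, h, mul_zero, Finset.sum_const_zero]

/-- Contraction of the first tensor factor with `t_{ij}`, on `ℬ`. -/
def contrBar (i j : ZMod 5) : Module.End ℚ Bar := (contr i j).restrict (contr_mem i j)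

theorem cf_contrBar (i j : ZMod 5) (b : Bar) (w : List LetterM) :
    cf (contrBar i j b) w = ∑ a, (res a i j : ℚ) * cf b (a :: w) := cf_contr i j b w

theorem res_minor : ∀ i j k l : ZMod 5, i ≠ k → i ≠ l → j ≠ k → j ≠ l →
    (∀ a b, a = LetterM.e21 ∧ b = LetterM.e24 ∨ a = LetterM.e31 ∧ b = LetterM.e34 →
      res a i j * res b k l = res a k l * res b i j) ∧
    (res .e31 i j * res .e21 k l - res .e31 k l * res .e21 i j =
      (res .e31 i j * res .e23 k l - res .e31 k l * res .e23 i j) +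
      (res .e23 i j * res .e21 k l - res .e23 k l * res .e21 i j)) ∧
    (res .e34 i j * res .e24 k l - res .e34 k l * res .e24 i j =
      (res .e34 i j * res .e23 k l - res .e34 k l * res .e23 i j) +
      (res .e23 i j * res .e24 k l - res .e23 k l * res .e24 i j)) := by
  decide

theorem double_contraction (x : LetterM → LetterM → ℚ) (r s : LetterM → ℚ)
    (e1 : x .e31 .e24 - x .e24 .e31 = 0) (e2 : x .e34 .e21 - x .e21 .e34 = 0)
    (e3 : (x .e31 .e21 - x .e21 .e31) + (x .e31 .e23 - x .e23 .e31) = 0)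
    (e4 : (x .e31 .e21 - x .e21 .e31) + (x .e23 .e21 - x .e21 .e23) = 0)
    (e5 : (x .e34 .e24 - x .e24 .e34) + (x .e34 .e23 - x .e23 .e34) = 0)
    (e6 : (x .e34 .e24 - x .e24 .e34) + (x .e23 .e24 - x .e24 .e23) = 0)
    (q2 : r .e31 * s .e21 - s .e31 * r .e21 =
      (r .e31 * s .e23 - s .e31 * r .e23) + (r .e23 * s .e21 - s .e23 * r .e21))
    (q3 : r .e34 * s .e24 - s .e34 * r .e24 =
      (r .e34 * s .e23 - s .e34 * r .e23) + (r .e23 * s .e24 - s .e23 * r .e24))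
    (q4 : r .e21 * s .e24 = s .e21 * r .e24) (q5 : r .e31 * s .e34 = s .e31 * r .e34) :
    ∑ a, s a * ∑ c, r c * x c a = ∑ a, r a * ∑ c, s c * x c a := by
  simp only [sum_letterM]
  linear_combination (r .e31 * s .e24 - s .e31 * r .e24) * e1 +
    (r .e34 * s .e21 - s .e34 * r .e21) * e2 + (r .e31 * s .e23 - s .e31 * r .e23) * e3 +
    (r .e23 * s .e21 - s .e23 * r .e21) * e4 + (r .e34 * s .e23 - s .e34 * r .e23) * e5 +
    (r .e23 * s .e24 - s .e23 * r .e24) * e6 + (x .e31 .e21 - x .e21 .e31) * q2 +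
    (x .e34 .e24 - x .e24 .e34) * q3 + (x .e21 .e24 - x .e24 .e21) * q4 +
    (x .e31 .e34 - x .e34 .e31) * q5

theorem contrBar_comm (i j k l : ZMod 5) (hik : i ≠ k) (hil : i ≠ l) (hjk : j ≠ k) (hjl : j ≠ l) :
    contrBar k l * contrBar i j = contrBar i j * contrBar k l := by
  refine LinearMap.ext fun b => Subtype.ext (cf_ext fun w => ?_)
  obtain ⟨e1, e2, e3, e4, e5, e6⟩ :=
    integrable_equations (fun c a => cf (b : NC LetterM) (c :: a :: w)) (b.2 [] w)
  obtain ⟨r1, r2, r3⟩ := res_minor i j k l hik hil hjk hjl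
  have r4 := r1 .e21 .e24 (by simp)
  have r5 := r1 .e31 .e34 (by simp)
  simp only [Module.End.mul_apply, cf_contrBar]
  exact double_contraction (fun c a => cf (b : NC LetterM) (c :: a :: w))
    (fun a => (res a i j : ℚ)) (fun a => (res a k l : ℚ)) e1 e2 e3 e4 e5 e6
    (by exact_mod_cast r2) (by exact_mod_cast r3) (by exact_mod_cast r4) (by exact_mod_cast r5)

/-- The opposite of the ring of endomorphisms of `ℬ`; it acts on `ℬ` from the right. -/
def OpEnd : Type := (Module.End ℚ Bar)ᵐᵒᵖ

instance : Ring OpEnd := inferInstanceAs (Ring (Module.End ℚ Bar)ᵐᵒᵖ)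

instance : Algebra ℚ OpEnd := inferInstanceAs (Algebra ℚ (Module.End ℚ Bar)ᵐᵒᵖ)

/-- An endomorphism of `ℬ` as an element of the opposite ring. -/
def OpEnd.mk (f : Module.End ℚ Bar) : OpEnd := MulOpposite.op f

/-- The endomorphism of `ℬ` given by an element of the opposite ring. -/
def OpEnd.toEnd (f : OpEnd) : Module.End ℚ Bar := MulOpposite.unop f

section

attribute [local instance 100] LieRing.ofAssociativeRing

/-- The right action of the free Lie algebra on `ℬ` for which `t_{ij}` acts by contraction. -/
def actFree : FreeT →ₗ⁅ℚ⁆ OpEnd :=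
  FreeLieAlgebra.lift ℚ fun p => OpEnd.mk (contrBar p.1 p.2)

theorem actFree_freeT (i j : ZMod 5) :
    actFree (freeT i j) = OpEnd.mk (contrBar i j) := FreeLieAlgebra.lift_of_apply ..

theorem contrBar_ext {i j k l : ZMod 5} (h : ∀ a, res a i j = res a k l) :
    contrBar i j = contrBar k l :=
  LinearMap.ext fun b => Subtype.ext (cf_ext fun w => by simp only [cf_contrBar, h])

theorem contrBar_self (i : ZMod 5) : contrBar i i = 0 :=
  LinearMap.ext fun b => Subtype.ext (cf_ext fun w => by
    simp [cf_contrBar, res_self, cf_zero])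

theorem contrBar_sum (i : ZMod 5) : ∑ j, contrBar i j = 0 := by
  refine LinearMap.ext fun b => Subtype.ext (cf_ext fun w => ?_)
  have h : ∀ s : Finset (ZMod 5), cf ((∑ j ∈ s, contrBar i j) b : Bar) w =
      ∑ j ∈ s, ∑ a, (res a i j : ℚ) * cf b (a :: w) := by
    intro s
    induction s using Finset.induction_on with
    | empty => rfl
    | insert a s ha ih =>
      rw [Finset.sum_insert ha, Finset.sum_insert ha, ← ih, ← cf_contrBar]
      rfl
  rw [h, Finset.sum_comm]
  refine (Finset.sum_eq_zero fun a _ => ?_).trans (cf_zero w).symm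
  rw [← Finset.sum_mul]
  have := res_sum a i
  have h' : ∑ j, (res a i j : ℚ) = 0 := by exact_mod_cast this
  rw [h', zero_mul]

theorem relP5_le : relP5 ⊆ (actFree.ker : Set FreeT) := by
  intro x hx
  rw [SetLike.mem_coe, LieHom.mem_ker]
  rcases hx with ((⟨i, j, rfl⟩ | ⟨i, rfl⟩) | ⟨i, rfl⟩) | ⟨i, j, k, l, h, rfl⟩
  · rw [map_sub, actFree_freeT, actFree_freeT, contrBar_ext (fun a => res_symm a i j), sub_self]
  · rw [actFree_freeT, contrBar_self]
    rfl
  · have h : ∀ s : Finset (ZMod 5), actFree (∑ j ∈ s, freeT i j) =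
        OpEnd.mk (∑ j ∈ s, contrBar i j) := by
      intro s
      induction s using Finset.induction_on with
      | empty => exact map_zero _
      | insert a s ha ih =>
        rw [Finset.sum_insert ha, Finset.sum_insert ha, map_add, ih, actFree_freeT]
        rfl
    rw [h, contrBar_sum]
    rfl
  · have hd : ∀ x, x ∈ ({i, j} : Set (ZMod 5)) → x ∉ ({k, l} : Set (ZMod 5)) := fun x hx hx' => by
      have : x ∈ ({i, j} ∩ {k, l} : Set (ZMod 5)) := ⟨hx, hx'⟩
      rw [h] at this
      exact this
    have hi := hd i (by simp)
    have hj := hd j (by simp)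
    simp only [Set.mem_insert_iff, Set.mem_singleton_iff, not_or] at hi hj
    rw [LieHom.map_lie, actFree_freeT, actFree_freeT, LieRing.of_associative_ring_bracket, sub_eq_zero]
    exact congrArg OpEnd.mk (contrBar_comm i j k l hi.1 hi.2 hj.1 hj.2)

/-- The right action of `𝔓_5` on `ℬ` for which `t_{ij}` acts by contraction of the first factor. -/
def actP5 : P5 →ₗ⁅ℚ⁆ OpEnd :=
  { Submodule.liftQ idealP5.toSubmodule actFree.toLinearMap
      (fun x hx => (LieSubmodule.lieSpan_le.2 relP5_le : idealP5 ≤ actFree.ker) hx) with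
    map_lie' := by
      intro x y
      induction x using Submodule.Quotient.induction_on
      induction y using Submodule.Quotient.induction_on
      exact LieHom.map_lie actFree _ _ }

/-- The right action of `U𝔓_5` on `ℬ`. -/
def act : UP5 →ₐ[ℚ] OpEnd := UniversalEnvelopingAlgebra.lift ℚ actP5

theorem act_t (i j : ZMod 5) : act (t i j) = OpEnd.mk (contrBar i j) := by
  rw [act, t, UniversalEnvelopingAlgebra.lift_ι_apply]
  exact actFree_freeT i j

end

/-- The pairing of `ℬ` with `U𝔓_5`: `⟨b | x⟩` is the coefficient of the empty word in `b · x`.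
By `pairU_one` and `pairU_t_mul` it is the pairing of tensors with words in the `t_{ij}` that is
induced by `⟨e_a, t_{ij}⟩`. -/
def pairU (b : Bar) : UP5 →+ ℚ where
  toFun x := cf ((act x).toEnd b : NC LetterM) []
  map_zero' := by rw [map_zero]; rfl
  map_add' x y := by rw [map_add]; rfl

theorem pairU_one (b : Bar) : pairU b 1 = cf (b : NC LetterM) [] := by
  change cf ((act 1).toEnd b : NC LetterM) [] = _
  rw [map_one]; rfl

theorem pairU_t_mul (b : Bar) (i j : ZMod 5) (x : UP5) :
    pairU b (t i j * x) = pairU (contrBar i j b) x := by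
  change cf ((act (t i j * x)).toEnd b : NC LetterM) [] = _
  rw [map_mul, act_t]; rfl

/-- The elements of `ℬ` of degree `< n`. -/
def barLt (n : ℕ) : Submodule ℚ Bar where
  carrier := {b | ∀ w : List LetterM, n ≤ w.length → cf (b : NC LetterM) w = 0}
  add_mem' := by
    intro a b ha hb w hw
    rw [Submodule.coe_add, cf_add, ha w hw, hb w hw, add_zero]
  zero_mem' := fun _ _ => rfl
  smul_mem' := by
    intro c a ha w hw
    rw [Submodule.coe_smul, cf_smul, ha w hw, mul_zero]

theorem barLt_mono {m n : ℕ} (h : m ≤ n) : barLt m ≤ barLt n :=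
  fun _ hb w hw => hb w (h.trans hw)

/-- The operators on `ℬ` that lower the degree. -/
def lowering : Submodule ℚ OpEnd where
  carrier := {f | ∀ n, ∀ b ∈ barLt (n + 1), f.toEnd b ∈ barLt n}
  add_mem' := by
    intro f g hf hg n b hb
    exact (barLt n).add_mem (hf n b hb) (hg n b hb)
  zero_mem' := fun n _ _ => (barLt n).zero_mem
  smul_mem' := by
    intro c f hf n b hb
    exact (barLt n).smul_mem c (hf n b hb)

theorem lowering_mul {f g : OpEnd} (hf : f ∈ lowering) (hg : g ∈ lowering) :
    f * g ∈ lowering :=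
  fun n b hb => hg n _ (barLt_mono (Nat.le_succ n) (hf n b hb))

theorem contrBar_mem_lowering (i j : ZMod 5) : OpEnd.mk (contrBar i j) ∈ lowering := by
  intro n b hb w hw
  change cf (contrBar i j b : NC LetterM) w = 0
  rw [cf_contrBar]
  exact Finset.sum_eq_zero fun a _ => by
    rw [hb (a :: w) (by simpa using hw), mul_zero]

section

attribute [local instance 100] LieRing.ofAssociativeRing

def loweringLie : LieSubalgebra ℚ OpEnd :=
  { lowering with
    lie_mem' := by
      intro f g hf hg
      change ⁅f, g⁆ ∈ lowering
      rw [LieRing.of_associative_ring_bracket]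
      exact lowering.sub_mem (lowering_mul hf hg) (lowering_mul hg hf) }

theorem mem_loweringLie {f : OpEnd} : f ∈ loweringLie ↔ f ∈ lowering := Iff.rfl

def actGen (p : ZMod 5 × ZMod 5) : loweringLie :=
  ⟨OpEnd.mk (contrBar p.1 p.2), mem_loweringLie.2 (contrBar_mem_lowering p.1 p.2)⟩

def actFree' : FreeT →ₗ⁅ℚ⁆ loweringLie := FreeLieAlgebra.lift ℚ actGen

theorem actFree_eq : actFree = loweringLie.incl.comp actFree' := by
  apply FreeLieAlgebra.hom_ext
  intro p
  rw [LieHom.comp_apply, actFree', FreeLieAlgebra.lift_of_apply]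
  exact actFree_freeT p.1 p.2

theorem actP5_mem (y : P5) : actP5 y ∈ lowering := by
  obtain ⟨x, rfl⟩ := LieSubmodule.Quotient.surjective_mk' idealP5 y
  have h : actP5 (LieSubmodule.Quotient.mk' idealP5 x) = actFree x := rfl
  rw [h, actFree_eq, LieHom.comp_apply]
  exact mem_loweringLie.1 (actFree' x).2

end

section

attribute [local instance 100] LieRing.ofAssociativeRing

theorem eq_top_of_ι_mem (S : Subalgebra ℚ UP5)
    (hS : ∀ y : P5, UniversalEnvelopingAlgebra.ι ℚ y ∈ S) (x : UP5) : x ∈ S := by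
  let f : P5 →ₗ⁅ℚ⁆ S :=
    { toFun := fun y => ⟨UniversalEnvelopingAlgebra.ι ℚ y, hS y⟩
      map_add' := fun a b => Subtype.ext (map_add _ a b)
      map_smul' := fun c a => Subtype.ext (map_smul (UniversalEnvelopingAlgebra.ι ℚ) c a)
      map_lie' := fun {a b} => Subtype.ext (LieHom.map_lie (UniversalEnvelopingAlgebra.ι ℚ) a b) }
  have h : S.val.comp (UniversalEnvelopingAlgebra.lift ℚ f) = AlgHom.id ℚ UP5 := by
    apply UniversalEnvelopingAlgebra.hom_ext
    refine LieHom.ext fun y => ?_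
    change ((UniversalEnvelopingAlgebra.lift ℚ f) (UniversalEnvelopingAlgebra.ι ℚ y) : UP5) = _
    rw [UniversalEnvelopingAlgebra.lift_ι_apply]
    rfl
  have hx := congrArg (fun g : UP5 →ₐ[ℚ] UP5 => g x) h
  change ((UniversalEnvelopingAlgebra.lift ℚ f) x : UP5) = x at hx
  rw [← hx]
  exact Subtype.property _

theorem act_ι (y : P5) : act (UniversalEnvelopingAlgebra.ι ℚ y) = actP5 y := by
  rw [act, UniversalEnvelopingAlgebra.lift_ι_apply]

theorem augP5_ι (y : P5) : augP5 (UniversalEnvelopingAlgebra.ι ℚ y) = 0 := by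
  rw [augP5, UniversalEnvelopingAlgebra.lift_ι_apply, LieHom.zero_apply]

theorem exists_ι_mem (S : Set UP5)
    (hS : ∀ x : UP5, act x ∈ lowering → augP5 x = 0 → x ∈ S) (y : P5) :
    UniversalEnvelopingAlgebra.ι ℚ y ∈ S :=
  hS _ (by rw [act_ι]; exact actP5_mem y) (augP5_ι y)

end

theorem mul_sub_central {R : Type} [Ring R] (a b p q : R) (ha : q * a = a * q)
    (hp : q * p = p * q) :
    a * b - p * q = (a - p) * (b - q) + q * (a - p) + p * (b - q) := by
  rw [mul_sub q, ha, hp]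
  noncomm_ring

theorem toEnd_eq_add (f : OpEnd) (c : ℚ) (b : Bar) :
    f.toEnd b = (f - algebraMap ℚ OpEnd c).toEnd b + c • b := by
  change f.toEnd b = (f.toEnd b - c • b) + c • b
  rw [sub_add_cancel]

/-- The elements of `U𝔓_5` that act as their augmentation up to lower degree (all of them). -/
def unipotent : Subalgebra ℚ UP5 where
  carrier := {x | act x - algebraMap ℚ _ (augP5 x) ∈ lowering}
  mul_mem' := by
    intro x y hx hy
    have : act (x * y) - algebraMap ℚ _ (augP5 (x * y)) =
        (act x - algebraMap ℚ _ (augP5 x)) * (act y - algebraMap ℚ _ (augP5 y)) +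
        (augP5 y) • (act x - algebraMap ℚ _ (augP5 x)) +
        (augP5 x) • (act y - algebraMap ℚ _ (augP5 y)) := by
      rw [map_mul, map_mul, map_mul, Algebra.smul_def, Algebra.smul_def]
      exact mul_sub_central _ _ _ _ (Algebra.commutes _ _) (Algebra.commutes _ _)
    change _ ∈ lowering
    rw [this]
    exact lowering.add_mem (lowering.add_mem (lowering_mul hx hy) (lowering.smul_mem _ hx))
      (lowering.smul_mem _ hy)
  add_mem' := by
    intro x y hx hy
    have : act (x + y) - algebraMap ℚ _ (augP5 (x + y)) =
        (act x - algebraMap ℚ _ (augP5 x)) + (act y - algebraMap ℚ _ (augP5 y)) := by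
      simp only [map_add]; abel
    change _ ∈ lowering
    rw [this]
    exact lowering.add_mem hx hy
  algebraMap_mem' := by
    intro r
    change _ ∈ lowering
    rw [AlgHom.commutes, AlgHom.commutes, Algebra.algebraMap_self_apply, sub_self]
    exact lowering.zero_mem

theorem mem_unipotent (x : UP5) : x ∈ unipotent :=
  eq_top_of_ι_mem _ (exists_ι_mem _ fun x hx h0 => by
    change act x - algebraMap ℚ _ (augP5 x) ∈ lowering
    rwa [h0, map_zero, sub_zero]) x

theorem act_lowers (n : ℕ) : ∀ x ∈ augIdeal ^ n, ∀ k, ∀ b ∈ barLt (n + k),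
    (act x).toEnd b ∈ barLt k := by
  induction n with
  | zero =>
    intro x _ k b hb
    rw [zero_add] at hb
    have h1 := mem_unipotent x
    rw [toEnd_eq_add (act x) (augP5 x) b]
    exact (barLt k).add_mem (h1 k b (barLt_mono (Nat.le_succ k) hb)) ((barLt k).smul_mem _ hb)
  | succ n ih =>
    intro x hx k b hb
    rw [Ideal.IsTwoSided.pow_succ] at hx
    induction hx using Submodule.mul_induction_on' with
    | mem_mul_mem a ha c hc =>
      have h1 := mem_unipotent a
      have h0 : augP5 a = 0 := ha
      change _ ∈ lowering at h1
      rw [h0, map_zero, sub_zero] at h1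
      rw [map_mul]
      exact ih c hc k _ (h1 (n + k) b (by rwa [add_right_comm] at hb))
    | add a _ c _ h1 h2 =>
      rw [map_add]
      exact (barLt k).add_mem h1 h2

/-- A strict upper bound for the degree of `b`. -/
def degBound (b : Bar) : ℕ := (b : NC LetterM).coeff.support.sup (fun w => w.length) + 1

theorem mem_barLt_degBound (b : Bar) : b ∈ barLt (degBound b) := by
  intro w hw
  by_contra h
  have := Finset.le_sup (f := fun w : FreeMonoid LetterM => w.length) (Finsupp.mem_support_iff.2 h)
  have hw' : degBound b ≤ (FreeMonoid.ofList w).length := hw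
  unfold degBound at hw'
  omega

theorem pairU_eq_zero (b : Bar) (x : UP5) (hx : x ∈ augIdeal ^ degBound b) : pairU b x = 0 :=
  act_lowers (degBound b) x hx 0 b (mem_barLt_degBound b) [] le_rfl

/-- The pairing `⟨b | ψ⟩` of `ℬ` with the completion of `U𝔓_5`: it is `⟨b | x⟩` for any `x ∈ U𝔓_5`
that is congruent to `ψ` modulo terms of degree greater than the degree of `b`. -/
def pairB (b : Bar) (ψ : UP5Hat) : ℚ :=
  QuotientAddGroup.lift (augIdeal ^ degBound b).toAddSubgroup (pairU b) (pairU_eq_zero b)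
    (ψ.1 (degBound b))

end KeyFormula

open KeyFormula

/-!
A series `φ ∈ exp [𝔣̂_2, 𝔣̂_2]` enters only through two properties: its coefficients form a character
of the shuffle algebra (`commGroupLike_isShuffleChar`), and they vanish on letters
(`commGroupLike_letter`).  Primitive series act on words as derivations of the shuffle product, and
the exponential of a derivation is multiplicative.  From the two properties, `φ` vanishes on
`f_1 ⋯ f_1 ⧢ w`, and by Taylor expansion `φ(a, b + c) = φ(a, b)` whenever `c` commutes with `a`
and `b` (`IsShuffleChar.evDeg_translate`).

In `U𝔓_5` one has `t_{15} = t_{23} + t_{24} + t_{34}`, where `t_{34}` commutes with `t_{21}` and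
`t_{23} + t_{24}`, and `t_{15}` commutes with `t_{23}` and `t_{24}`.  Hence, with
`f_0, f_z, f_1 = t_{21}, t_{23}, t_{24}`,
`φ_{215} = φ(f_0, f_z + f_1)` and `φ_{243} = φ(f_1, -f_1 - f_z)`,
so that `φ_{243}⁻¹ φ_{215}` is a series in `t_{21}, t_{23}, t_{24}` only, while `φ_{534}` is a series in
`t_{53}, t_{34}`.  The map `dec_2` is the transpose of the multiplication of words in these two sets
of generators (`pairU_eq_cfT`), so the right-hand side is the coefficient `⟨l | Θ⟩` of
`Θ = φ(f_1, -f_1 - f_z)⁻¹ φ(f_0, f_z + f_1)` (`pairB_evHat`).  This uses that `l ⊗ 1` is in the image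
of `dec_2`; a preimage is written down through the action of `U𝔓_5` on its quotient by the left ideal
that `t_{53}` and `t_{34}` generate (`exists_dec2`).

Both sides are then compared on shuffle products `l = u ⧢ v` with `u ∈ 𝒜_z^{-2}` and
`v ∈ 𝒜_z^0 ∩ ℚ⟨e_1, e_z⟩`, which span `𝒜_z^0` (`az0_le_range`).  As the first factor of `Θ` involves
only `f_1` and `f_z`, and the words of `u` begin with `e_0`,
`⟨u ⧢ v | Θ⟩ = ⟨u | φ(f_0, f_z + f_1)⟩ ⟨v | φ(f_1, -f_1 - f_z)⁻¹⟩` (`ofWords_mulS_sh`).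
The second factor is `⟨τ_z v | φ(f_0, f_z + f_1)⟩`, since the inverse of a group-like series is its
antipode (`ofWords_pullTau`, `pullTau_eq`).  The product is therefore
`⟨u ⧢ τ_z v | φ(f_0, f_z + f_1)⟩`, and `const ∘ reg_z` does not change this coefficient because
`φ(f_0, f_z + f_1)` has no linear term in `f_z` (`pairA_lam`).

The isomorphisms `reg_{z,1}`, `reg_z` and `dec_2⁻¹` enter only as some preimage; each argument works
for every preimage, so that only the surjectivity of the three maps is needed.
-/

namespace KeyFormula

/-! ### Words as a basis and as coordinates -/

section Words

variable {X : Type}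

theorem ofWords_word {M : Type} [AddCommGroup M] [Module ℚ M] (f : List X → M) (w : List X) :
    ofWords f (word w) = f w := by
  simp [ofWords, word]

theorem word_mul (u v : List X) : (word u * word v : NC X) = word (u ++ v) := by
  simp [word, MonoidAlgebra.single_mul_single]

theorem word_nil : (word [] : NC X) = 1 := rfl

theorem word_cons (a : X) (u : List X) : (word (a :: u) : NC X) = word [a] * word u := by
  rw [word_mul]; rfl

theorem linear_ext {M : Type} [AddCommGroup M] [Module ℚ M] {f g : NC X →ₗ[ℚ] M}
    (h : ∀ w, f (word w) = g (word w)) : f = g := by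
  refine LinearMap.ext fun p => ?_
  induction p using MonoidAlgebra.induction_linear with
  | zero => simp
  | add a b ha hb => simp [ha, hb]
  | single w r =>
    have : (MonoidAlgebra.single w r : NC X) = r • word w.toList := by
      simp [word]
    rw [this, map_smul, map_smul, h]

theorem bilinear_ext {Y M : Type} [AddCommGroup M] [Module ℚ M] {f g : NC X →ₗ[ℚ] NC Y →ₗ[ℚ] M}
    (h : ∀ u v, f (word u) (word v) = g (word u) (word v)) : f = g :=
  linear_ext fun u => linear_ext fun v => h u v

theorem span_word : Submodule.span ℚ (Set.range (word : List X → NC X)) = ⊤ := by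
  refine Submodule.eq_top_iff'.2 fun p => ?_
  induction p using MonoidAlgebra.induction_linear with
  | zero => exact zero_mem _
  | add a b ha hb => exact add_mem ha hb
  | single w r =>
    have : (MonoidAlgebra.single w r : NC X) = r • word w.toList := by
      simp [word]
    rw [this]
    exact Submodule.smul_mem _ _ (Submodule.subset_span ⟨_, rfl⟩)

theorem cf_word [DecidableEq X] (u w : List X) :
    cf (word u : NC X) w = if u = w then 1 else 0 := by
  exact @Finsupp.single_apply (FreeMonoid X) ℚ _ (FreeMonoid.ofList u) (FreeMonoid.ofList w) 1
    (inferInstanceAs (Decidable (u = w)))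

/-- The coefficient of a word as a linear form. -/
def cfL (w : List X) : NC X →ₗ[ℚ] ℚ where
  toFun p := cf p w
  map_add' _ _ := rfl
  map_smul' _ _ := rfl

theorem cfL_apply (w : List X) (p : NC X) : cfL w p = cf p w := rfl

theorem NC_ext {p q : NC X} (h : ∀ w, cf p w = cf q w) : p = q :=
  MonoidAlgebra.ext (Finsupp.ext fun w => h w.toList)

theorem ofLetters_word {R : Type} [Ring R] [Algebra ℚ R] (f : X → R) (w : List X) :
    ofLetters f (word w) = (w.map f).prod := by
  simp [ofLetters, word, FreeMonoid.lift_apply]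

/-- The noncommutative polynomials all of whose words satisfy `P`. -/
def wordSpan (P : List X → Prop) : Submodule ℚ (NC X) where
  carrier := {p | ∀ w, cf p w ≠ 0 → P w}
  add_mem' := by
    intro p q hp hq w hw
    by_cases h : cf p w = 0
    · refine hq w fun h' => hw ?_
      change cf p w + cf q w = 0
      rw [h, h', add_zero]
    · exact hp w h
  zero_mem' := fun _ hw => absurd rfl hw
  smul_mem' := by
    intro c p hp w hw
    refine hp w fun h => hw ?_
    change c * cf p w = 0
    rw [h, mul_zero]

theorem wordSpan_eq_span (P : List X → Prop) :
    wordSpan P = Submodule.span ℚ {p | ∃ w, P w ∧ p = word w} := by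
  classical
  apply le_antisymm
  · intro p hp
    have h : p = ∑ w ∈ p.coeff.support, p.coeff w • word w.toList := by
      refine NC_ext fun v => ?_
      rw [← cfL_apply, ← cfL_apply, map_sum]
      simp only [map_smul, cfL_apply, cf_word, smul_eq_mul, mul_ite, mul_one, mul_zero]
      rw [Finset.sum_eq_single (FreeMonoid.ofList v)]
      · exact (if_pos rfl).symm
      · exact fun w _ hw => if_neg hw
      · exact fun h => by rw [Finsupp.notMem_support_iff.1 h, ite_self]
    rw [h]
    exact Submodule.sum_mem _ fun w hw => Submodule.smul_mem _ _
      (Submodule.subset_span ⟨w.toList, hp _ (Finsupp.mem_support_iff.1 hw), rfl⟩)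
  · rw [Submodule.span_le]
    rintro _ ⟨w, hw, rfl⟩ v hv
    rw [cf_word] at hv
    have : w = v := by by_contra h; simp [h] at hv
    exact this ▸ hw

theorem word_mem_wordSpan {P : List X → Prop} {w : List X} (hw : P w) : word w ∈ wordSpan P := by
  rw [wordSpan_eq_span]
  exact Submodule.subset_span ⟨w, hw, rfl⟩

theorem wordSpan_le {P : List X → Prop} {S : Submodule ℚ (NC X)} (h : ∀ w, P w → word w ∈ S) :
    wordSpan P ≤ S := by
  rw [wordSpan_eq_span, Submodule.span_le]
  rintro _ ⟨w, hw, rfl⟩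
  exact h w hw

theorem wordSpan_inf (P Q : List X → Prop) :
    wordSpan P ⊓ wordSpan Q = wordSpan fun w => P w ∧ Q w := by
  ext p
  exact ⟨fun h w hw => ⟨h.1 w hw, h.2 w hw⟩,
    fun h => ⟨fun w hw => (h w hw).1, fun w hw => (h w hw).2⟩⟩

/-- A bilinear map sends `wordSpan P × wordSpan Q` into `S` if it does so on words. -/
theorem bilinear_mem {Y M : Type} [AddCommGroup M] [Module ℚ M] {P : List X → Prop}
    {Q : List Y → Prop} {S : Submodule ℚ M} (f : NC X →ₗ[ℚ] NC Y →ₗ[ℚ] M)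
    (h : ∀ u v, P u → Q v → f (word u) (word v) ∈ S) {p : NC X} {q : NC Y}
    (hp : p ∈ wordSpan P) (hq : q ∈ wordSpan Q) : f p q ∈ S := by
  have h1 : ∀ u, P u → wordSpan Q ≤ S.comap (f (word u)) := fun u hu =>
    wordSpan_le fun v hv => h u v hu hv
  have h2 : wordSpan P ≤ S.comap (f.flip q) := wordSpan_le fun u hu => h1 u hu hq
  exact h2 hp

/-- `x⁻¹ φ`: the coefficients of `φ` on the words that begin with the letter `x`. -/
def der (x : X) (φ : List X → ℚ) : List X → ℚ := fun w => φ (x :: w)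

theorem ofWords_letter_mul (φ : List X → ℚ) (x : X) (p : NC X) :
    ofWords φ (word [x] * p) = ofWords (der x φ) p := by
  have : ofWords φ ∘ₗ LinearMap.mulLeft ℚ (word [x]) = ofWords (der x φ) :=
    linear_ext fun w => by
      simp [← word_cons, ofWords_word, der]
  exact LinearMap.congr_fun this p

/-! ### The shuffle product -/

/-- The shuffle product as a bilinear map. -/
def sh : NC X →ₗ[ℚ] NC X →ₗ[ℚ] NC X := ofWords fun u => ofWords fun v => shuffleWords u v

theorem sh_word (u v : List X) : sh (word u) (word v) = shuffleWords u v := by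
  rw [sh, ofWords_word, ofWords_word]

theorem shuffleWords_nil_left (v : List X) : shuffleWords [] v = word v := by
  rw [shuffleWords]

theorem shuffleWords_nil_right (u : List X) : shuffleWords u [] = word u := by
  cases u <;> rw [shuffleWords]

theorem shuffleWords_cons_cons (a b : X) (u v : List X) :
    shuffleWords (a :: u) (b :: v) =
      word [a] * shuffleWords u (b :: v) + word [b] * shuffleWords (a :: u) v := by
  rw [shuffleWords]

theorem sh_one_left (p : NC X) : sh 1 p = p := by
  have : sh (1 : NC X) = LinearMap.id := linear_ext fun w => by
    rw [← word_nil, sh_word, shuffleWords_nil_left]; rfl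
  rw [this]; rfl

theorem sh_one_right (p : NC X) : sh p 1 = p := by
  have : sh.flip (1 : NC X) = LinearMap.id := linear_ext fun w => by
    rw [LinearMap.flip_apply, ← word_nil, sh_word, shuffleWords_nil_right]; rfl
  exact LinearMap.congr_fun this p

theorem shuffleWords_comm : ∀ u v : List X, shuffleWords u v = shuffleWords v u
  | [], v => by rw [shuffleWords_nil_left, shuffleWords_nil_right]
  | a :: u, [] => by rw [shuffleWords_nil_left, shuffleWords_nil_right]
  | a :: u, b :: v => by
    rw [shuffleWords_cons_cons, shuffleWords_cons_cons, shuffleWords_comm u (b :: v),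
      shuffleWords_comm (a :: u) v, add_comm]
termination_by u v => u.length + v.length

theorem sh_comm (p q : NC X) : sh p q = sh q p := by
  have : (sh : NC X →ₗ[ℚ] _) = sh.flip := bilinear_ext fun u v => by
    rw [LinearMap.flip_apply, sh_word, sh_word, shuffleWords_comm]
  exact LinearMap.congr_fun (LinearMap.congr_fun this p) q

theorem letter_mul_mem {P Q : List X → Prop} {a : X} (h : ∀ w, Q w → P (a :: w)) {p : NC X}
    (hp : p ∈ wordSpan Q) : word [a] * p ∈ wordSpan P := by
  have : wordSpan Q ≤ (wordSpan P).comap (LinearMap.mulLeft ℚ (word [a])) :=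
    wordSpan_le fun w hw => by
      rw [Submodule.mem_comap, LinearMap.mulLeft_apply, ← word_cons]
      exact word_mem_wordSpan (h w hw)
  exact this hp

theorem shuffleWords_mem_length : ∀ u v : List X,
    shuffleWords u v ∈ wordSpan fun w => w.length = u.length + v.length
  | [], v => by rw [shuffleWords_nil_left]; exact word_mem_wordSpan (by simp)
  | a :: u, [] => by rw [shuffleWords_nil_right]; exact word_mem_wordSpan (by simp)
  | a :: u, b :: v => by
    rw [shuffleWords_cons_cons]
    exact add_mem
      (letter_mul_mem (fun w hw => by simp [hw]; omega) (shuffleWords_mem_length u (b :: v)))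
      (letter_mul_mem (fun w hw => by simp [hw]; omega) (shuffleWords_mem_length (a :: u) v))
termination_by u v => u.length + v.length

end Words

section SeriesOperators

variable {X : Type}

/-! ### Series as operators on words -/

/-- The unit series. -/
def oneS : List X → ℚ := fun w => if w.length = 0 then 1 else 0

/-- The concatenation product of series in the letters `X`. -/
def mulS (φ ψ : List X → ℚ) : List X → ℚ :=
  fun w => ∑ k ∈ Finset.range (w.length + 1), φ (w.take k) * ψ (w.drop k)

theorem mulS_nil (φ ψ : List X → ℚ) : mulS φ ψ [] = φ [] * ψ [] := by
  simp [mulS]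

theorem der_mulS (x : X) (φ ψ : List X → ℚ) :
    der x (mulS φ ψ) = φ [] • der x ψ + mulS (der x φ) ψ := by
  funext w
  simp only [der, mulS, List.length_cons, Pi.add_apply, Pi.smul_apply, smul_eq_mul]
  rw [Finset.sum_range_succ', add_comm]
  simp

/-- The operator `w ↦ ∑ ψ(w') w''` over the factorizations `w = w' w''`: the transpose of the
left multiplication by the series `ψ`. -/
def lop (ψ : List X → ℚ) : NC X →ₗ[ℚ] NC X :=
  ofWords fun w => ∑ k ∈ Finset.range (w.length + 1), ψ (w.take k) • word (w.drop k)

theorem lop_nil (ψ : List X → ℚ) : lop ψ (word []) = ψ [] • word [] := by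
  simp [lop, ofWords_word]

theorem lop_cons (ψ : List X → ℚ) (x : X) (w : List X) :
    lop ψ (word (x :: w)) = ψ [] • word (x :: w) + lop (der x ψ) (word w) := by
  simp only [lop, ofWords_word, List.length_cons, der]
  rw [Finset.sum_range_succ', add_comm]
  simp

theorem lop_letter_mul (ψ : List X → ℚ) (x : X) (p : NC X) :
    lop ψ (word [x] * p) = ψ [] • (word [x] * p) + lop (der x ψ) p := by
  have : lop ψ ∘ₗ LinearMap.mulLeft ℚ (word [x]) =
      ψ [] • LinearMap.mulLeft ℚ (word [x]) + lop (der x ψ) :=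
    linear_ext fun w => by
      simp [← word_cons, lop_cons]
  exact LinearMap.congr_fun this p

theorem lop_add (φ ψ : List X → ℚ) : lop (φ + ψ) = lop φ + lop ψ :=
  linear_ext fun w => by
    simp [lop, ofWords_word, add_smul, Finset.sum_add_distrib]

theorem lop_smul (c : ℚ) (ψ : List X → ℚ) : lop (c • ψ) = c • lop ψ :=
  linear_ext fun w => by
    simp [lop, ofWords_word, mul_smul, Finset.smul_sum]

theorem lop_zero : lop (0 : List X → ℚ) = 0 :=
  linear_ext fun w => by simp [lop, ofWords_word]

theorem lop_sub (φ ψ : List X → ℚ) : lop (φ - ψ) = lop φ - lop ψ :=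
  linear_ext fun w => by
    simp [lop, ofWords_word, sub_smul, Finset.sum_sub_distrib]

theorem lop_one : lop (oneS : List X → ℚ) = LinearMap.id :=
  linear_ext fun w => by
    cases w with
    | nil => simp [lop_nil, oneS]
    | cons x w =>
      have : der x (oneS : List X → ℚ) = 0 := by funext v; simp [der, oneS]
      rw [lop_cons, this, lop_zero]
      simp [oneS]

theorem lop_mulS (φ ψ : List X → ℚ) : lop (mulS φ ψ) = lop ψ ∘ₗ lop φ :=
  linear_ext fun w => by
    rw [LinearMap.comp_apply]
    induction w generalizing φ with
    | nil => rw [lop_nil, lop_nil, map_smul, lop_nil, mulS_nil, mul_smul]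
    | cons x w ih =>
      rw [lop_cons, lop_cons, map_add, map_smul, lop_cons, ← ih, der_mulS, lop_add, lop_smul,
        mulS_nil, smul_add, mul_smul, LinearMap.add_apply, LinearMap.smul_apply, add_assoc]

theorem cf_word_self (w : List X) : cf (word w : NC X) w = 1 := by
  classical
  rw [cf_word, if_pos rfl]

theorem cf_word_cons_nil (x : X) (w : List X) : cf (word (x :: w) : NC X) [] = 0 := by
  classical
  rw [cf_word, if_neg (List.cons_ne_nil x w)]

theorem cfL_nil_lop (ψ : List X → ℚ) : cfL [] ∘ₗ lop ψ = ofWords ψ :=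
  linear_ext fun w => by
    rw [LinearMap.comp_apply, ofWords_word]
    induction w generalizing ψ with
    | nil => rw [lop_nil, map_smul, cfL_apply, cf_word_self, smul_eq_mul, mul_one]
    | cons x w ih =>
      rw [lop_cons, map_add, map_smul, ih, cfL_apply, cf_word_cons_nil, smul_zero, zero_add]
      rfl

theorem cf_nil_lop (ψ : List X → ℚ) (p : NC X) : cf (lop ψ p) [] = ofWords ψ p := by
  rw [← cfL_nil_lop, LinearMap.comp_apply, cfL_apply]

theorem lop_injective {φ ψ : List X → ℚ} (h : lop φ = lop ψ) : φ = ψ := by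
  funext w
  rw [← ofWords_word φ, ← ofWords_word ψ, ← cf_nil_lop, ← cf_nil_lop, h]

theorem mulS_assoc (a b c : List X → ℚ) : mulS (mulS a b) c = mulS a (mulS b c) :=
  lop_injective (by rw [lop_mulS, lop_mulS, lop_mulS, lop_mulS, LinearMap.comp_assoc])

theorem one_mulS (a : List X → ℚ) : mulS oneS a = a :=
  lop_injective (by rw [lop_mulS, lop_one, LinearMap.comp_id])

theorem lop_congr {φ ψ : List X → ℚ} {N : ℕ} (h : ∀ w, w.length < N → φ w = ψ w) {p : NC X}
    (hp : p ∈ wordSpan fun w => w.length < N) : lop φ p = lop ψ p := by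
  have : wordSpan (fun w : List X => w.length < N) ≤ LinearMap.eqLocus (lop φ) (lop ψ) :=
    wordSpan_le fun w hw => by
      change lop φ _ = lop ψ _
      rw [lop, lop, ofWords_word, ofWords_word]
      refine Finset.sum_congr rfl fun k _ => ?_
      rw [h _ (lt_of_le_of_lt (by simp) hw)]
  exact this hp

/-! ### Primitive series and characters of the shuffle algebra -/

/-- The primitive series, encoded as the series without constant term that act on words as
derivations of the shuffle product. -/
def prim : Submodule ℚ (List X → ℚ) where
  carrier := {ψ | ψ [] = 0 ∧
    ∀ u v, lop ψ (sh (word u) (word v)) =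
      sh (lop ψ (word u)) (word v) + sh (word u) (lop ψ (word v))}
  add_mem' := by
    rintro a b ⟨ha, ha'⟩ ⟨hb, hb'⟩
    refine ⟨by simp [ha, hb], fun u v => ?_⟩
    simp only [lop_add, LinearMap.add_apply, map_add, ha', hb']
    abel
  zero_mem' := ⟨rfl, fun u v => by simp [lop_zero]⟩
  smul_mem' := by
    rintro c a ⟨ha, ha'⟩
    refine ⟨by simp [ha], fun u v => ?_⟩
    simp only [lop_smul, LinearMap.smul_apply, map_smul, ha', smul_add]

theorem lop_sh {ψ : List X → ℚ} (h : ψ ∈ prim) (p q : NC X) :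
    lop ψ (sh p q) = sh (lop ψ p) q + sh p (lop ψ q) := by
  have : sh.compr₂ (lop ψ) = sh.comp (lop ψ) + sh.compl₂ (lop ψ) :=
    bilinear_ext fun u v => h.2 u v
  exact LinearMap.congr_fun (LinearMap.congr_fun this p) q

theorem bracket_mem_prim {a b : List X → ℚ} (ha : a ∈ prim) (hb : b ∈ prim) :
    mulS a b - mulS b a ∈ prim := by
  refine ⟨by simp [mulS_nil, mul_comm], fun u v => ?_⟩
  simp only [lop_sub, lop_mulS, LinearMap.sub_apply, LinearMap.comp_apply, lop_sh ha, lop_sh hb,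
    map_add, map_sub]
  abel

/-- The operator of a letter removes it from the beginning of a word, so it is a derivation by the
recursive definition of the shuffle product. -/
theorem letter_mem_prim (a : X) :
    (fun w => cf (word [a] : NC X) w) ∈ (prim : Submodule ℚ (List X → ℚ)) := by
  classical
  have h0 : cf (word [a] : NC X) [] = 0 := by rw [cf_word]; simp
  have h1 : lop (fun w => cf (word [a] : NC X) w) (word []) = 0 := by
    rw [lop_nil, h0, zero_smul]
  have h2 : ∀ x w, lop (fun w => cf (word [a] : NC X) w) (word (x :: w)) =
      if a = x then word w else 0 := by
    intro x w
    rw [lop_cons, h0, zero_smul, zero_add]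
    split_ifs with hx
    · have : der x (fun w => cf (word [a] : NC X) w) = oneS := by
        funext v
        simp [der, cf_word, oneS, hx, eq_comm]
      rw [this, lop_one]; rfl
    · have : der x (fun w => cf (word [a] : NC X) w) = 0 := by
        funext v
        simp [der, cf_word, hx]
      rw [this, lop_zero]; rfl
  have h3 : ∀ x p, lop (fun w => cf (word [a] : NC X) w) (word [x] * p) =
      if a = x then p else 0 := by
    intro x p
    have : lop (fun w => cf (word [a] : NC X) w) ∘ₗ LinearMap.mulLeft ℚ (word [x]) =
        if a = x then LinearMap.id else 0 := linear_ext fun w => by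
      rw [LinearMap.comp_apply, LinearMap.mulLeft_apply, ← word_cons, h2]
      split_ifs <;> rfl
    have := LinearMap.congr_fun this p
    rw [LinearMap.comp_apply, LinearMap.mulLeft_apply] at this
    rw [this]
    split_ifs <;> rfl
  refine ⟨h0, fun u v => ?_⟩
  cases u with
  | nil => rw [h1, word_nil]; simp [sh_one_left]
  | cons x u =>
    cases v with
    | nil => rw [h1, word_nil]; simp [sh_one_right]
    | cons y v =>
      rw [sh_word, shuffleWords_cons_cons, map_add, h3, h3, h2, h2, ← sh_word, ← sh_word]
      split_ifs <;> simp

/-- The characters of the shuffle algebra, that is, the group-like series. -/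
structure IsShuffleChar (φ : List X → ℚ) : Prop where
  nil : φ [] = 1
  map_sh : ∀ p q, ofWords φ (sh p q) = ofWords φ p * ofWords φ q

theorem cf_nil_sh (p q : NC X) : cf (sh p q) [] = cf p [] * cf q [] := by
  classical
  have h0 : ∀ (x : X) (p : NC X), cfL [] (word [x] * p) = 0 := by
    intro x p
    have : cfL [] ∘ₗ LinearMap.mulLeft ℚ (word [x]) = 0 := linear_ext fun w => by
      rw [LinearMap.comp_apply, LinearMap.mulLeft_apply, ← word_cons, cfL_apply, cf_word]
      simp
    exact LinearMap.congr_fun this p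
  have : sh.compr₂ (cfL ([] : List X)) = (LinearMap.mul ℚ ℚ).compl₁₂ (cfL []) (cfL []) :=
    bilinear_ext fun u v => by
      simp only [LinearMap.compr₂_apply, LinearMap.compl₁₂_apply, LinearMap.mul_apply', sh_word]
      rcases u with _ | ⟨x, u⟩
      · rw [shuffleWords_nil_left, cfL_apply, cfL_apply, cf_word, cf_word]; simp
      · rcases v with _ | ⟨y, v⟩
        · rw [shuffleWords_nil_right, cfL_apply, cfL_apply, cf_word, cf_word]; simp
        · rw [shuffleWords_cons_cons, map_add, h0, h0, cfL_apply, cf_word]; simp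
  exact LinearMap.congr_fun (LinearMap.congr_fun this p) q

theorem lop_pow_sh {ψ : List X → ℚ} (h : ψ ∈ prim) (n : ℕ) (p q : NC X) :
    (lop ψ ^ n) (sh p q) = ∑ ij ∈ Finset.HasAntidiagonal.antidiagonal n,
      n.choose ij.1 • sh ((lop ψ ^ ij.1) p) ((lop ψ ^ ij.2) q) := by
  induction n with
  | zero => simp
  | succ n ih =>
    rw [Finset.sum_antidiagonal_choose_succ_nsmul
      (fun i j => sh ((lop ψ ^ i) p) ((lop ψ ^ j) q)), pow_succ', Module.End.mul_apply, ih, map_sum,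
      ← Finset.sum_add_distrib]
    refine Finset.sum_congr rfl fun ij hij => ?_
    have hc : n.choose ij.2 = n.choose ij.1 := by
      rw [← Finset.HasAntidiagonal.mem_antidiagonal.1 hij]
      exact Nat.choose_symm_add.symm
    rw [map_nsmul, lop_sh h, hc, ← nsmul_add, pow_succ' _ ij.1, pow_succ' _ ij.2,
      Module.End.mul_apply, Module.End.mul_apply, add_comm]

theorem sum_antidiagonal_eq_mul (g h : ℕ → ℚ) (p q : ℕ) (hg : ∀ i, p < i → g i = 0)
    (hh : ∀ j, q < j → h j = 0) :
    ∑ n ∈ Finset.range (p + q + 1), ∑ ij ∈ Finset.HasAntidiagonal.antidiagonal n, g ij.1 * h ij.2 =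
      (∑ i ∈ Finset.range (p + 1), g i) * ∑ j ∈ Finset.range (q + 1), h j := by
  classical
  -- both sides are the value at `1` of a product of polynomials with coefficients `g` and `h`
  let P : ℕ → (ℕ → ℚ) → Polynomial ℚ := fun p g =>
    ∑ i ∈ Finset.range (p + 1), Polynomial.monomial i (g i)
  have hP : ∀ (p : ℕ) (g : ℕ → ℚ), (∀ i, p < i → g i = 0) → ∀ i, (P p g).coeff i = g i := by
    intro p g hg i
    simp only [P, Polynomial.finsetSum_coeff, Polynomial.coeff_monomial, Finset.sum_ite_eq',
      Finset.mem_range]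
    split_ifs with hi
    · rfl
    · exact (hg i (by omega)).symm
  have hd : ∀ (p : ℕ) (g : ℕ → ℚ), (P p g).natDegree ≤ p := fun p g =>
    Polynomial.natDegree_sum_le_of_forall_le _ _ fun i hi =>
      (Polynomial.natDegree_monomial_le _).trans (by simpa [Nat.lt_succ_iff] using hi)
  have he : ∀ (p : ℕ) (g : ℕ → ℚ), (P p g).eval 1 = ∑ i ∈ Finset.range (p + 1), g i := by
    intro p g
    simp [P, Polynomial.eval_finsetSum]
  rw [← he p, ← he q, ← Polynomial.eval_mul, Polynomial.eval_eq_sum_range' (n := p + q + 1)]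
  · refine Finset.sum_congr rfl fun n _ => ?_
    rw [one_pow, mul_one, Polynomial.coeff_mul]
    exact Finset.sum_congr rfl fun ij _ => by rw [hP p g hg, hP q h hh]
  · exact lt_of_le_of_lt Polynomial.natDegree_mul_le (by have := hd p g; have := hd q h; omega)

theorem lop_mem_length {ψ : List X → ℚ} (h : ψ [] = 0) {n : ℕ} {p : NC X}
    (hp : p ∈ wordSpan fun w => w.length < n + 1) : lop ψ p ∈ wordSpan fun w => w.length < n := by
  have : wordSpan (fun w : List X => w.length < n + 1) ≤
      (wordSpan fun w => w.length < n).comap (lop ψ) := wordSpan_le fun w hw => by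
    rw [Submodule.mem_comap]
    induction w generalizing ψ n with
    | nil => rw [lop_nil, h, zero_smul]; exact zero_mem _
    | cons x w _ =>
      rw [lop_cons, h, zero_smul, zero_add, lop, ofWords_word]
      refine Submodule.sum_mem _ fun k _ => Submodule.smul_mem _ _ (word_mem_wordSpan ?_)
      simp only [List.length_cons, List.length_drop] at hw ⊢
      omega
  exact this hp

theorem lop_pow_eq_zero {ψ : List X → ℚ} (h : ψ [] = 0) (n : ℕ) {p : NC X}
    (hp : p ∈ wordSpan fun w => w.length < n) : (lop ψ ^ n) p = 0 := by
  induction n generalizing p with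
  | zero =>
    refine NC_ext fun w => ?_
    by_contra hw
    exact absurd (hp w hw) (by omega)
  | succ n ih =>
    rw [pow_succ, Module.End.mul_apply]
    exact ih (lop_mem_length h hp)

/-- The exponential of a series without constant term, through powers of operators: the coefficient of
`w` in `ψ ^ n` is the constant term of `(lop ψ) ^ n w`, and it vanishes for `n > |w|`. -/
def expS (ψ : List X → ℚ) : List X → ℚ :=
  fun w => ∑ n ∈ Finset.range (w.length + 1), cf ((lop ψ ^ n) (word w)) [] / (n.factorial : ℚ)

theorem ofWords_expS {ψ : List X → ℚ} (h : ψ [] = 0) {N : ℕ} {p : NC X}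
    (hp : p ∈ wordSpan fun w => w.length < N) :
    ofWords (expS ψ) p = ∑ n ∈ Finset.range N, cf ((lop ψ ^ n) p) [] / (n.factorial : ℚ) := by
  have : wordSpan (fun w : List X => w.length < N) ≤ LinearMap.eqLocus (ofWords (expS ψ))
      (∑ n ∈ Finset.range N, (n.factorial : ℚ)⁻¹ • cfL [] ∘ₗ (lop ψ ^ n)) :=
    wordSpan_le fun w hw => by
      rw [LinearMap.mem_eqLocus, ofWords_word, expS]
      simp only [LinearMap.sum_apply, LinearMap.smul_apply, LinearMap.comp_apply, cfL_apply,
        smul_eq_mul]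
      rw [← Finset.sum_subset (Finset.range_mono (Nat.succ_le_of_lt hw))]
      · exact Finset.sum_congr rfl fun n _ => by rw [div_eq_inv_mul]
      · intro n _ hn
        rw [lop_pow_eq_zero h n (word_mem_wordSpan (by simpa [Nat.succ_le_iff] using hn)),
          cf, MonoidAlgebra.coeff_zero, Finsupp.zero_apply, mul_zero]
  have := this hp
  rw [LinearMap.mem_eqLocus] at this
  rw [this]
  simp only [LinearMap.sum_apply, LinearMap.smul_apply, LinearMap.comp_apply, cfL_apply,
        smul_eq_mul, div_eq_inv_mul]

/-- The exponential of a primitive series is group-like, by the Leibniz rule. -/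
theorem isShuffleChar_expS {ψ : List X → ℚ} (h : ψ ∈ prim) : IsShuffleChar (expS ψ) := by
  classical
  refine ⟨by simp [expS, cf_word], fun p q => ?_⟩
  have : sh.compr₂ (ofWords (expS ψ)) =
      (LinearMap.mul ℚ ℚ).compl₁₂ (ofWords (expS ψ)) (ofWords (expS ψ)) :=
    bilinear_ext fun u v => by
      simp only [LinearMap.compr₂_apply, LinearMap.compl₁₂_apply, LinearMap.mul_apply']
      have hl : ∀ w : List X, word w ∈ wordSpan fun v => v.length < w.length + 1 := fun w =>
        word_mem_wordSpan (by omega)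
      rw [ofWords_expS h.1 (hl u), ofWords_expS h.1 (hl v),
        ofWords_expS (N := u.length + v.length + 1) h.1, ← sum_antidiagonal_eq_mul]
      · refine Finset.sum_congr rfl fun n _ => ?_
        rw [lop_pow_sh h, ← cfL_apply, map_sum, Finset.sum_div]
        refine Finset.sum_congr rfl fun ij hij => ?_
        rw [← Finset.HasAntidiagonal.mem_antidiagonal.1 hij, map_nsmul, cfL_apply, cf_nil_sh,
          nsmul_eq_mul, Nat.cast_add_choose]
        have := fun i : ℕ => (Nat.cast_ne_zero (R := ℚ)).2 i.factorial_ne_zero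
        field_simp [this]
      · intro i hi
        rw [lop_pow_eq_zero h.1 i (word_mem_wordSpan hi)]; simp [cf]
      · intro i hi
        rw [lop_pow_eq_zero h.1 i (word_mem_wordSpan hi)]; simp [cf]
      · rw [sh_word]
        exact fun w hw => by have := shuffleWords_mem_length u v w hw; omega
  exact LinearMap.congr_fun (LinearMap.congr_fun this p) q

end SeriesOperators

/-! ### Commutator group-like series -/

theorem toSeries_word_mul (u : List Letter) : ∀ v : List Letter,
    toSeries (word u * word v) = mulS (toSeries (word u)) (toSeries (word v)) := by
  classical
  intro v
  have h1 : ∀ u : List Letter, toSeries (word u) = fun w => if u = w then 1 else 0 := fun u => by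
    funext w
    exact cf_word u w
  rw [word_mul]
  simp only [h1]
  funext w
  induction u generalizing w with
  | nil =>
    have : (fun w : List Letter => if [] = w then (1 : ℚ) else 0) = oneS := by
      funext w
      cases w <;> simp [oneS]
    rw [this, one_mulS, List.nil_append]
  | cons a u ih =>
    cases w with
    | nil => simp [mulS_nil]
    | cons x w =>
      have h2 : mulS (fun w => if a :: u = w then (1 : ℚ) else 0) (fun w => if v = w then 1 else 0)
          (x :: w) = mulS (der x (fun w => if a :: u = w then (1 : ℚ) else 0))
            (fun w => if v = w then 1 else 0) w := by
        change der x (mulS _ _) w = _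
        rw [der_mulS]
        simp
      rw [h2]
      by_cases hx : a = x
      · have : der x (fun w => if a :: u = w then (1 : ℚ) else 0) =
            fun w => if u = w then (1 : ℚ) else 0 := by
          funext w
          simp [der, hx]
        rw [this, ← ih]
        simp [hx]
      · have : der x (fun w => if a :: u = w then (1 : ℚ) else 0) = 0 := by
          funext w
          simp [der, hx]
        rw [this]
        simp [hx, mulS]

theorem toSeries_mul (p q : NC Letter) : toSeries (p * q) = mulS (toSeries p) (toSeries q) := by
  have h : (LinearMap.mul ℚ (NC Letter)).compr₂ toSeries =
      LinearMap.mk₂ ℚ (fun p q => mulS (toSeries p) (toSeries q))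
        (fun p p' q => by funext w; simp [mulS, add_mul, Finset.sum_add_distrib])
        (fun c p q => by funext w; simp [mulS, mul_assoc, Finset.mul_sum])
        (fun p q q' => by funext w; simp [mulS, mul_add, Finset.sum_add_distrib])
        (fun c p q => by funext w; simp [mulS, Finset.mul_sum, mul_left_comm]) :=
    bilinear_ext fun u v => toSeries_word_mul u v
  exact LinearMap.congr_fun (LinearMap.congr_fun h p) q

/-- Primitivity is tested in each degree separately, so it passes to the closure. -/
theorem degClosure_le_prim {S : Submodule ℚ Series} (h : S ≤ prim) : degClosure S ≤ prim := by
  intro ψ hψ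
  refine ⟨?_, fun u v => ?_⟩
  · obtain ⟨x, hx, hxψ⟩ := hψ 1
    rw [hxψ [] (by simp), (h hx).1]
  · obtain ⟨x, hx, hxψ⟩ := hψ (u.length + v.length + 1)
    have hw : ∀ w : List Letter, w.length ≤ u.length + v.length →
        lop ψ (word w) = lop x (word w) := fun w hw =>
      lop_congr hxψ (word_mem_wordSpan (by omega))
    rw [lop_congr hxψ, hw u (by omega), hw v (by omega), (h hx).2]
    rw [sh_word]
    exact fun w hw => by have := shuffleWords_mem_length u v w hw; omega

section

attribute [local instance 100] LieRing.ofAssociativeRing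

theorem freeLie2_le_prim : freeLie2.map toSeries ≤ prim := by
  let K : LieSubalgebra ℚ (NC Letter) :=
    { prim.comap toSeries with
      lie_mem' := by
        intro p q hp hq
        change toSeries ⁅p, q⁆ ∈ prim
        rw [LieRing.of_associative_ring_bracket, map_sub, toSeries_mul, toSeries_mul]
        exact bracket_mem_prim hp hq }
  let g : FreeLieAlgebra ℚ Letter →ₗ⁅ℚ⁆ K := FreeLieAlgebra.lift ℚ fun a =>
    (⟨word [a], letter_mem_prim a⟩ : K)
  have hg : FreeLieAlgebra.lift ℚ (fun a : Letter => (word [a] : NC Letter)) = K.incl.comp g := by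
    apply FreeLieAlgebra.hom_ext
    intro a
    rw [LieHom.comp_apply, FreeLieAlgebra.lift_of_apply, FreeLieAlgebra.lift_of_apply]
    rfl
  rintro _ ⟨p, hp, rfl⟩
  obtain ⟨x, rfl⟩ := hp
  change toSeries (FreeLieAlgebra.lift ℚ (fun a : Letter => (word [a] : NC Letter)) x) ∈ prim
  rw [hg]
  exact (g x).2

end

theorem freeLie2Hat_le_prim : freeLie2Hat ≤ prim := degClosure_le_prim freeLie2_le_prim

theorem commutatorHat_le_prim : commutatorHat ≤ prim := by
  refine degClosure_le_prim (Submodule.span_le.2 ?_)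
  rintro _ ⟨x, hx, y, hy, rfl⟩
  exact bracket_mem_prim (freeLie2Hat_le_prim hx) (freeLie2Hat_le_prim hy)

theorem commutatorHat_letter {ψ : Series} (h : ψ ∈ commutatorHat) (a : Letter) : ψ [a] = 0 := by
  obtain ⟨x, hx, hxψ⟩ := h 2
  rw [hxψ [a] (by simp)]
  have : Submodule.span ℚ
      {ψ | ∃ x ∈ freeLie2Hat, ∃ y ∈ freeLie2Hat, ψ = Series.conv x y - Series.conv y x} ≤
      LinearMap.ker (LinearMap.proj (R := ℚ) (φ := fun _ : List Letter => ℚ) [a]) := by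
    rw [Submodule.span_le]
    rintro _ ⟨x, -, y, -, rfl⟩
    simp [Series.conv, Finset.sum_range_succ]
    ring
  exact this hx

theorem cpow_eq (ψ : Series) (n : ℕ) : Series.cpow ψ n = fun w => cf ((lop ψ ^ n) (word w)) [] := by
  have h : lop (Series.cpow ψ n) = lop ψ ^ n := by
    induction n with
    | zero => exact lop_one
    | succ n ih =>
      rw [pow_succ, ← ih]
      exact lop_mulS ψ _
  funext w
  rw [← h, cf_nil_lop, ofWords_word]

theorem cexp_eq (ψ : Series) : Series.cexp ψ = expS ψ := by
  funext w
  simp only [Series.cexp, expS, cpow_eq]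

theorem commGroupLike_isShuffleChar {φ : Series} (h : φ ∈ commGroupLike) : IsShuffleChar φ := by
  obtain ⟨ψ, hψ, rfl⟩ := h
  rw [cexp_eq]
  exact isShuffleChar_expS (commutatorHat_le_prim hψ)

theorem commGroupLike_letter {φ : Series} (h : φ ∈ commGroupLike) (a : Letter) : φ [a] = 0 := by
  obtain ⟨ψ, hψ, rfl⟩ := h
  simp [Series.cexp, Finset.sum_range_succ, Series.cpow, Series.conv,
    commutatorHat_letter hψ a]

section

variable {X : Type}

theorem IsShuffleChar.map_shuffleWords {φ : List X → ℚ} (h : IsShuffleChar φ) (u v : List X) :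
    ofWords φ (shuffleWords u v) = φ u * φ v := by
  rw [← sh_word, h.map_sh, ofWords_word, ofWords_word]

theorem shuffleWords_replicate (a : X) (n : ℕ) :
    shuffleWords [a] (List.replicate n a) = ((n : ℚ) + 1) • word (List.replicate (n + 1) a) := by
  induction n with
  | zero => simp [shuffleWords_nil_right]
  | succ n ih =>
    rw [List.replicate_succ, shuffleWords_cons_cons, ih, shuffleWords_nil_left, mul_smul_comm,
      ← word_cons, ← word_cons, ← List.replicate_succ, ← List.replicate_succ]
    push_cast
    module

/-- Up to a nonzero factor the word `a ⋯ a` is the shuffle product of `a` with a shorter word. -/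
theorem IsShuffleChar.replicate {φ : List X → ℚ} (h : IsShuffleChar φ) {a : X} (ha : φ [a] = 0)
    (n : ℕ) : φ (List.replicate (n + 1) a) = 0 := by
  have h1 := h.map_shuffleWords [a] (List.replicate n a)
  rw [shuffleWords_replicate, map_smul, ofWords_word, ha, zero_mul, smul_eq_mul] at h1
  rcases mul_eq_zero.1 h1 with h2 | h2
  · exact absurd h2 (by positivity)
  · exact h2

/-! ### The inverse of a group-like series -/

/-- The antipode of series: `φ ↦ φ⁻¹` on group-like series. -/
def antipodeS (φ : List X → ℚ) : List X → ℚ := fun w => (-1) ^ w.length * φ w.reverse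

/-- The sum telescopes, since the words with a given first letter occur in two consecutive terms. -/
theorem sum_shuffleWords_reverse (b : List X) : ∀ a : List X,
    ∑ k ∈ Finset.range (b.length + 1),
      (-1 : ℚ) ^ k • shuffleWords ((b.take k).reverse ++ a) (b.drop k) =
    match a with
    | [] => if b.length = 0 then 1 else 0
    | x :: a => word [x] * shuffleWords a b := by
  induction b with
  | nil =>
    intro a
    cases a with
    | nil => simp [shuffleWords_nil_right, word_nil]
    | cons x a => simp [shuffleWords_nil_right, word_cons x a]
  | cons y b ih =>
    intro a
    rw [List.length_cons, Finset.sum_range_succ']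
    have h : ∑ k ∈ Finset.range (b.length + 1), (-1 : ℚ) ^ (k + 1) •
        shuffleWords (((y :: b).take (k + 1)).reverse ++ a) ((y :: b).drop (k + 1)) =
        - (word [y] * shuffleWords a b) := by
      have h' : word [y] * shuffleWords a b = _ := (ih (y :: a)).symm
      rw [h', ← Finset.sum_neg_distrib]
      refine Finset.sum_congr rfl fun k _ => ?_
      simp [pow_succ]
    rw [h]
    cases a with
    | nil => simp [shuffleWords_nil_left, ← word_cons]
    | cons x a => simp [shuffleWords_cons_cons]

theorem IsShuffleChar.antipode_mul {φ : List X → ℚ} (h : IsShuffleChar φ) :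
    mulS (antipodeS φ) φ = oneS := by
  funext w
  have h1 := congrArg (ofWords φ) (sum_shuffleWords_reverse w [])
  rw [map_sum] at h1
  have h2 : ofWords φ (if w.length = 0 then (1 : NC X) else 0) = oneS w := by
    unfold oneS
    split_ifs
    · rw [← word_nil, ofWords_word, h.nil]
    · exact map_zero _
  rw [← h2]
  refine Eq.trans ?_ h1
  refine Finset.sum_congr rfl fun k hk => ?_
  have hk' : k ≤ w.length := by simpa [Nat.lt_succ_iff] using hk
  rw [map_smul, List.append_nil, h.map_shuffleWords, smul_eq_mul, ← mul_assoc, antipodeS,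
    List.length_take, min_eq_left hk']

/-- An idempotent series with constant term `1` is the unit.  It turns the left inverse of a group-like
series into a two-sided one. -/
theorem eq_one_of_mulS_self {E : List X → ℚ} (h0 : E [] = 1) (h : mulS E E = E) : E = oneS := by
  have key : ∀ n, ∀ w : List X, w.length = n → E w = oneS w := by
    intro n
    induction n using Nat.strong_induction_on with
    | _ n ih =>
      intro w hw
      cases n with
      | zero =>
        rw [List.length_eq_zero_iff.1 hw, h0]; rfl
      | succ n =>
        have h1 := congrFun h w
        rw [mulS, hw, Finset.sum_range_succ, Finset.sum_range_succ',
          Finset.sum_eq_zero (s := Finset.range n)] at h1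
        · rw [List.take_of_length_le hw.le, List.drop_of_length_le hw.le] at h1
          simp only [List.take_zero, List.drop_zero, h0] at h1
          simp only [oneS, hw]
          norm_num
          linarith
        · intro k hk
          have hk := Finset.mem_range.1 hk
          rw [ih (k + 1) (by omega) _ (by simp; omega)]
          simp only [oneS, List.length_take, hw]
          rw [if_neg (by omega), zero_mul]
  exact funext fun w => key _ w rfl

theorem IsShuffleChar.mul_antipode {φ : List X → ℚ} (h : IsShuffleChar φ) :
    mulS φ (antipodeS φ) = oneS := by
  refine eq_one_of_mulS_self (by simp [mulS_nil, antipodeS, h.nil]) ?_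
  rw [mulS_assoc, ← mulS_assoc (antipodeS φ), h.antipode_mul, one_mulS]

end

/-! ### Regularization: the images of the shuffle maps -/

/-- The word does not begin with `e_1`. -/
def HeadOK (w : List LetterZ) : Prop := w.head? ≠ some .one

/-- The word does not end with `e_0`. -/
def LastOK (w : List LetterZ) : Prop := w.getLast? ≠ some .zero

/-- The first letter other than `e_z`, if there is one, is `e_0`. -/
def FirstOK : List LetterZ → Prop
  | [] => True
  | .zero :: _ => True
  | .z :: w => FirstOK w
  | .one :: _ => False

/-- The words of `𝒜_z^{-2}`. -/
def IsNeg2 (w : List LetterZ) : Prop := w = [] ∨ ∃ y, w = .zero :: y ∧ LastOK w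

theorem lastOK_nil : LastOK [] := by simp [LastOK]

theorem lastOK_cons_iff {a : LetterZ} {w : List LetterZ} (hw : w ≠ []) :
    LastOK (a :: w) ↔ LastOK w := by
  cases w with
  | nil => exact absurd rfl hw
  | cons b w => simp [LastOK, List.getLast?_cons_cons]

theorem LastOK.tail {a : LetterZ} {w : List LetterZ} (h : LastOK (a :: w)) : LastOK w := by
  cases w with
  | nil => exact lastOK_nil
  | cons b w => exact (lastOK_cons_iff (by simp)).1 h

theorem lastOK_zero_cons_iff {w : List LetterZ} : LastOK (.zero :: w) ↔ w ≠ [] ∧ LastOK w := by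
  cases w with
  | nil => simp [LastOK]
  | cons b w => simp [lastOK_cons_iff]

theorem lastOK_append_singleton {w : List LetterZ} {b : LetterZ} :
    LastOK (w ++ [b]) ↔ b ≠ .zero := by
  simp [LastOK]

theorem lastOK_append {x u : List LetterZ} (hu : u ≠ []) : LastOK (x ++ u) ↔ LastOK u := by
  simp [LastOK, List.getLast?_append_of_ne_nil _ hu]

theorem lastOK_of_forall {w : List LetterZ} (h : ∀ a ∈ w, a ≠ .zero) : LastOK w := fun h' =>
  h _ (List.mem_of_getLast? h') rfl

theorem mul_word_mul_mem {X : Type} {S : Submodule ℚ (NC X)} {a b : X}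
    (h : ∀ w, word (a :: w ++ [b]) ∈ S) (p : NC X) : word [a] * p * word [b] ∈ S := by
  have : (⊤ : Submodule ℚ (NC X)) ≤ S.comap
      (LinearMap.mulRight ℚ (word [b]) ∘ₗ LinearMap.mulLeft ℚ (word [a])) := by
    rw [← span_word, Submodule.span_le]
    rintro _ ⟨w, rfl⟩
    have := h w
    rw [← word_mul, word_cons] at this
    exact this
  exact this (Submodule.mem_top (x := p))

theorem exists_eq_cons_append {X : Type} {a c : X} {w : List X} :
    ∃ v b, a :: c :: w = a :: v ++ [b] ∧ (a :: c :: w).getLast? = some b := by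
  rcases List.eq_nil_or_concat (c :: w) with h | ⟨v, b, h⟩
  · simp at h
  · exact ⟨v, b, by simp [h], by rw [h]; simp [List.getLast?_cons]⟩

theorem az0_eq : Az0 = wordSpan fun w => HeadOK w ∧ LastOK w := by
  apply le_antisymm
  · rw [Az0, Submodule.span_le]
    rintro _ ((rfl | rfl) | ⟨a, ha, b, hb, p, rfl⟩)
    · exact word_mem_wordSpan (w := []) (by simp [HeadOK, LastOK])
    · exact word_mem_wordSpan (w := [LetterZ.z]) (by simp [HeadOK, LastOK])
    · refine mul_word_mul_mem (fun w => word_mem_wordSpan ⟨?_, ?_⟩) p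
      · rcases ha with rfl | rfl <;> simp [HeadOK]
      · rw [lastOK_append_singleton]
        rcases hb with rfl | rfl <;> simp
  · refine wordSpan_le fun w hw => ?_
    rcases w with _ | ⟨a, _ | ⟨c, w⟩⟩
    · exact Submodule.subset_span (Or.inl (Or.inl rfl))
    · cases a
      · simp [LastOK] at hw
      · exact Submodule.subset_span (Or.inl (Or.inr rfl))
      · simp [HeadOK] at hw
    · obtain ⟨v, b, h, h'⟩ := exists_eq_cons_append (a := a) (c := c) (w := w)
      refine Submodule.subset_span (Or.inr ⟨a, ?_, b, ?_, word v, ?_⟩)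
      · cases a
        · simp
        · simp
        · simp [HeadOK] at hw
      · cases b
        · exact absurd h' hw.2
        · simp
        · simp
      · rw [h, ez, ez, word_mul, word_mul]; rfl

theorem azNeg2_eq : AzNeg2 = wordSpan IsNeg2 := by
  apply le_antisymm
  · rw [AzNeg2, Submodule.span_le]
    rintro _ (rfl | ⟨b, hb, p, rfl⟩)
    · exact word_mem_wordSpan (w := []) (Or.inl rfl)
    · refine mul_word_mul_mem (fun w => word_mem_wordSpan (Or.inr ⟨_, rfl, ?_⟩)) p
      rw [lastOK_append_singleton]
      rcases hb with rfl | rfl <;> simp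
  · refine wordSpan_le fun w hw => ?_
    rcases hw with rfl | ⟨y, rfl, hw⟩
    · exact Submodule.subset_span (Or.inl rfl)
    · rcases y with _ | ⟨c, w⟩
      · simp [LastOK] at hw
      · obtain ⟨v, b, h, h'⟩ := exists_eq_cons_append (a := LetterZ.zero) (c := c) (w := w)
        refine Submodule.subset_span (Or.inr ⟨b, ?_, word v, ?_⟩)
        · cases b
          · exact absurd h' hw
          · simp
          · simp
        · rw [h, ez, ez, word_mul, word_mul]; rfl

theorem subAlphabet_eq (s : Set LetterZ) : subAlphabet s = wordSpan fun w => ∀ a ∈ w, a ∈ s := by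
  apply le_antisymm
  · let K : Subalgebra ℚ Az := Submodule.toSubalgebra (wordSpan fun w => ∀ a ∈ w, a ∈ s)
      (word_mem_wordSpan (w := []) (by simp))
      (fun p q hp hq => bilinear_mem (LinearMap.mul ℚ Az) (fun u v hu hv => by
        rw [LinearMap.mul_apply', word_mul]
        refine word_mem_wordSpan fun a ha => ?_
        rcases List.mem_append.1 ha with h | h
        · exact hu a h
        · exact hv a h) hp hq)
    have : Algebra.adjoin ℚ (ez '' s) ≤ K := Algebra.adjoin_le (by
      rintro _ ⟨a, ha, rfl⟩
      exact word_mem_wordSpan (by simpa using ha))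
    exact this
  · refine wordSpan_le fun w hw => ?_
    change word w ∈ Algebra.adjoin ℚ (ez '' s)
    induction w with
    | nil => exact one_mem _
    | cons a w ih =>
      rw [word_cons]
      exact mul_mem (Algebra.subset_adjoin ⟨a, hw a (by simp), rfl⟩)
        (ih fun b hb => hw b (by simp [hb]))

theorem az0OneZ_eq : Az0OneZ = wordSpan fun w => HeadOK w ∧ ∀ a ∈ w, a ≠ .zero := by
  rw [Az0OneZ, az0_eq, subAlphabet_eq, wordSpan_inf]
  congr 1
  funext w
  have h : ∀ a : LetterZ, a ∈ ({.one, .z} : Set LetterZ) ↔ a ≠ .zero := by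
    intro a; cases a <;> simp
  simp only [h, eq_iff_iff]
  exact ⟨fun h => ⟨h.1.1, h.2⟩, fun h => ⟨⟨h.1, lastOK_of_forall h.2⟩, h.2⟩⟩

theorem shuffleWords_mem_lastOK : ∀ u v : List LetterZ, LastOK u → LastOK v →
    shuffleWords u v ∈ wordSpan LastOK
  | [], v, _, hv => by rw [shuffleWords_nil_left]; exact word_mem_wordSpan hv
  | a :: u, [], hu, _ => by rw [shuffleWords_nil_right]; exact word_mem_wordSpan hu
  | a :: u, b :: v, hu, hv => by
    have key : ∀ (c : LetterZ) (u v : List LetterZ), u.length + v.length ≠ 0 →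
        shuffleWords u v ∈ wordSpan LastOK → word [c] * shuffleWords u v ∈ wordSpan LastOK := by
      intro c u v h0 h
      have h1 := Submodule.mem_inf.2 ⟨h, shuffleWords_mem_length u v⟩
      rw [wordSpan_inf] at h1
      refine letter_mul_mem (fun w hw => (lastOK_cons_iff ?_).2 hw.1) h1
      rintro rfl
      exact h0 hw.2.symm
    rw [shuffleWords_cons_cons]
    exact add_mem (key _ _ _ (by simp) (shuffleWords_mem_lastOK u (b :: v) hu.tail hv))
      (key _ _ _ (by simp) (shuffleWords_mem_lastOK (a :: u) v hu hv.tail))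
termination_by u v => u.length + v.length

theorem shuffleWords_mem_firstOK : ∀ u v : List LetterZ, FirstOK u → FirstOK v →
    shuffleWords u v ∈ wordSpan FirstOK
  | [], v, _, hv => by rw [shuffleWords_nil_left]; exact word_mem_wordSpan hv
  | a :: u, [], hu, _ => by rw [shuffleWords_nil_right]; exact word_mem_wordSpan hu
  | a :: u, b :: v, hu, hv => by
    have h0 : ∀ u v : List LetterZ, word [.zero] * shuffleWords u v ∈ wordSpan FirstOK :=
      fun u v => letter_mul_mem (fun w _ => trivial) (shuffleWords_mem_length u v)
    rw [shuffleWords_cons_cons]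
    refine add_mem ?_ ?_
    · cases a
      · exact h0 _ _
      · exact letter_mul_mem (fun w hw => hw) (shuffleWords_mem_firstOK u (b :: v) hu hv)
      · exact hu.elim
    · cases b
      · exact h0 _ _
      · exact letter_mul_mem (fun w hw => hw) (shuffleWords_mem_firstOK (a :: u) v hu hv)
      · exact hv.elim
termination_by u v => u.length + v.length

/-- The words of the shuffle of `x` with `c y`, sorted by the position of the letter `c`. -/
theorem shuffleWords_cons_right {X : Type} (c : X) (y : List X) (x : List X) :
    shuffleWords x (c :: y) = ∑ k ∈ Finset.range (x.length + 1),
      word (x.take k) * (word [c] * shuffleWords (x.drop k) y) := by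
  induction x with
  | nil => simp [shuffleWords_nil_left, word_nil, word_cons c y]
  | cons a x ih =>
    rw [shuffleWords_cons_cons, List.length_cons, Finset.sum_range_succ', ih, Finset.mul_sum]
    congr 1
    · exact Finset.sum_congr rfl fun k _ => by
        rw [List.take_succ_cons, List.drop_succ_cons, word_cons a (x.take k), mul_assoc]
    · simp [word_nil]

/-- If `S` contains the shuffle products of the words `x` in `P` with `𝒜_z^{-2}`, it contains their
concatenation products: `x · e_0 y` is the term of `x ⧢ e_0 y` in which all of `x` precedes `e_0`, and
the other terms have shorter prefixes of `x`. -/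
theorem word_mul_mem_of_sh_mem (P : List LetterZ → Prop) (hP : ∀ x k, P x → P (x.take k))
    (hP0 : ∀ x, P x → ∀ a ∈ x, a ≠ .zero) (S : Submodule ℚ Az)
    (hS : ∀ x, P x → ∀ u ∈ AzNeg2, sh (word x) u ∈ S) :
    ∀ x, P x → ∀ u ∈ AzNeg2, word x * u ∈ S := by
  have key : ∀ n, ∀ x : List LetterZ, x.length = n → P x → ∀ u ∈ AzNeg2, word x * u ∈ S := by
    intro n
    induction n using Nat.strong_induction_on with
    | _ n ih =>
      intro x hx hPx u hu
      rw [azNeg2_eq] at hu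
      have h : wordSpan IsNeg2 ≤ S.comap (LinearMap.mulLeft ℚ (word x)) := by
        refine wordSpan_le fun u hu => ?_
        have hm : (word u : Az) ∈ AzNeg2 := by rw [azNeg2_eq]; exact word_mem_wordSpan hu
        have h1 := hS x hPx _ hm
        rw [Submodule.mem_comap, LinearMap.mulLeft_apply]
        rcases hu with rfl | ⟨y, rfl, hy⟩
        · rwa [word_nil, mul_one, ← sh_one_right (word x : Az)]
        · rw [sh_word, shuffleWords_cons_right, Finset.sum_range_succ,
            List.take_length, List.drop_length, shuffleWords_nil_left, ← word_cons] at h1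
          refine (Submodule.add_mem_iff_right S ?_).1 h1
          refine Submodule.sum_mem _ fun k hk => ?_
          have hk := Finset.mem_range.1 hk
          refine ih k (hx ▸ hk) _ (by simp [hk.le]) (hP x k hPx) _ ?_
          rw [azNeg2_eq]
          obtain ⟨hy0, hy1⟩ := lastOK_zero_cons_iff.1 hy
          have h2 := Submodule.mem_inf.2 ⟨shuffleWords_mem_lastOK (x.drop k) y
            (lastOK_of_forall fun a ha => hP0 x hPx a (List.mem_of_mem_drop ha)) hy1,
            shuffleWords_mem_length (x.drop k) y⟩
          rw [wordSpan_inf] at h2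
          refine letter_mul_mem (fun w hw => Or.inr ⟨w, rfl, lastOK_zero_cons_iff.2 ⟨?_, hw.1⟩⟩) h2
          rintro rfl
          have := hw.2
          simp only [List.length_nil, List.length_drop] at this
          exact hy0 (List.length_eq_zero_iff.1 (by omega))
      exact h hu
  exact fun x => key _ x rfl

theorem shuffleZ1_tmul (u : AzNeg2) (v : Az0OneZ) :
    shuffleZ1 (u ⊗ₜ[ℚ] v) = sh (u : Az) (v : Az) := rfl

theorem shuffleZ_tmul (p : PolyZ) (u : AzNeg2) :
    shuffleZ (p ⊗ₜ[ℚ] u) = sh (p : Az) (u : Az) := rfl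

theorem exists_split (w : List LetterZ) : ∃ x u, w = x ++ u ∧ (∀ a ∈ x, a ≠ .zero) ∧
    (u = [] ∨ ∃ y, u = .zero :: y) := by
  induction w with
  | nil => exact ⟨[], [], rfl, by simp, Or.inl rfl⟩
  | cons a w ih =>
    by_cases ha : a = .zero
    · exact ⟨[], a :: w, rfl, by simp, Or.inr ⟨w, by rw [ha]⟩⟩
    · obtain ⟨x, u, rfl, hx, hu⟩ := ih
      exact ⟨a :: x, u, rfl, by simpa [ha] using hx, hu⟩

theorem exists_split_z (w : List LetterZ) (hw : FirstOK w) : ∃ x u, w = x ++ u ∧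
    (∀ a ∈ x, a = .z) ∧ (u = [] ∨ ∃ y, u = .zero :: y) := by
  induction w with
  | nil => exact ⟨[], [], rfl, by simp, Or.inl rfl⟩
  | cons a w ih =>
    cases a
    · exact ⟨[], _, rfl, by simp, Or.inr ⟨w, rfl⟩⟩
    · obtain ⟨x, u, rfl, hx, hu⟩ := ih hw
      exact ⟨_ :: x, u, rfl, by simpa using hx, hu⟩
    · exact hw.elim

theorem word_mem_azNeg2 {x u : List LetterZ} (hw : LastOK (x ++ u))
    (hu : u = [] ∨ ∃ y, u = .zero :: y) : (word u : Az) ∈ AzNeg2 := by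
  rw [azNeg2_eq]
  refine word_mem_wordSpan ?_
  rcases hu with rfl | ⟨y, rfl⟩
  · exact Or.inl rfl
  · exact Or.inr ⟨y, rfl, (lastOK_append (by simp)).1 hw⟩

theorem az0_le_range : Az0 ≤ LinearMap.range shuffleZ1 := by
  have key := word_mul_mem_of_sh_mem (fun x => HeadOK x ∧ ∀ a ∈ x, a ≠ .zero)
    (fun x k h => ⟨by
      cases x with
      | nil => simpa using h.1
      | cons a x =>
        cases k with
        | zero => simp [HeadOK]
        | succ k => exact h.1, fun a ha => h.2 a (List.mem_of_mem_take ha)⟩)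
    (fun x h => h.2) (LinearMap.range shuffleZ1)
    (fun x hx u hu => by
      have hx' : (word x : Az) ∈ Az0OneZ := by rw [az0OneZ_eq]; exact word_mem_wordSpan hx
      rw [sh_comm]
      exact ⟨⟨u, hu⟩ ⊗ₜ ⟨_, hx'⟩, shuffleZ1_tmul _ _⟩)
  rw [az0_eq]
  refine wordSpan_le fun w hw => ?_
  obtain ⟨x, u, rfl, hx, hu⟩ := exists_split w
  rw [← word_mul]
  refine key x ⟨?_, hx⟩ _ (word_mem_azNeg2 hw.2 hu)
  cases x with
  | nil => simp [HeadOK]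
  | cons a x => exact hw.1

/-- The space on the left is `𝒜_z^{-1}`. -/
theorem wordSpan_le_range_shuffleZ :
    wordSpan (fun w => FirstOK w ∧ LastOK w) ≤ LinearMap.range shuffleZ := by
  have key := word_mul_mem_of_sh_mem (fun x => ∀ a ∈ x, a = .z)
    (fun x k h a ha => h a (List.mem_of_mem_take ha))
    (fun x h a ha => by rw [h a ha]; simp) (LinearMap.range shuffleZ)
    (fun x hx u hu => by
      have hx' : (word x : Az) ∈ PolyZ := by
        rw [PolyZ, subAlphabet_eq]; exact word_mem_wordSpan hx
      exact ⟨⟨_, hx'⟩ ⊗ₜ ⟨u, hu⟩, shuffleZ_tmul _ _⟩)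
  refine wordSpan_le fun w hw => ?_
  obtain ⟨x, u, rfl, hx, hu⟩ := exists_split_z w hw.1
  rw [← word_mul]
  exact key x hx _ (word_mem_azNeg2 hw.2 hu)

theorem shuffleZ1_regZ1 (l : Az0) : shuffleZ1 (regZ1 l) = l :=
  Function.invFun_eq (az0_le_range l.2)

theorem tauZ_word (w : List LetterZ) : tauZ (word w) =
    (w.reverse.map fun a => match a with
      | .zero => ez .z - ez .one
      | .one => ez .z - ez .zero
      | .z => ez .z).prod := by
  have : ∀ w : List LetterZ, tauZ (word w) = MulOpposite.unop ((w.map fun a => match a with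
      | .zero => MulOpposite.op (ez .z - ez .one)
      | .one => MulOpposite.op (ez .z - ez .zero)
      | .z => MulOpposite.op (ez .z)).prod) := fun w => by
    rw [← ofLetters_word]; rfl
  rw [this, MulOpposite.unop_list_prod, List.map_map, List.map_reverse]
  congr 2
  refine List.map_congr_left fun a _ => ?_
  cases a <;> rfl

/-- Since `v` is `1` or begins with `e_z`, the words of `τ_z v` end with `e_z`; they do not contain
`e_1`. -/
theorem tauZ_mem {v : Az} (hv : v ∈ Az0OneZ) :
    tauZ v ∈ wordSpan fun w => FirstOK w ∧ LastOK w := by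
  rw [az0OneZ_eq] at hv
  have h1 : ∀ w : List LetterZ, (∀ a ∈ w, a ≠ .zero) →
      tauZ (word w) ∈ wordSpan fun w => ∀ a ∈ w, a ≠ LetterZ.one := by
    intro w hw
    have hs : (wordSpan fun w => ∀ a ∈ w, a ≠ LetterZ.one) = subAlphabet {.zero, .z} := by
      rw [subAlphabet_eq]
      congr 1; funext w
      have h : ∀ a : LetterZ, a ∈ ({.zero, .z} : Set LetterZ) ↔ a ≠ .one := by
        intro a; cases a <;> simp
      simp only [h]
    rw [hs, tauZ_word]
    refine list_prod_mem (S := Algebra.adjoin ℚ (ez '' {LetterZ.zero, LetterZ.z})) fun p hp => ?_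
    obtain ⟨a, ha, rfl⟩ := List.mem_map.1 hp
    have hz : ∀ b ∈ ({.zero, .z} : Set LetterZ), ez b ∈
        Algebra.adjoin ℚ (ez '' {LetterZ.zero, LetterZ.z}) := fun b hb =>
      Algebra.subset_adjoin ⟨b, hb, rfl⟩
    cases a
    · exact absurd rfl (hw _ (List.mem_reverse.1 ha))
    · exact hz _ (by simp)
    · exact sub_mem (hz _ (by simp)) (hz _ (by simp))
  have h2 : wordSpan (fun w => HeadOK w ∧ ∀ a ∈ w, a ≠ .zero) ≤
      (wordSpan fun w => FirstOK w ∧ LastOK w).comap tauZ := wordSpan_le fun w hw => by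
    rw [Submodule.mem_comap]
    rcases w with _ | ⟨a, w⟩
    · rw [tauZ_word]
      exact word_mem_wordSpan (w := []) ⟨trivial, lastOK_nil⟩
    · have ha : a = .z := by
        cases a
        · exact absurd rfl (hw.2 _ (by simp))
        · rfl
        · exact absurd rfl hw.1
      subst ha
      have h3 := h1 w fun a ha => hw.2 a (by simp [ha])
      have h4 : tauZ (word (.z :: w)) = tauZ (word w) * ez .z := by
        rw [tauZ_word, tauZ_word]; simp
      have hF : ∀ w : List LetterZ, (∀ a ∈ w, a ≠ .one) → FirstOK w := by
        intro w hw
        induction w with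
        | nil => trivial
        | cons a w ih =>
          cases a
          · trivial
          · exact ih fun a ha => hw a (by simp [ha])
          · exact absurd rfl (hw _ (by simp))
      have h5 : (wordSpan fun w => ∀ a ∈ w, a ≠ LetterZ.one) ≤
          (wordSpan fun w => FirstOK w ∧ LastOK w).comap (LinearMap.mulRight ℚ (ez .z)) :=
        wordSpan_le fun w hw => by
          rw [Submodule.mem_comap, LinearMap.mulRight_apply, ez, word_mul]
          refine word_mem_wordSpan ⟨hF _ ?_, lastOK_append_singleton.2 (by simp)⟩
          intro a ha
          rcases List.mem_append.1 ha with h | h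
          · exact hw a h
          · rw [List.mem_singleton.1 h]; simp
      rw [h4]
      exact h5 h3
  exact h2 hv

theorem sh_tauZ_mem {u v : Az} (hu : u ∈ AzNeg2) (hv : v ∈ Az0OneZ) :
    sh u (tauZ v) ∈ LinearMap.range shuffleZ := by
  refine wordSpan_le_range_shuffleZ ?_
  rw [azNeg2_eq] at hu
  refine bilinear_mem sh (fun u v hu hv => ?_) hu (tauZ_mem hv)
  have hu' : FirstOK u ∧ LastOK u := by
    rcases hu with rfl | ⟨y, rfl, h⟩
    · exact ⟨trivial, lastOK_nil⟩
    · exact ⟨trivial, h⟩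
  rw [sh_word, ← wordSpan_inf]
  exact ⟨shuffleWords_mem_firstOK u v hu'.1 hv.1, shuffleWords_mem_lastOK u v hu'.2 hv.2⟩

theorem shuffleZ_regZ_mapN (l : Az0) : shuffleZ (regZ (mapN l)) = mapN l := by
  refine Function.invFun_eq ?_
  change mapN l ∈ LinearMap.range shuffleZ
  rw [mapN]
  induction regZ1 l using TensorProduct.induction_on with
  | zero => rw [map_zero, map_zero]; exact zero_mem _
  | add x y hx hy => rw [map_add, map_add]; exact add_mem hx hy
  | tmul u v => exact sh_tauZ_mem u.2 v.2

/-! ### Evaluation of series in algebras -/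

section ShufflePowers

variable {X : Type}

/-- The series `w ↦ φ(a ⋯ a ⧢ w)`, with `k` letters `a`. -/
def shS (a : X) (k : ℕ) (φ : List X → ℚ) : List X → ℚ :=
  fun w => ofWords φ (shuffleWords (List.replicate k a) w)

theorem der_shS_zero (a x : X) (φ : List X → ℚ) : der x (shS a 0 φ) = shS a 0 (der x φ) := by
  funext w
  simp [der, shS, shuffleWords_nil_left, ofWords_word]

theorem der_shS_succ (a x : X) (k : ℕ) (φ : List X → ℚ) :
    der x (shS a (k + 1) φ) = der x (shS a k (der a φ)) + shS a (k + 1) (der x φ) := by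
  funext w
  simp [der, shS, List.replicate_succ, shuffleWords_cons_cons, ofWords_letter_mul]

theorem shS_succ_nil (a : X) (k : ℕ) (φ : List X → ℚ) :
    shS a (k + 1) φ [] = shS a k (der a φ) [] := by
  simp [der, shS, List.replicate_succ, shuffleWords_nil_right, ofWords_word]

end ShufflePowers

section Evaluation

variable {X Y : Type} [Fintype X] [Fintype Y] {R : Type} [Ring R] [Algebra ℚ R]

/-- The part of degree `m` of the value of the series `φ` at the family `f`. -/
def evDeg (f : X → R) (φ : List X → ℚ) (m : ℕ) : R :=
  ∑ w : Fin m → X, φ (List.ofFn w) • (List.ofFn fun s => f (w s)).prod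

theorem evDeg_zero (f : X → R) (φ : List X → ℚ) : evDeg f φ 0 = φ [] • 1 := by
  simp [evDeg]

theorem evDeg_succ (f : X → R) (φ : List X → ℚ) (m : ℕ) :
    evDeg f φ (m + 1) = ∑ x, f x * evDeg f (der x φ) m := by
  rw [evDeg, ← (Fin.consEquiv fun _ => X).sum_comp, Fintype.sum_prod_type]
  refine Finset.sum_congr rfl fun x _ => ?_
  rw [evDeg, Finset.mul_sum]
  refine Finset.sum_congr rfl fun w _ => ?_
  rw [mul_smul_comm]
  simp [Fin.consEquiv, List.ofFn_succ, der]

theorem evDeg_add (f : X → R) (φ ψ : List X → ℚ) (m : ℕ) :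
    evDeg f (φ + ψ) m = evDeg f φ m + evDeg f ψ m := by
  simp [evDeg, add_smul, Finset.sum_add_distrib]

theorem evDeg_smul (f : X → R) (c : ℚ) (φ : List X → ℚ) (m : ℕ) :
    evDeg f (c • φ) m = c • evDeg f φ m := by
  simp [evDeg, mul_smul, Finset.smul_sum]

theorem evDeg_series_zero (f : X → R) (m : ℕ) : evDeg f (0 : List X → ℚ) m = 0 := by
  simp [evDeg]

theorem evDeg_sum {ι : Type} (s : Finset ι) (f : X → R) (φ : ι → List X → ℚ) (m : ℕ) :
    evDeg f (∑ i ∈ s, φ i) m = ∑ i ∈ s, evDeg f (φ i) m := by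
  simp [evDeg, Finset.sum_smul, Finset.sum_comm (s := s)]

theorem evDeg_mulS (f : X → R) (φ ψ : List X → ℚ) (m : ℕ) :
    evDeg f (mulS φ ψ) m =
      ∑ ij ∈ Finset.HasAntidiagonal.antidiagonal m, evDeg f φ ij.1 * evDeg f ψ ij.2 := by
  induction m generalizing φ with
  | zero =>
    rw [Finset.Nat.antidiagonal_zero, Finset.sum_singleton, evDeg_zero, evDeg_zero, evDeg_zero,
      mulS_nil, smul_mul_smul_comm, one_mul]
  | succ m ih =>
    rw [evDeg_succ, Finset.Nat.sum_antidiagonal_succ]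
    simp only [der_mulS, evDeg_add, evDeg_smul, ih, mul_add, Finset.sum_add_distrib, evDeg_zero,
      evDeg_succ f φ, Finset.sum_mul, Finset.mul_sum, mul_smul_comm, smul_mul_assoc, one_mul,
      evDeg_succ f ψ, mul_assoc]
    rw [Finset.sum_comm]

theorem evDeg_one (f : X → R) (m : ℕ) : evDeg f oneS m = if m = 0 then 1 else 0 := by
  cases m with
  | zero => simp [evDeg_zero, oneS]
  | succ m => simp [evDeg, oneS]

/-- The value of a series at linear combinations of the family `f` is the value at `f` of the series
obtained by the transposed substitution of letters. -/
theorem evDeg_linear (M : X → Y → ℚ) (ζ : NC Y →ₐ[ℚ] NC X)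
    (hζ : ∀ y, ζ (word [y]) = ∑ x, M x y • word [x]) (f : Y → R) (φ : List X → ℚ) (m : ℕ) :
    evDeg f (fun w => ofWords φ (ζ (word w))) m = evDeg (fun x => ∑ y, M x y • f y) φ m := by
  induction m generalizing φ with
  | zero => rw [evDeg_zero, evDeg_zero, word_nil, map_one, ← word_nil, ofWords_word]
  | succ m ih =>
    have hd : ∀ y, der y (fun w => ofWords φ (ζ (word w))) =
        ∑ x, M x y • fun w => ofWords (der x φ) (ζ (word w)) := by
      intro y
      funext w
      rw [der, word_cons, map_mul, hζ, Finset.sum_mul, map_sum, Finset.sum_apply]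
      refine Finset.sum_congr rfl fun x _ => ?_
      rw [smul_mul_assoc, map_smul, ofWords_letter_mul]
      rfl
    rw [evDeg_succ, evDeg_succ]
    simp only [hd, evDeg_sum, evDeg_smul, ih, Finset.mul_sum, Finset.sum_mul, mul_smul_comm,
      smul_mul_assoc]
    rw [Finset.sum_comm]

/-- Taylor expansion of the value of a series at a family whose member with index `a` is translated
by an element `c` that commutes with the family. -/
theorem evDeg_translate [DecidableEq X] (a : X) (f : X → R) (c : R) (hc : ∀ x, Commute c (f x))
    (φ : List X → ℚ) (m : ℕ) :
    evDeg (fun x => f x + if x = a then c else 0) φ m =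
      ∑ ij ∈ Finset.HasAntidiagonal.antidiagonal m, c ^ ij.1 * evDeg f (shS a ij.1 φ) ij.2 := by
  induction m generalizing φ with
  | zero => simp [evDeg_zero, shS, shuffleWords_nil_left, ofWords_word]
  | succ m ih =>
    -- the terms of the expansion for the translated factor `c`, indexed by the power of `c`
    let G : ℕ → ℕ → R := fun i j =>
      Nat.casesOn i 0 fun i => c ^ (i + 1) * evDeg f (shS a i (der a φ)) j
    have hG : ∀ i j, c ^ i * evDeg f (shS a i φ) (j + 1) =
        (∑ x, f x * (c ^ i * evDeg f (shS a i (der x φ)) j)) + G i (j + 1) := by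
      intro i j
      have hcomm : ∀ x y, f x * (c ^ i * y) = c ^ i * (f x * y) := fun x y => by
        rw [← mul_assoc, ← mul_assoc, ((hc x).pow_left i).eq]
      simp only [hcomm, ← Finset.mul_sum]
      cases i with
      | zero =>
        rw [evDeg_succ]
        simp only [der_shS_zero]
        exact (add_zero _).symm
      | succ i =>
        change _ = _ + c ^ (i + 1) * evDeg f (shS a i (der a φ)) (j + 1)
        rw [evDeg_succ, evDeg_succ, ← mul_add, ← Finset.sum_add_distrib]
        congr 1
        refine Finset.sum_congr rfl fun x _ => ?_
        rw [der_shS_succ, evDeg_add, mul_add, add_comm]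
    have hG0 : c ^ (m + 1) * evDeg f (shS a (m + 1) φ) 0 = G (m + 1) 0 := by
      change _ = c ^ (m + 1) * evDeg f (shS a m (der a φ)) 0
      rw [evDeg_zero, evDeg_zero, shS_succ_nil]
    have hsum : G (m + 1) 0 +
        ∑ ij ∈ Finset.HasAntidiagonal.antidiagonal m, G ij.1 (ij.2 + 1) =
        ∑ ij ∈ Finset.HasAntidiagonal.antidiagonal m, G (ij.1 + 1) ij.2 := by
      rw [← Finset.Nat.sum_antidiagonal_succ' (f := fun ij : ℕ × ℕ => G ij.1 ij.2),
        Finset.Nat.sum_antidiagonal_succ]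
      simp [G]
    rw [Finset.Nat.sum_antidiagonal_succ', hG0, Finset.sum_congr rfl (fun ij _ => hG ij.1 ij.2),
      Finset.sum_add_distrib, add_left_comm, hsum, evDeg_succ]
    simp only [add_mul, Finset.sum_add_distrib, ih, ite_mul, zero_mul, Finset.sum_ite_eq',
      Finset.mem_univ, if_true]
    simp only [Finset.mul_sum]
    rw [Finset.sum_comm]
    congr 1
    refine Finset.sum_congr rfl fun ij _ => ?_
    change _ = c ^ (ij.1 + 1) * evDeg f (shS a ij.1 (der a φ)) ij.2
    rw [pow_succ', mul_assoc]

/-- The value of a group-like series without linear term in `a` does not change when an element that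
commutes with the arguments is added to the argument with index `a`. -/
theorem IsShuffleChar.evDeg_translate [DecidableEq X] {φ : List X → ℚ} (h : IsShuffleChar φ)
    {a : X} (ha : φ [a] = 0) (f : X → R) (c : R) (hc : ∀ x, Commute c (f x)) (m : ℕ) :
    evDeg (fun x => f x + if x = a then c else 0) φ m = evDeg f φ m := by
  rw [KeyFormula.evDeg_translate a f c hc, Finset.sum_eq_single (0, m)]
  · have : shS a 0 φ = φ := by
      funext w
      simp [shS, shuffleWords_nil_left, ofWords_word]
    simp [this]
  · rintro ⟨i, j⟩ hij h0
    cases i with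
    | zero =>
      have := Finset.HasAntidiagonal.mem_antidiagonal.1 hij
      exact absurd (by simpa using this) h0
    | succ i =>
      have : shS a (i + 1) φ = 0 := by
        funext w
        rw [shS, h.map_shuffleWords, h.replicate ha, zero_mul]; rfl
      rw [this, evDeg_series_zero, mul_zero]
  · simp

end Evaluation

section Completion

variable {X : Type} [Fintype X]

theorem evDeg_mem {f : X → UP5} (hf : ∀ x, f x ∈ augIdeal) (φ : List X → ℚ) (m : ℕ) :
    evDeg f φ m ∈ augIdeal ^ m := by
  induction m generalizing φ with
  | zero => simp [Submodule.pow_zero]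
  | succ m ih =>
    rw [evDeg_succ, Ideal.IsTwoSided.pow_succ]
    exact Ideal.sum_mem _ fun x _ => Ideal.mul_mem_mul (hf x) (ih _)

/-- The value of a series at a family of elements of the augmentation ideal. -/
def evHat (f : X → UP5) (hf : ∀ x, f x ∈ augIdeal) (φ : List X → ℚ) : UP5Hat :=
  ⟨fun n => Ideal.Quotient.mk _ (∑ m ∈ Finset.range n, evDeg f φ m), by
    intro n
    rw [Ideal.Quotient.factor_mk, Finset.sum_range_succ, map_add,
      Ideal.Quotient.eq_zero_iff_mem.2 (evDeg_mem hf φ n), add_zero]⟩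

theorem evHat_apply (f : X → UP5) (hf : ∀ x, f x ∈ augIdeal) (φ : List X → ℚ) (n : ℕ) :
    (evHat f hf φ).1 n = Ideal.Quotient.mk _ (∑ m ∈ Finset.range n, evDeg f φ m) := rfl

theorem evHat_congr {Y : Type} [Fintype Y] {f : X → UP5} {hf : ∀ x, f x ∈ augIdeal}
    {φ : List X → ℚ} {g : Y → UP5} {hg : ∀ x, g x ∈ augIdeal} {ψ : List Y → ℚ}
    (h : ∀ m, evDeg f φ m = evDeg g ψ m) : evHat f hf φ = evHat g hg ψ :=
  Subtype.ext (funext fun n => by rw [evHat_apply, evHat_apply]; simp only [h])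

theorem evHat_one (f : X → UP5) (hf : ∀ x, f x ∈ augIdeal) : evHat f hf oneS = 1 := by
  refine Subtype.ext (funext fun n => ?_)
  rw [evHat_apply]
  cases n with
  | zero =>
    refine (Ideal.Quotient.eq (I := augIdeal ^ 0)).2 ?_
    simp [Submodule.pow_zero]
  | succ n =>
    simp [evDeg_one]

theorem evHat_mul (f : X → UP5) (hf : ∀ x, f x ∈ augIdeal) (φ ψ : List X → ℚ) :
    evHat f hf (mulS φ ψ) = evHat f hf φ * evHat f hf ψ := by
  refine Subtype.ext (funext fun n => ?_)
  change (evHat f hf (mulS φ ψ)).1 n = (evHat f hf φ).1 n * (evHat f hf ψ).1 n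
  rw [evHat_apply, evHat_apply, evHat_apply, ← map_mul, Finset.sum_mul_sum]
  simp only [evDeg_mulS, Finset.Nat.sum_antidiagonal_eq_sum_range_succ_mk]
  rw [Finset.sum_range_diag_flip n fun i j => evDeg f φ i * evDeg f ψ j, map_sum, map_sum]
  refine Finset.sum_congr rfl fun i hi => ?_
  rw [map_sum, map_sum]
  refine Finset.sum_subset (Finset.range_mono (Nat.sub_le _ _)) fun j hj hj' => ?_
  refine Ideal.Quotient.eq_zero_iff_mem.2 (Ideal.pow_le_pow_right (m := n) (n := i + j) ?_ ?_)
  · have := Finset.mem_range.not.1 hj'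
    omega
  · rw [Ideal.IsTwoSided.pow_add]
    exact Ideal.mul_mem_mul (evDeg_mem hf φ i) (evDeg_mem hf ψ j)

theorem subst_eq_evHat (φ : Series) (i j k : ZMod 5) :
    subst φ i j k = evHat (substLetter i j k)
      (fun x => by cases x <;> exact t_mem_augIdeal _ _) φ := rfl

theorem inverse_evHat (f : X → UP5) (hf : ∀ x, f x ∈ augIdeal) {φ : List X → ℚ}
    (h : IsShuffleChar φ) : Ring.inverse (evHat f hf φ) = evHat f hf (antipodeS φ) := by
  let u : UP5Hatˣ := ⟨evHat f hf φ, evHat f hf (antipodeS φ),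
    by rw [← evHat_mul, h.mul_antipode, evHat_one],
    by rw [← evHat_mul, h.antipode_mul, evHat_one]⟩
  exact Ring.inverse_unit u

end Completion

/-! ### Relations in `U𝔓_5` -/

section

attribute [local instance 100] LieRing.ofAssociativeRing

/-- The linear map from the free Lie algebra to `U𝔓_5`. -/
def toUP5 : FreeT →ₗ[ℚ] UP5 :=
  (UniversalEnvelopingAlgebra.ι ℚ : P5 →ₗ⁅ℚ⁆ UP5).toLinearMap ∘ₗ
    (LieSubmodule.Quotient.mk' idealP5 : FreeT →ₗ[ℚ] P5)

theorem toUP5_lie (x y : FreeT) : toUP5 ⁅x, y⁆ = toUP5 x * toUP5 y - toUP5 y * toUP5 x := by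
  rw [← LieRing.of_associative_ring_bracket]
  exact LieHom.map_lie (UniversalEnvelopingAlgebra.ι ℚ : P5 →ₗ⁅ℚ⁆ UP5)
    (LieSubmodule.Quotient.mk x : P5) (LieSubmodule.Quotient.mk y : P5)

theorem toUP5_eq_zero {x : FreeT} (hx : x ∈ relP5) : toUP5 x = 0 := by
  have : LieSubmodule.Quotient.mk' idealP5 x = 0 :=
    (LieSubmodule.Quotient.mk_eq_zero (N := idealP5)).2 (LieSubmodule.subset_lieSpan hx)
  change UniversalEnvelopingAlgebra.ι ℚ (LieSubmodule.Quotient.mk' idealP5 x : P5) = 0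
  rw [this, map_zero]

theorem t_symm (i j : ZMod 5) : t i j = t j i := by
  have := toUP5_eq_zero (Or.inl (Or.inl (Or.inl ⟨i, j, rfl⟩)))
  rwa [map_sub, sub_eq_zero] at this

theorem t_self (i : ZMod 5) : t i i = 0 := toUP5_eq_zero (Or.inl (Or.inl (Or.inr ⟨i, rfl⟩)))

theorem t_sum (i : ZMod 5) : t i 0 + t i 1 + t i 2 + t i 3 + t i 4 = 0 := by
  have := toUP5_eq_zero (Or.inl (Or.inr ⟨i, rfl⟩))
  rw [map_sum] at this
  rw [← this]
  exact (Fin.sum_univ_five (fun j : Fin 5 => t i j)).symm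

theorem t_comm {i j k l : ZMod 5} (h : ({i, j} ∩ {k, l} : Set (ZMod 5)) = ∅) :
    Commute (t i j) (t k l) := by
  have := toUP5_eq_zero (Or.inr ⟨i, j, k, l, h, rfl⟩)
  rwa [toUP5_lie, sub_eq_zero] at this

end

/-- The relation `t_{15} = t_{23} + t_{24} + t_{34}`, from the relations for the vanishing sums. -/
theorem t_one_five : t 1 5 = t 2 3 + t 2 4 + t 3 4 := by
  have h5 : (5 : ZMod 5) = 0 := rfl
  have h0 := t_sum 0
  have h1 := t_sum 1
  have h2 := t_sum 2
  have h3 := t_sum 3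
  have h4 := t_sum 4
  rw [t_self] at h0 h1 h2 h3 h4
  rw [t_symm 1 0] at h1
  rw [t_symm 2 0, t_symm 2 1] at h2
  rw [t_symm 3 0, t_symm 3 1, t_symm 3 2] at h3
  rw [t_symm 4 0, t_symm 4 1, t_symm 4 2, t_symm 4 3] at h4
  rw [h5, t_symm 1 0]
  have h : t 0 1 = t 2 3 + t 2 4 + t 3 4 + (1 / 2 : ℚ) •
      ((0 + t 0 1 + t 0 2 + t 0 3 + t 0 4) + (t 0 1 + 0 + t 1 2 + t 1 3 + t 1 4) -
        (t 0 2 + t 1 2 + 0 + t 2 3 + t 2 4) - (t 0 3 + t 1 3 + t 2 3 + 0 + t 3 4) -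
        (t 0 4 + t 1 4 + t 2 4 + t 3 4 + 0)) := by module
  rw [h, h0, h1, h2, h3, h4]
  simp

theorem commute_t34_t21 : Commute (t 3 4) (t 2 1) := t_comm (by ext x; revert x; decide)

theorem commute_t34_add : Commute (t 3 4) (t 2 3 + t 2 4) := by
  have h2 := t_sum 2
  rw [t_self] at h2
  have : t 2 3 + t 2 4 = (t 2 0 + t 2 1 + 0 + t 2 3 + t 2 4) - t 2 0 - t 2 1 := by abel
  rw [this, h2, zero_sub]
  exact ((t_comm (by ext x; revert x; decide)).neg_right).sub_right commute_t34_t21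

theorem commute_t15_t24 : Commute (t 1 5) (t 2 4) := t_comm (by ext x; revert x; decide)

theorem commute_t15_t23 : Commute (t 1 5) (t 2 3) := t_comm (by ext x; revert x; decide)

/-! ### The coefficients of `dec_2` as iterated contractions -/

/-- The coefficient of `w ⊗ v` as a linear form on `𝒜_z ⊗ 𝒜`. -/
def cfT (w : List LetterZ) (v : List Letter) : Az ⊗[ℚ] A →ₗ[ℚ] ℚ :=
  LinearMap.mul' ℚ ℚ ∘ₗ TensorProduct.map (cfL w) (cfL v)

theorem cfT_tmul (w : List LetterZ) (v : List Letter) (p : Az) (q : A) :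
    cfT w v (p ⊗ₜ q) = cf p w * cf q v := rfl

theorem tensor_ext {x y : Az ⊗[ℚ] A} (h : ∀ w v, cfT w v x = cfT w v y) : x = y := by
  let E := TensorProduct.congr (MonoidAlgebra.coeffLinearEquiv ℚ : Az ≃ₗ[ℚ] _)
    (MonoidAlgebra.coeffLinearEquiv ℚ : A ≃ₗ[ℚ] _) ≪≫ₗ
    finsuppTensorFinsupp' ℚ (FreeMonoid LetterZ) (FreeMonoid Letter)
  have hE : ∀ (z : Az ⊗[ℚ] A) (w : FreeMonoid LetterZ) (v : FreeMonoid Letter),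
      E z (w, v) = cfT w.toList v.toList z := by
    intro z w v
    induction z using TensorProduct.induction_on with
    | zero => simp
    | add a b ha hb => rw [map_add, map_add, Finsupp.add_apply, ha, hb]
    | tmul p q =>
      change finsuppTensorFinsupp' ℚ (FreeMonoid LetterZ) (FreeMonoid Letter)
        (p.coeff ⊗ₜ[ℚ] q.coeff) (w, v) = _
      rw [finsuppTensorFinsupp'_apply_apply]
      rfl
  refine E.injective (Finsupp.ext fun ⟨w, v⟩ => ?_)
  rw [hE, hE, h]

/-- `(p_2 ⊗ p_3) ∘ δ` on the whole tensor space. -/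
def decT : NC LetterM →ₗ[ℚ] Az ⊗[ℚ] A :=
  TensorProduct.map pr2.toLinearMap pr3.toLinearMap ∘ₗ deconc

theorem dec2_apply (b : Bar) : dec2 b = decT b := rfl

theorem decT_nil : decT (word []) = 1 ⊗ₜ 1 := by
  rw [decT, LinearMap.comp_apply, deconc, ofWords_word]
  simp [word_nil]

theorem decT_cons (x : LetterM) (m : List LetterM) : decT (word (x :: m)) =
    1 ⊗ₜ pr3 (word (x :: m)) +
      TensorProduct.map (LinearMap.mulLeft ℚ (pr2 (word [x]))) LinearMap.id (decT (word m)) := by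
  simp only [decT, LinearMap.comp_apply, deconc, ofWords_word, List.length_cons]
  rw [Finset.sum_range_succ', add_comm]
  simp only [map_add, map_sum, List.take_succ_cons, List.drop_succ_cons, List.take_zero,
    List.drop_zero, TensorProduct.map_tmul, AlgHom.toLinearMap_apply, LinearMap.mulLeft_apply,
    LinearMap.id_apply, word_nil, map_one]
  congr 1
  exact Finset.sum_congr rfl fun k _ => by rw [word_cons x (m.take k), map_mul]

/-- The letter of `H^1_DR` that `p_2` maps to a given letter of `𝒜_z`. -/
def letterM : LetterZ → LetterM
  | .zero => .e21
  | .z => .e23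
  | .one => .e24

theorem cf_letter_mul {X : Type} [DecidableEq X] (x y : X) (p : NC X) (w : List X) :
    cf (word [x] * p) (y :: w) = if x = y then cf p w else 0 := by
  have : cfL (y :: w) ∘ₗ LinearMap.mulLeft ℚ (word [x]) = if x = y then cfL w else 0 :=
    linear_ext fun v => by
      rw [LinearMap.comp_apply, LinearMap.mulLeft_apply, ← word_cons, cfL_apply, cf_word]
      by_cases h : x = y
      · rw [if_pos h, cfL_apply, cf_word]; simp [h]
      · rw [if_neg h]; simp [h]
  have := LinearMap.congr_fun this p
  rw [LinearMap.comp_apply, LinearMap.mulLeft_apply, cfL_apply] at this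
  rw [this]
  split_ifs <;> rfl

theorem cf_letter_mul_nil {X : Type} (x : X) (p : NC X) : cf (word [x] * p) [] = 0 := by
  have : cfL [] ∘ₗ LinearMap.mulLeft ℚ (word [x]) = 0 :=
    linear_ext fun v => by
      rw [LinearMap.comp_apply, LinearMap.mulLeft_apply, ← word_cons, cfL_apply, cf_word_cons_nil]
      rfl
  have := LinearMap.congr_fun this p
  rwa [LinearMap.comp_apply, LinearMap.mulLeft_apply, cfL_apply] at this

theorem cut_word_nil (a : LetterM) : cut a (word []) = 0 :=
  cf_ext fun w => by rw [cf_cut, cf_word]; simp [cf_zero]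

theorem cut_word_cons (a x : LetterM) (m : List LetterM) :
    cut a (word (x :: m)) = if x = a then word m else 0 :=
  cf_ext fun w => by
    rw [cf_cut, word_cons, cf_letter_mul]
    split_ifs <;> rfl

theorem pr2_letter : pr2 (word [.e21]) = word [.zero] ∧ pr2 (word [.e23]) = word [.z] ∧
    pr2 (word [.e24]) = word [.one] ∧ pr2 (word [.e31]) = 0 ∧ pr2 (word [.e34]) = 0 := by
  simp [pr2, ofLetters_word, ez]

theorem cf_pr2_letter_mul (x : LetterM) (p : Az) (a : LetterZ) (w : List LetterZ) :
    cf (pr2 (word [x]) * p) (a :: w) = if x = letterM a then cf p w else 0 := by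
  obtain ⟨h1, h2, h3, h4, h5⟩ := pr2_letter
  cases x
  · rw [h1, cf_letter_mul]; cases a <;> simp [letterM]
  · rw [h2, cf_letter_mul]; cases a <;> simp [letterM]
  · rw [h3, cf_letter_mul]; cases a <;> simp [letterM]
  · rw [h4, zero_mul]; cases a <;> simp [letterM] <;> rfl
  · rw [h5, zero_mul]; cases a <;> simp [letterM] <;> rfl

theorem cf_pr2_letter_mul_nil (x : LetterM) (p : Az) : cf (pr2 (word [x]) * p) [] = 0 := by
  obtain ⟨h1, h2, h3, h4, h5⟩ := pr2_letter
  cases x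
  · rw [h1, cf_letter_mul_nil]
  · rw [h2, cf_letter_mul_nil]
  · rw [h3, cf_letter_mul_nil]
  · rw [h4, zero_mul]; rfl
  · rw [h5, zero_mul]; rfl

theorem cf_one {X : Type} (w : List X) : cf (1 : NC X) w = if w.length = 0 then 1 else 0 := by
  classical
  rw [← word_nil, cf_word]
  cases w <;> simp

theorem cfT_map (w : List LetterZ) (v : List Letter) (f : Az →ₗ[ℚ] Az) (z : Az ⊗[ℚ] A) :
    cfT w v (TensorProduct.map f LinearMap.id z) =
      LinearMap.mul' ℚ ℚ (TensorProduct.map (cfL w ∘ₗ f) (cfL v) z) := by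
  rw [cfT, LinearMap.comp_apply, ← LinearMap.comp_apply (TensorProduct.map _ _),
    ← TensorProduct.map_comp, LinearMap.comp_id]

theorem cfT_decT_nil (p : NC LetterM) (v : List Letter) : cfT [] v (decT p) = cf (pr3 p) v := by
  have : cfT [] v ∘ₗ decT = cfL v ∘ₗ pr3.toLinearMap := linear_ext fun m => by
    rw [LinearMap.comp_apply, LinearMap.comp_apply, AlgHom.toLinearMap_apply, cfL_apply]
    cases m with
    | nil => rw [decT_nil, cfT_tmul, word_nil, map_one, cf_one]; simp
    | cons x m =>
      have h0 : cfL [] ∘ₗ LinearMap.mulLeft ℚ (pr2 (word [x])) = 0 :=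
        LinearMap.ext fun p => cf_pr2_letter_mul_nil x p
      rw [decT_cons, map_add, cfT_tmul, cfT_map, h0, TensorProduct.map_zero_left, cf_one]
      simp
  exact LinearMap.congr_fun this p

/-- On the coefficients of `dec_2`, the removal of the first letter of `w` is the contraction with the
dual generator. -/
theorem cfT_decT_cons (p : NC LetterM) (a : LetterZ) (w : List LetterZ) (v : List Letter) :
    cfT (a :: w) v (decT p) = cfT w v (decT (cut (letterM a) p)) := by
  have : cfT (a :: w) v ∘ₗ decT = cfT w v ∘ₗ decT ∘ₗ cut (letterM a) := linear_ext fun m => by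
    rw [LinearMap.comp_apply, LinearMap.comp_apply, LinearMap.comp_apply]
    cases m with
    | nil => rw [decT_nil, cfT_tmul, cut_word_nil, cf_one]; simp
    | cons x m =>
      have h0 : cfL (a :: w) ∘ₗ LinearMap.mulLeft ℚ (pr2 (word [x])) =
          if x = letterM a then cfL w else 0 := LinearMap.ext fun p => by
        rw [LinearMap.comp_apply, LinearMap.mulLeft_apply, cfL_apply, cf_pr2_letter_mul]
        split_ifs <;> rfl
      rw [decT_cons, map_add, cfT_tmul, cfT_map, h0, cf_one, if_neg (by simp), cut_word_cons]
      split_ifs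
      · rw [zero_mul, zero_add]; rfl
      · rw [TensorProduct.map_zero_left]; simp
  exact LinearMap.congr_fun this p

/-- The indices of the generators dual to the letters of `𝒜` under `p_3`. -/
def pairIndex : Letter → ZMod 5 × ZMod 5
  | .zero => (5, 3)
  | .one => (3, 4)

theorem cf_pr3_letter_mul (x : LetterM) (q : A) (a : Letter) (v : List Letter) :
    cf (pr3 (word [x]) * q) (a :: v) = (res x (pairIndex a).1 (pairIndex a).2 : ℚ) * cf q v := by
  have h : pr3 (word [x]) =
      ((res x 5 3 : ℤ) : ℚ) • word [Letter.zero] + ((res x 3 4 : ℤ) : ℚ) • word [Letter.one] := by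
    have hr : ∀ x : LetterM, res x 5 3 = (match x with
          | .e21 => 0 | .e23 => -1 | .e24 => 0 | .e31 => -1 | .e34 => -1) ∧
        res x 3 4 = (match x with
          | .e21 => 0 | .e23 => 0 | .e24 => 0 | .e31 => 0 | .e34 => 1) := by decide
    rw [(hr x).1, (hr x).2, pr3, ofLetters_word]
    cases x <;> simp [e]
    abel
  rw [h, add_mul, smul_mul_assoc, smul_mul_assoc, ← cfL_apply, map_add, map_smul, map_smul,
    cfL_apply, cfL_apply, cf_letter_mul, cf_letter_mul]
  cases a <;> simp [pairIndex]

theorem cf_pr3_nil (p : NC LetterM) : cf (pr3 p) [] = cf p [] := by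
  have : cfL [] ∘ₗ pr3.toLinearMap = cfL [] := linear_ext fun m => by
    rw [LinearMap.comp_apply, AlgHom.toLinearMap_apply, cfL_apply, cfL_apply]
    cases m with
    | nil => rw [word_nil, map_one, cf_one, cf_one]; simp
    | cons x m =>
      rw [cf_word_cons_nil, word_cons, map_mul, pr3, ofLetters_word]
      cases x <;> simp only [List.map_cons, List.map_nil, List.prod_cons, List.prod_nil, mul_one,
        zero_mul, neg_mul, sub_mul, e, ← cfL_apply [], map_sub, map_neg, map_zero] <;>
        simp only [cfL_apply, cf_letter_mul_nil, neg_zero, sub_zero]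
  exact LinearMap.congr_fun this p

theorem contr_word_nil (i j : ZMod 5) : contr i j (word []) = 0 :=
  cf_ext fun w => by
    rw [cf_contr, cf_zero]
    exact Finset.sum_eq_zero fun a _ => by rw [cf_word]; simp

theorem contr_word_cons (i j : ZMod 5) (x : LetterM) (m : List LetterM) :
    contr i j (word (x :: m)) = (res x i j : ℚ) • word m :=
  cf_ext fun w => by
    rw [cf_contr, cf_smul]
    rw [Finset.sum_eq_single x]
    · rw [word_cons, cf_letter_mul, if_pos rfl]
    · intro a _ ha
      rw [word_cons, cf_letter_mul, if_neg ha.symm, mul_zero]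
    · simp

theorem cf_pr3_cons (p : NC LetterM) (a : Letter) (v : List Letter) :
    cf (pr3 p) (a :: v) = cf (pr3 (contr (pairIndex a).1 (pairIndex a).2 p)) v := by
  have : cfL (a :: v) ∘ₗ pr3.toLinearMap =
      cfL v ∘ₗ pr3.toLinearMap ∘ₗ contr (pairIndex a).1 (pairIndex a).2 := linear_ext fun m => by
    simp only [LinearMap.comp_apply, AlgHom.toLinearMap_apply, cfL_apply]
    cases m with
    | nil => rw [contr_word_nil, word_nil, map_one, map_zero, cf_one]; exact if_neg (by simp)
    | cons x m => rw [contr_word_cons, word_cons, map_mul, cf_pr3_letter_mul, map_smul]; rfl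
  exact LinearMap.congr_fun this p

/-! ### The pairing of `dec_2⁻¹(l ⊗ 1)` with products -/

/-- The generators of `U𝔓_5` dual to the letters of `𝒜_z` under `p_2`. -/
def tZ : LetterZ → UP5
  | .zero => t 2 1
  | .z => t 2 3
  | .one => t 2 4

theorem tZ_mem (a : LetterZ) : tZ a ∈ augIdeal := by cases a <;> exact t_mem_augIdeal _ _

theorem pairU_tZ_mul (b : Bar) (a : LetterZ) (x : UP5) :
    ∃ b' : Bar, (b' : NC LetterM) = cut (letterM a) b ∧ pairU b (tZ a * x) = pairU b' x := by
  have key : ∀ i j : ZMod 5, ∀ c : LetterM, (∀ d, res d i j = if d = c then 1 else 0) →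
      (contrBar i j b : NC LetterM) = cut c b := fun i j c h => cf_ext fun w => by
    rw [cf_contrBar, cf_cut, Finset.sum_eq_single c]
    · rw [h, if_pos rfl]; simp
    · intro d _ hd
      rw [h, if_neg hd]; simp
    · simp
  cases a
  · exact ⟨_, key 2 1 .e21 (fun d => (res_dual d).1), pairU_t_mul b 2 1 x⟩
  · exact ⟨_, key 2 3 .e23 (fun d => (res_dual d).2.1), pairU_t_mul b 2 3 x⟩
  · exact ⟨_, key 2 4 .e24 (fun d => (res_dual d).2.2.1), pairU_t_mul b 2 4 x⟩

/-- The pairing of `ℬ` with `U𝔓_5` in terms of `dec_2`: the products of words in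
`t_{21}, t_{23}, t_{24}` and words in `t_{53}, t_{34}` are dual to the words of `𝒜_z ⊗ 𝒜`. -/
theorem pairU_eq_cfT (L : List LetterZ) (L' : List Letter) (b : Bar) :
    pairU b ((L.map tZ).prod * (L'.map (substLetter 5 3 4)).prod) = cfT L L' (dec2 b) := by
  induction L generalizing b with
  | nil =>
    rw [List.map_nil, List.prod_nil, one_mul, dec2_apply, cfT_decT_nil]
    induction L' generalizing b with
    | nil => rw [List.map_nil, List.prod_nil, pairU_one, cf_pr3_nil]
    | cons a L' ih =>
      have h : substLetter 5 3 4 a = t (pairIndex a).1 (pairIndex a).2 := by cases a <;> rfl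
      rw [List.map_cons, List.prod_cons, h, pairU_t_mul, ih, cf_pr3_cons]
      rfl
  | cons a L ih =>
    obtain ⟨b', hb', h⟩ := pairU_tZ_mul b a ((L.map tZ).prod * (L'.map (substLetter 5 3 4)).prod)
    rw [List.map_cons, List.prod_cons, mul_assoc, h, ih, dec2_apply, dec2_apply, cfT_decT_cons, hb']

theorem cfT_decT_nil_right (L : List LetterZ) (p : NC LetterM) :
    cfT L [] (decT p) = cf p (L.map letterM) := by
  induction L generalizing p with
  | nil => rw [cfT_decT_nil, cf_pr3_nil]; rfl
  | cons a L ih => rw [cfT_decT_cons, ih, cf_cut]; rfl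

theorem sum_ofFn {X : Type} [Fintype X] [DecidableEq X] {n : ℕ} (φ : List X → ℚ) {p : NC X}
    (hp : p ∈ wordSpan fun w => w.length < n) :
    ∑ m ∈ Finset.range n, ∑ w : Fin m → X, φ (List.ofFn w) * cf p (List.ofFn w) = ofWords φ p := by
  have : wordSpan (fun w : List X => w.length < n) ≤ LinearMap.eqLocus
      (∑ m ∈ Finset.range n, ∑ w : Fin m → X, φ (List.ofFn w) • cfL (List.ofFn w)) (ofWords φ) :=
    wordSpan_le fun u hu => by
      rw [LinearMap.mem_eqLocus, ofWords_word]
      simp only [LinearMap.sum_apply, LinearMap.smul_apply, cfL_apply, smul_eq_mul, cf_word]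
      rw [Finset.sum_eq_single u.length, Fintype.sum_eq_single u.get]
      · rw [List.ofFn_get]; simp
      · intro w hw
        rw [if_neg, mul_zero]
        intro h
        exact hw (List.ofFn_injective ((List.ofFn_get u).trans h).symm)
      · intro m _ hm
        refine Finset.sum_eq_zero fun w _ => ?_
        rw [if_neg, mul_zero]
        intro h
        exact hm (by rw [h, List.length_ofFn])
      · intro h
        exact absurd (Finset.mem_range.2 hu) h
  have := this hp
  rw [LinearMap.mem_eqLocus] at this
  rw [← this]
  simp only [LinearMap.sum_apply, LinearMap.smul_apply, cfL_apply, smul_eq_mul]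

/-- The pairing of `dec_2⁻¹(l ⊗ 1)` with the product of a series `Θ` in `t_{21}, t_{23}, t_{24}` and
`φ_{534}` is `⟨l | Θ⟩`. -/
theorem pairB_evHat (l : Az) (b : Bar) (hb : dec2 b = l ⊗ₜ 1) (Θ : List LetterZ → ℚ) (φ : Series)
    (hφ : φ [] = 1) : pairB b (evHat tZ tZ_mem Θ * subst φ 5 3 4) = ofWords Θ l := by
  have hl : l ∈ wordSpan fun w => w.length < degBound b := by
    intro w hw
    by_contra h
    refine hw ?_
    have h1 := cfT_decT_nil_right w b
    rw [← dec2_apply, hb, cfT_tmul, cf_one, if_pos List.length_nil, mul_one] at h1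
    rw [h1]
    exact mem_barLt_degBound b _ (by simpa using h)
  have h0 : pairB b (evHat tZ tZ_mem Θ * subst φ 5 3 4) =
      pairU b ((∑ m ∈ Finset.range (degBound b), evDeg tZ Θ m) *
        ∑ m ∈ Finset.range (degBound b), substDeg φ 5 3 4 m) := rfl
  rw [h0, Finset.sum_mul, map_sum, ← sum_ofFn Θ hl]
  refine Finset.sum_congr rfl fun m _ => ?_
  rw [evDeg, Finset.sum_mul, map_sum]
  refine Finset.sum_congr rfl fun w _ => ?_
  have hw : ∀ (L' : List Letter), pairU b ((List.ofFn fun s => tZ (w s)).prod *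
      (L'.map (substLetter 5 3 4)).prod) = cf l (List.ofFn w) * if L'.length = 0 then 1 else 0 := by
    intro L'
    rw [← cf_one, ← cfT_tmul, ← hb, ← pairU_eq_cfT, List.map_ofFn]
    rfl
  rw [smul_mul_assoc, map_rat_smul, smul_eq_mul, Finset.mul_sum, map_sum, Finset.sum_eq_single 0]
  · have := hw []
    rw [List.map_nil, List.prod_nil, mul_one, if_pos List.length_nil, mul_one] at this
    simp [substDeg, hφ, this]
  · intro k _ hk
    rw [substDeg, Finset.mul_sum, map_sum]
    refine Finset.sum_eq_zero fun v _ => ?_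
    have := hw (List.ofFn v)
    rw [List.map_ofFn, List.length_ofFn, if_neg hk, mul_zero] at this
    rw [mul_smul_comm, map_rat_smul]
    change φ (List.ofFn v) • pairU b (_ * (List.ofFn (substLetter 5 3 4 ∘ v)).prod) = 0
    rw [this, smul_zero]
  · intro h
    exact absurd (Finset.mem_range.2 (by simp [degBound])) h

/-! ### Surjectivity of `dec_2` -/

/-- The operator on `ℚ⟨f_0, f_z, f_1⟩` with the value `c` at `1` whose commutators with the left
multiplications by letters are the left multiplications by the elements `D x`. -/
def leftDer (c : Az) (D : LetterZ → Az) : Az →ₗ[ℚ] Az :=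
  ofWords fun w => w.rec c fun x w q => D x * word w + word [x] * q

theorem leftDer_one (c : Az) (D : LetterZ → Az) : leftDer c D 1 = c := by
  rw [← word_nil, leftDer, ofWords_word]

theorem leftDer_letter_mul (c : Az) (D : LetterZ → Az) (x : LetterZ) (p : Az) :
    leftDer c D (word [x] * p) = D x * p + word [x] * leftDer c D p := by
  have : leftDer c D ∘ₗ LinearMap.mulLeft ℚ (word [x]) =
      LinearMap.mulLeft ℚ (D x) + LinearMap.mulLeft ℚ (word [x]) ∘ₗ leftDer c D :=
    linear_ext fun w => by
      simp only [LinearMap.comp_apply, LinearMap.mulLeft_apply, LinearMap.add_apply, ← word_cons]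
      simp only [leftDer, ofWords_word]
  exact LinearMap.congr_fun this p

/-- The action of the generators `t_{21}, t_{23}, t_{24}, t_{31}, t_{34}` on the quotient of `U𝔓_5`
by the left ideal that `t_{53}` and `t_{34}` generate.  The quotient is identified with
`ℚ⟨f_0, f_z, f_1⟩` through `t_{21}, t_{23}, t_{24}`, and this space is encoded as `Az`. -/
def rho : LetterM → Az →ₗ[ℚ] Az
  | .e21 => LinearMap.mulLeft ℚ (ez .zero)
  | .e23 => LinearMap.mulLeft ℚ (ez .z)
  | .e24 => LinearMap.mulLeft ℚ (ez .one)
  | .e31 => leftDer (-ez .z) fun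
    | .zero => ez .zero * ez .z - ez .z * ez .zero
    | .z => ez .z * ez .zero - ez .zero * ez .z
    | .one => 0
  | .e34 => leftDer 0 fun
    | .zero => 0
    | .z => ez .z * ez .one - ez .one * ez .z
    | .one => ez .one * ez .z - ez .z * ez .one

/-- The value at `1` of the operator of a word. -/
def rhoWord (m : List LetterM) : Az := m.foldr (fun x q => rho x q) 1

/-- A combination of the forms `ω_a ∧ ω_b` whose coefficients satisfy the relations of `U𝔓_5`
vanishes, by the two Arnold relations `A1` and `A2`. -/
theorem sum_wedge_eq_zero {K : Type} [Field K] (Z W : K) (y : LetterM → LetterM → K)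
    (f : LetterM → Fin 2 → K) (h1 : Z ≠ 0) (h2 : W ≠ 0) (h3 : W - Z ≠ 0) (h4 : W - 1 ≠ 0)
    (h5 : Z - 1 ≠ 0)
    (f1 : f .e21 = ![0, 1 / W]) (f2 : f .e23 = ![-1 / (W - Z), 1 / (W - Z)])
    (f3 : f .e24 = ![0, 1 / (W - 1)]) (f4 : f .e31 = ![1 / Z, 0])
    (f5 : f .e34 = ![1 / (Z - 1), 0])
    (e1 : y .e31 .e24 - y .e24 .e31 = 0) (e2 : y .e34 .e21 - y .e21 .e34 = 0)
    (e3 : (y .e31 .e21 - y .e21 .e31) + (y .e31 .e23 - y .e23 .e31) = 0)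
    (e4 : (y .e31 .e21 - y .e21 .e31) + (y .e23 .e21 - y .e21 .e23) = 0)
    (e5 : (y .e34 .e24 - y .e24 .e34) + (y .e34 .e23 - y .e23 .e34) = 0)
    (e6 : (y .e34 .e24 - y .e24 .e34) + (y .e23 .e24 - y .e24 .e23) = 0) :
    ∑ a, ∑ b, y a b * (f a 0 * f b 1 - f a 1 * f b 0) = 0 := by
  have A1 : 1 / Z * (1 / W) = 1 / Z * (1 / (W - Z)) + -1 / (W - Z) * (1 / W) := by
    field_simp
    ring
  have A2 : 1 / (Z - 1) * (1 / (W - 1)) =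
      1 / (Z - 1) * (1 / (W - Z)) + -1 / (W - Z) * (1 / (W - 1)) := by
    field_simp
    ring
  simp only [sum_letterM, f1, f2, f3, f4, f5, Matrix.cons_val_zero, Matrix.cons_val_one]
  linear_combination (1 / Z * (1 / (W - 1))) * e1 + (1 / (Z - 1) * (1 / W)) * e2 +
    (1 / Z * (1 / (W - Z))) * e3 + (-1 / (W - Z) * (1 / W)) * e4 +
    (1 / (Z - 1) * (1 / (W - Z))) * e5 + (-1 / (W - Z) * (1 / (W - 1))) * e6 +
    (y .e31 .e21 - y .e21 .e31) * A1 + (y .e34 .e24 - y .e24 .e34) * A2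

theorem sum_mul_wedge_eq_zero (x : LetterM → LetterM → ℚ)
    (e1 : x .e31 .e24 - x .e24 .e31 = 0) (e2 : x .e34 .e21 - x .e21 .e34 = 0)
    (e3 : (x .e31 .e21 - x .e21 .e31) + (x .e31 .e23 - x .e23 .e31) = 0)
    (e4 : (x .e31 .e21 - x .e21 .e31) + (x .e23 .e21 - x .e21 .e23) = 0)
    (e5 : (x .e34 .e24 - x .e24 .e34) + (x .e34 .e23 - x .e23 .e34) = 0)
    (e6 : (x .e34 .e24 - x .e24 .e34) + (x .e23 .e24 - x .e24 .e23) = 0) :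
    ∑ a, ∑ b, algebraMap ℚ RatZW (x a b) * wedge a b = 0 := by
  have inj : Function.Injective (algebraMap PolyZW RatZW) := IsFractionRing.injective _ _
  have key : ∀ f : PolyZW, ∀ z w : ℚ, MvPolynomial.eval ![z, w] f ≠ 0 →
      algebraMap PolyZW RatZW f ≠ 0 := by
    intro f z w hf h0
    rw [map_eq_zero_iff _ inj] at h0
    simp [h0] at hf
  have h1 := key (.X 0) 2 3 (by simp)
  have h2 := key (.X 1) 2 3 (by simp)
  have h3 := key (.X 1 - .X 0) 2 3 (by simp; norm_num)
  have h4 := key (.X 1 - 1) 2 3 (by simp; norm_num)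
  have h5 := key (.X 0 - 1) 2 3 (by simp; norm_num)
  simp only [map_sub, map_one] at h3 h4 h5
  have hd : ∀ a, dlog (divisorEq a) = ![dlog (divisorEq a) 0, dlog (divisorEq a) 1] := by
    intro a; ext s; fin_cases s <;> rfl
  have h01 : (1 : Fin 2) ≠ 0 := by decide
  have h10 : (0 : Fin 2) ≠ 1 := by decide
  have hm : ∀ q : ℚ, q = 0 → algebraMap ℚ RatZW q = 0 := fun q hq => by rw [hq, map_zero]
  exact sum_wedge_eq_zero _ _ (fun a b => algebraMap ℚ RatZW (x a b))
    (fun a => dlog (divisorEq a)) h1 h2 h3 h4 h5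
    (by rw [hd]; simp [dlog, divisorEq, MvPolynomial.pderiv_X_of_ne h01])
    (by rw [hd]; simp [dlog, divisorEq, MvPolynomial.pderiv_X_of_ne h01,
          MvPolynomial.pderiv_X_of_ne h10])
    (by rw [hd]; simp [dlog, divisorEq, MvPolynomial.pderiv_X_of_ne h01])
    (by rw [hd]; simp [dlog, divisorEq, MvPolynomial.pderiv_X_of_ne h10])
    (by rw [hd]; simp [dlog, divisorEq, MvPolynomial.pderiv_X_of_ne h10])
    (by simpa using hm _ e1) (by simpa using hm _ e2) (by simpa using hm _ e3)
    (by simpa using hm _ e4) (by simpa using hm _ e5) (by simpa using hm _ e6)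

/-- The operators `rho` satisfy the quadratic relations of `U𝔓_5`, in the form dual to the integrability
condition of `ℬ`. -/
theorem rho_relations (H : Az →ₗ[ℚ] ℚ) (q : Az) :
    ∑ a, ∑ b, algebraMap ℚ RatZW (H (rho a (rho b q))) * wedge a b = 0 := by
  refine sum_mul_wedge_eq_zero (fun a b => H (rho a (rho b q))) ?_ ?_ ?_ ?_ ?_ ?_ <;>
    simp only [rho, LinearMap.mulLeft_apply, ez, leftDer_letter_mul, ← map_sub, ← map_add] <;>
    refine (congrArg H ?_).trans (map_zero H) <;>
    noncomm_ring

theorem leftDer_mem {c : Az} {D : LetterZ → Az} (hc : c ∈ wordSpan fun w => w.length = 1)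
    (hD : ∀ x, D x ∈ wordSpan fun w => w.length = 2) {n : ℕ} {p : Az}
    (hp : p ∈ wordSpan fun w => w.length = n) :
    leftDer c D p ∈ wordSpan fun w => w.length = n + 1 := by
  have : wordSpan (fun w : List LetterZ => w.length = n) ≤
      (wordSpan fun w => w.length = n + 1).comap (leftDer c D) := wordSpan_le fun w hw => by
    rw [Submodule.mem_comap]
    clear hp
    induction w generalizing n with
    | nil =>
      subst hw
      rw [word_nil, leftDer_one]
      exact hc
    | cons x w ih =>
      subst hw
      rw [word_cons, leftDer_letter_mul]
      refine add_mem ?_ (letter_mul_mem (fun v hv => ?_) (ih rfl))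
      · refine bilinear_mem (LinearMap.mul ℚ Az) (fun u v hu hv => ?_) (hD x)
          (word_mem_wordSpan (P := fun v => v = w) rfl)
        rw [LinearMap.mul_apply', word_mul]
        refine word_mem_wordSpan ?_
        rw [hv, List.length_append, hu, List.length_cons]
        omega
      · rw [List.length_cons, hv, List.length_cons]
  exact this hp

theorem rho_mem (x : LetterM) {n : ℕ} {p : Az} (hp : p ∈ wordSpan fun w => w.length = n) :
    rho x p ∈ wordSpan fun w => w.length = n + 1 := by
  have h1 : ∀ a, ez a * p ∈ wordSpan fun w => w.length = n + 1 := fun a =>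
    letter_mul_mem (fun w hw => by rw [List.length_cons, hw]) hp
  have h2 : ∀ a b, ez a * ez b ∈ wordSpan fun w => w.length = 2 := fun a b => by
    rw [ez, ez, word_mul]
    exact word_mem_wordSpan rfl
  cases x
  · exact h1 _
  · exact h1 _
  · exact h1 _
  · exact leftDer_mem (neg_mem (word_mem_wordSpan rfl)) (fun a => by
      cases a
      · exact sub_mem (h2 _ _) (h2 _ _)
      · exact sub_mem (h2 _ _) (h2 _ _)
      · exact zero_mem _) hp
  · exact leftDer_mem (zero_mem _) (fun a => by
      cases a
      · exact zero_mem _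
      · exact sub_mem (h2 _ _) (h2 _ _)
      · exact sub_mem (h2 _ _) (h2 _ _)) hp

theorem rhoWord_mem (m : List LetterM) : rhoWord m ∈ wordSpan fun w => w.length = m.length := by
  induction m with
  | nil => exact word_mem_wordSpan (w := []) rfl
  | cons x m ih => exact rho_mem x ih

theorem exists_rhoWord_append (H : Az →ₗ[ℚ] ℚ) (u : List LetterM) :
    ∃ H' : Az →ₗ[ℚ] ℚ, ∀ m, H (rhoWord (u ++ m)) = H' (rhoWord m) := by
  induction u generalizing H with
  | nil => exact ⟨H, fun _ => rfl⟩
  | cons x u ih =>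
    obtain ⟨H', h⟩ := ih (H ∘ₗ rho x)
    exact ⟨H', fun m => (h m)⟩

/-- The right factor contributes only its constant term, since `t_{53}` and `t_{34}` annihilate `1`. -/
theorem cf_pr3_of_rho (v : List Letter) (p : NC LetterM) (H : Az →ₗ[ℚ] ℚ)
    (hp : ∀ m, cf p m = H (rhoWord m)) :
    cf (pr3 p) v = H 1 * if v.length = 0 then 1 else 0 := by
  induction v generalizing p H with
  | nil => rw [cf_pr3_nil, hp]; simp [rhoWord]
  | cons a v ih =>
    rw [cf_pr3_cons, ih _ (H ∘ₗ ∑ x, (res x (pairIndex a).1 (pairIndex a).2 : ℚ) • rho x)]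
    · have h0 : (∑ x, (res x (pairIndex a).1 (pairIndex a).2 : ℚ) • rho x) (1 : Az) = 0 := by
        have hr : ∀ x : LetterM, res x 5 3 = (match x with
              | .e21 => 0 | .e23 => -1 | .e24 => 0 | .e31 => -1 | .e34 => -1) ∧
            res x 3 4 = (match x with
              | .e21 => 0 | .e23 => 0 | .e24 => 0 | .e31 => 0 | .e34 => 1) := by decide
        cases a
        · simp [pairIndex, sum_letterM, (hr _).1, rho, leftDer_one]
        · simp [pairIndex, sum_letterM, (hr _).2, rho, leftDer_one]
      rw [LinearMap.comp_apply, h0]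
      simp
    · intro m
      rw [cf_contr, LinearMap.comp_apply, LinearMap.sum_apply, map_sum]
      refine Finset.sum_congr rfl fun x _ => ?_
      rw [hp, LinearMap.smul_apply, map_smul]
      rfl

theorem cfT_decT_of_rho (w : List LetterZ) (v : List Letter) (p : NC LetterM) (H : Az →ₗ[ℚ] ℚ)
    (hp : ∀ m, cf p m = H (rhoWord m)) :
    cfT w v (decT p) = H (word w) * if v.length = 0 then 1 else 0 := by
  induction w generalizing p H with
  | nil => rw [cfT_decT_nil, cf_pr3_of_rho v p H hp, word_nil]
  | cons a w ih =>
    rw [cfT_decT_cons, ih _ (H ∘ₗ rho (letterM a))]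
    · rw [LinearMap.comp_apply, word_cons]
      cases a <;> rfl
    · intro m
      rw [cf_cut, hp]
      rfl

/-- For a word `u`, the tensor with the coefficients `⟨u | ρ(m) 1⟩` on the words `m` is a preimage of
`u ⊗ 1`: it is integrable because `ρ` satisfies the relations of `U𝔓_5`, and `t_{53}`, `t_{34}` annihilate
`1`. -/
theorem exists_dec2 (l : Az) : ∃ b, dec2 b = l ⊗ₜ 1 := by
  have h : (⊤ : Submodule ℚ Az) ≤
      (LinearMap.range dec2).comap ((TensorProduct.mk ℚ Az A).flip 1) := by
    rw [← span_word, Submodule.span_le]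
    rintro _ ⟨u, rfl⟩
    have hfin : (Function.support fun m : FreeMonoid LetterM =>
        cfL u (rhoWord m.toList)).Finite := by
      refine (List.finite_length_eq LetterM u.length).subset fun m hm => ?_
      exact (rhoWord_mem m u hm).symm
    let p : NC LetterM := MonoidAlgebra.ofCoeff (Finsupp.ofSupportFinite _ hfin)
    have hp : ∀ m, cf p m = cfL u (rhoWord m) := fun m => rfl
    have hbar : p ∈ Bar := by
      intro x y
      obtain ⟨H', hH'⟩ := exists_rhoWord_append (cfL u) x
      simp only [hp, hH']
      exact rho_relations H' (rhoWord y)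
    refine ⟨⟨p, hbar⟩, tensor_ext fun w v => ?_⟩
    rw [dec2_apply, cfT_decT_of_rho w v p (cfL u) hp]
    change _ = cfT w v (word u ⊗ₜ 1)
    rw [cfT_tmul, cf_one, cfL_apply, cf_word, cf_word]
    simp only [eq_comm]
  exact h (Submodule.mem_top (x := l))

theorem dec2_j2 (l : Az) : dec2 (j2 l) = l ⊗ₜ 1 := Function.invFun_eq (exists_dec2 l)

/-! ### The two characters of the formula -/

/-- The index of the image of `e_a` under `e_z ↦ e_1`. -/
def zToOneLetter : LetterZ → Letter
  | .zero => .zero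
  | .z => .one
  | .one => .one

theorem zToOne_letter (a : LetterZ) : zToOne (word [a]) = word [zToOneLetter a] := by
  rw [zToOne, ofLetters_word]
  cases a <;> simp [e, zToOneLetter]

theorem zToOne_word (w : List LetterZ) : zToOne (word w) = word (w.map zToOneLetter) := by
  induction w with
  | nil => rw [word_nil, map_one]; rfl
  | cons a w ih => rw [word_cons, map_mul, ih, zToOne_letter, List.map_cons, ← word_cons]

theorem zToOne_sh (p q : Az) : zToOne (sh p q) = sh (zToOne p) (zToOne q) := by
  have h : ∀ u v : List LetterZ, zToOne (shuffleWords u v) =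
      shuffleWords (u.map zToOneLetter) (v.map zToOneLetter) := by
    intro u v
    induction u generalizing v with
    | nil => simp [shuffleWords_nil_left, zToOne_word]
    | cons a u ih =>
      induction v with
      | nil => simp [shuffleWords_nil_right, zToOne_word]
      | cons b v ih' =>
        rw [shuffleWords_cons_cons, map_add, map_mul, map_mul, ih, ih', zToOne_letter,
          zToOne_letter]
        simp only [List.map_cons, shuffleWords_cons_cons]
  have : sh.compr₂ zToOne.toLinearMap = sh.compl₁₂ zToOne.toLinearMap zToOne.toLinearMap :=
    bilinear_ext fun u v => by
      simp only [LinearMap.compr₂_apply, LinearMap.compl₁₂_apply, AlgHom.toLinearMap_apply,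
        zToOne_word, sh_word, h]
  exact LinearMap.congr_fun (LinearMap.congr_fun this p) q

/-- The series `φ(f_0, f_z + f_1)`, by the transposed substitution `e_z ↦ e_1`. -/
def pullZ (φ : Series) : List LetterZ → ℚ := fun w => ofWords φ (zToOne (word w))

/-- The series `φ(f_1, -f_1 - f_z)⁻¹`, for a group-like series `φ`; its coefficients are defined
through `τ_z`, and `pullTau_eq` identifies it. -/
def pullTau (φ : Series) : List LetterZ → ℚ := fun w => ofWords φ (zToOne (tauZ (word w)))

theorem ofWords_pullZ (φ : Series) (p : Az) : ofWords (pullZ φ) p = ofWords φ (zToOne p) := by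
  have : ofWords (pullZ φ) = ofWords φ ∘ₗ zToOne.toLinearMap := linear_ext fun w => by
    rw [ofWords_word]; rfl
  exact LinearMap.congr_fun this p

theorem ofWords_pullTau (φ : Series) (p : Az) :
    ofWords (pullTau φ) p = ofWords (pullZ φ) (tauZ p) := by
  have : ofWords (pullTau φ) = ofWords (pullZ φ) ∘ₗ tauZ := linear_ext fun w => by
    rw [ofWords_word, LinearMap.comp_apply, ofWords_pullZ]; rfl
  exact LinearMap.congr_fun this p

theorem isShuffleChar_pullZ {φ : Series} (h : IsShuffleChar φ) : IsShuffleChar (pullZ φ) := by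
  refine ⟨?_, fun p q => ?_⟩
  · rw [pullZ, word_nil, map_one, ← word_nil, ofWords_word, h.nil]
  · simp only [ofWords_pullZ, zToOne_sh, h.map_sh]

theorem tauZ_cons (a : LetterZ) (w : List LetterZ) :
    tauZ (word (a :: w)) = tauZ (word w) * tauZ (word [a]) := by
  rw [tauZ_word, tauZ_word, tauZ_word]; simp

/-- The antipode of `ℚ⟨e_0, e_1⟩`, the transpose of `antipodeS`. -/
def antipodeA : A →ₗ[ℚ] A := ofWords fun w => (-1 : ℚ) ^ w.length • word w.reverse

theorem ofWords_antipodeS (φ : Series) (p : A) :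
    ofWords (antipodeS φ) p = ofWords φ (antipodeA p) := by
  have : ofWords (antipodeS φ) = ofWords φ ∘ₗ antipodeA := linear_ext fun w => by
    rw [LinearMap.comp_apply, antipodeA, ofWords_word, ofWords_word, map_smul, ofWords_word]; rfl
  exact LinearMap.congr_fun this p

theorem antipodeA_mul (p q : A) : antipodeA (p * q) = antipodeA q * antipodeA p := by
  have : (LinearMap.mul ℚ A).compr₂ antipodeA =
      ((LinearMap.mul ℚ A).compl₁₂ antipodeA antipodeA).flip := bilinear_ext fun u v => by
    simp only [LinearMap.compr₂_apply, LinearMap.flip_apply, LinearMap.compl₁₂_apply,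
      LinearMap.mul_apply', word_mul, antipodeA, ofWords_word, List.reverse_append,
      List.length_append, smul_mul_smul_comm, pow_add]
    rw [mul_comm]
  exact LinearMap.congr_fun (LinearMap.congr_fun this p) q

theorem antipodeA_letter (a : Letter) : antipodeA (word [a]) = -word [a] := by
  simp [antipodeA, ofWords_word]

/-- The substitution dual to `f_0 ↦ f_1`, `f_1 ↦ -f_1 - f_z`. -/
def dualSubst : Az →ₐ[ℚ] A :=
  ofLetters fun a => match a with
    | .zero => 0
    | .z => -e .one
    | .one => e .zero - e .one

/-- Both sides are antihomomorphisms with the same values on letters; both map `e_0` to `0`. -/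
theorem antipodeA_dualSubst (w : List LetterZ) :
    antipodeA (dualSubst (word w)) = zToOne (tauZ (word w)) := by
  induction w with
  | nil =>
    have h : tauZ (word []) = word [] := by rw [tauZ_word]; rfl
    rw [h, word_nil, map_one dualSubst, map_one zToOne, ← word_nil, antipodeA, ofWords_word]; simp
  | cons a w ih =>
    have h : antipodeA (dualSubst (word [a])) = zToOne (tauZ (word [a])) := by
      rw [tauZ_word, dualSubst, ofLetters_word]
      cases a <;> simp [e, ez, zToOne_letter, zToOneLetter, antipodeA_letter, neg_add_eq_sub]
    rw [tauZ_cons, word_cons, map_mul, antipodeA_mul, map_mul, ih, h]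

theorem pullTau_eq (φ : Series) :
    pullTau φ = fun w => ofWords (antipodeS φ) (dualSubst (word w)) := by
  funext w
  rw [ofWords_antipodeS, antipodeA_dualSubst]; rfl

/-! ### The images of `φ` in the completion -/

/-- `φ_{215} = φ(t_{21}, t_{23} + t_{24})`: the difference `t_{34}` between `t_{15}` and
`t_{23} + t_{24}` commutes with `t_{21}` and `t_{23} + t_{24}`. -/
theorem subst_two_one_five {φ : Series} (h : IsShuffleChar φ) (h1 : φ [.one] = 0) :
    subst φ 2 1 5 = evHat tZ tZ_mem (pullZ φ) := by
  rw [subst_eq_evHat]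
  refine evHat_congr fun m => ?_
  have hf : substLetter 2 1 5 = fun x : Letter =>
      (∑ y, (if zToOneLetter y = x then (1 : ℚ) else 0) • tZ y) +
        if x = .one then t 3 4 else 0 := by
    funext x
    have hu : (Finset.univ : Finset LetterZ) = {.zero, .z, .one} := rfl
    rw [hu]
    cases x <;> simp [substLetter, zToOneLetter, tZ, t_one_five]
  rw [hf, h.evDeg_translate h1]
  · exact (evDeg_linear _ zToOne (fun y => by
      rw [zToOne_letter]; simp) tZ φ m).symm
  · intro x
    have hu : (Finset.univ : Finset LetterZ) = {.zero, .z, .one} := rfl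
    rw [hu]
    cases x
    · simpa [zToOneLetter, tZ] using commute_t34_t21
    · simpa [zToOneLetter, tZ] using commute_t34_add

/-- The substitution matrix of `f_0 ↦ f_1`, `f_1 ↦ -f_1 - f_z`. -/
def dualMatrix : Letter → LetterZ → ℚ
  | .zero, .one => 1
  | .one, .one => -1
  | .one, .z => -1
  | _, _ => 0

theorem dualSubst_letter (y : LetterZ) :
    dualSubst (word [y]) = ∑ x, dualMatrix x y • word [x] := by
  have hu : (Finset.univ : Finset Letter) = {.zero, .one} := rfl
  rw [hu, dualSubst, ofLetters_word]
  cases y <;> simp [dualMatrix, e, sub_eq_add_neg]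

/-- `φ_{243} = φ(t_{24}, -t_{23} - t_{24})`, as `t_{15}` commutes with `t_{23}` and `t_{24}`. -/
theorem inverse_subst_two_four_three {φ : Series} (h : IsShuffleChar φ) (h1 : φ [.one] = 0) :
    Ring.inverse (subst φ 2 4 3) = evHat tZ tZ_mem (pullTau φ) := by
  let g : Letter → UP5 := fun x => ∑ y, dualMatrix x y • tZ y
  have hu : (Finset.univ : Finset LetterZ) = {.zero, .z, .one} := rfl
  have hg0 : g .zero = t 2 4 := by simp [g, hu, dualMatrix, tZ]
  have hg1 : g .one = -t 2 3 - t 2 4 := by simp [g, hu, dualMatrix, tZ]; abel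
  have hg : ∀ x, g x ∈ augIdeal := by
    intro x
    cases x
    · rw [hg0]; exact t_mem_augIdeal _ _
    · rw [hg1]; exact sub_mem (neg_mem (t_mem_augIdeal _ _)) (t_mem_augIdeal _ _)
  have hs : subst φ 2 4 3 = evHat g hg φ := by
    rw [subst_eq_evHat]
    refine evHat_congr fun m => ?_
    have hf : substLetter 2 4 3 = fun x : Letter => g x + if x = .one then t 1 5 else 0 := by
      funext x
      cases x
      · simp [hg0, substLetter]
      · simp only [hg1, substLetter, if_true]
        rw [t_one_five, t_symm 4 3]; abel
    rw [hf, h.evDeg_translate h1]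
    intro x
    cases x
    · rw [hg0]; exact commute_t15_t24
    · rw [hg1]; exact commute_t15_t23.neg_right.sub_right commute_t15_t24
  rw [hs, inverse_evHat g hg h, pullTau_eq]
  exact evHat_congr fun m => (evDeg_linear dualMatrix dualSubst dualSubst_letter tZ _ m).symm

/-! ### The effect of the characters on the regularized factors -/

/-- A series that vanishes on the words with the letter `e_0` acts on the shuffle product of a word
that begins with `e_0` and another word through the second factor only. -/
theorem lop_shuffleWords {g : List LetterZ → ℚ} (hg : ∀ w, .zero ∈ w → g w = 0)
    (y v : List LetterZ) :
    lop g (shuffleWords (.zero :: y) v) = sh (word (.zero :: y)) (lop g (word v)) := by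
  have h0 : ∀ g : List LetterZ → ℚ, (∀ w, .zero ∈ w → g w = 0) → ∀ p : Az,
      lop g (word [.zero] * p) = g [] • (word [.zero] * p) := by
    intro g hg p
    have : der .zero g = 0 := funext fun w => hg _ (by simp)
    rw [lop_letter_mul, this, lop_zero, LinearMap.zero_apply, add_zero]
  induction v generalizing g with
  | nil =>
    rw [shuffleWords_nil_right, word_cons, h0 g hg, lop_nil, map_smul, word_nil, sh_one_right]
  | cons a v ih =>
    rw [shuffleWords_cons_cons, map_add, h0 g hg, lop_letter_mul, lop_cons, map_add, map_smul,
      sh_word, shuffleWords_cons_cons,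
      ih (g := der a g) fun w hw => hg _ (List.mem_cons_of_mem a hw), smul_add, add_assoc]

theorem pullTau_zero (φ : Series) (w : List LetterZ) (hw : .zero ∈ w) : pullTau φ w = 0 := by
  rw [pullTau_eq]
  have : dualSubst (word w) = 0 := by
    rw [dualSubst, ofLetters_word]
    exact List.prod_eq_zero (List.mem_map.2 ⟨_, hw, rfl⟩)
  change ofWords (antipodeS φ) (dualSubst (word w)) = 0
  rw [this, map_zero]

/-- On words in `e_1, e_z` the series `φ(f_0, f_z + f_1)` has the coefficients of `φ` on `e_1 ⋯ e_1`. -/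
theorem pullZ_of_forall {φ : Series} (h : IsShuffleChar φ) (h1 : φ [.one] = 0) {v : List LetterZ}
    (hv : ∀ a ∈ v, a ≠ .zero) : pullZ φ v = if v.length = 0 then 1 else 0 := by
  rw [pullZ, zToOne_word, ofWords_word]
  have hr : v.map zToOneLetter = List.replicate v.length .one := by
    refine List.eq_replicate_iff.2 ⟨by simp, fun b hb => ?_⟩
    obtain ⟨a, ha, rfl⟩ := List.mem_map.1 hb
    cases a
    · exact absurd rfl (hv _ ha)
    · rfl
    · rfl
  rw [hr]
  cases v with
  | nil => simpa using h.nil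
  | cons a v => simpa using h.replicate h1 v.length

/-- On `ℚ⟨e_1, e_z⟩` the product of a series `g` with `φ(f_0, f_z + f_1)` has the same coefficients
as `g`. -/
theorem ofWords_pullZ_lop {φ : Series} (h : IsShuffleChar φ) (h1 : φ [.one] = 0)
    (g : List LetterZ → ℚ) {v : List LetterZ} (hv : ∀ a ∈ v, a ≠ .zero) :
    ofWords (pullZ φ) (lop g (word v)) = g v := by
  induction v generalizing g with
  | nil => rw [lop_nil, map_smul, ofWords_word, (isShuffleChar_pullZ h).nil, smul_eq_mul, mul_one]
  | cons a v ih =>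
    rw [lop_cons, map_add, map_smul, ofWords_word, pullZ_of_forall h h1 hv,
      ih _ fun b hb => hv b (by simp [hb])]
    simp [der]

/-- The right-hand side of the formula on a product of the two regularized factors. -/
theorem ofWords_mulS_sh {φ : Series} (h : IsShuffleChar φ) (h1 : φ [.one] = 0) {u v : Az}
    (hu : u ∈ AzNeg2) (hv : v ∈ Az0OneZ) :
    ofWords (mulS (pullTau φ) (pullZ φ)) (sh u v) =
      ofWords (pullZ φ) u * ofWords (pullZ φ) (tauZ v) := by
  have key : sh.compr₂ (ofWords (mulS (pullTau φ) (pullZ φ))) u v =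
      (LinearMap.mul ℚ ℚ).compl₁₂ (ofWords (pullZ φ)) (ofWords (pullTau φ)) u v := by
    rw [← sub_eq_zero, ← LinearMap.sub_apply, ← LinearMap.sub_apply, ← Submodule.mem_bot ℚ]
    rw [azNeg2_eq] at hu
    rw [az0OneZ_eq] at hv
    refine bilinear_mem _ (fun u v hu hv => ?_) hu hv
    rw [Submodule.mem_bot, LinearMap.sub_apply, LinearMap.sub_apply, sub_eq_zero]
    simp only [LinearMap.compr₂_apply, LinearMap.compl₁₂_apply, LinearMap.mul_apply']
    have hc := isShuffleChar_pullZ h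
    have hl : lop (pullTau φ) (sh (word u) (word v)) = sh (word u) (lop (pullTau φ) (word v)) := by
      rcases hu with rfl | ⟨y, rfl, -⟩
      · rw [word_nil, sh_one_left, sh_one_left]
      · rw [sh_word, lop_shuffleWords (pullTau_zero φ)]
    rw [← cf_nil_lop, lop_mulS, LinearMap.comp_apply, cf_nil_lop, hl, hc.map_sh,
      ofWords_pullZ_lop h h1 _ hv.2, ofWords_word (pullTau φ)]
  rw [← ofWords_pullTau]
  exact key

theorem ofWords_pullZ_polyZ {φ : Series} (h : IsShuffleChar φ) (h1 : φ [.one] = 0) (p : PolyZ) :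
    ofWords (pullZ φ) (p : Az) = constZ p := by
  have : PolyZ ≤ LinearMap.eqLocus (ofWords (pullZ φ))
      (ofLetters fun _ : LetterZ => (0 : ℚ)).toLinearMap := by
    rw [PolyZ, subAlphabet_eq]
    refine wordSpan_le fun w hw => ?_
    rw [LinearMap.mem_eqLocus, AlgHom.toLinearMap_apply, ofWords_word, ofLetters_word,
      pullZ_of_forall h h1 fun a ha => by rw [hw a ha]; simp]
    cases w <;> simp
  exact this p.2

/-- The regularization `const ⊗ id` does not change the coefficient of `φ(f_0, f_z + f_1)`, which
vanishes on `e_z`. -/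
theorem pairA_lam {φ : Series} (h : IsShuffleChar φ) (h1 : φ [.one] = 0) (l : Az0) :
    pairA (lam l) φ = ofWords (pullZ φ) (mapN l) := by
  have hr := shuffleZ_regZ_mapN l
  rw [lam, pairA, ← ofWords_pullZ]
  generalize regZ (mapN l) = x at hr ⊢
  rw [← hr]
  clear hr
  induction x using TensorProduct.induction_on with
  | zero => simp
  | add x y hx hy => simp only [map_add, hx, hy]
  | tmul p u =>
    rw [shuffleZ_tmul, (isShuffleChar_pullZ h).map_sh, ofWords_pullZ_polyZ h h1]
    simp

theorem ofWords_mapN {φ : Series} (h : IsShuffleChar φ) (h1 : φ [.one] = 0) (l : Az0) :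
    ofWords (pullZ φ) (mapN l) = ofWords (mulS (pullTau φ) (pullZ φ)) l := by
  have hr := shuffleZ1_regZ1 l
  rw [mapN]
  generalize regZ1 l = x at hr ⊢
  rw [← hr]
  clear hr
  induction x using TensorProduct.induction_on with
  | zero => simp
  | add x y hx hy => simp only [map_add, hx, hy]
  | tmul u v =>
    rw [shuffleZ1_tmul, ofWords_mulS_sh h h1 u.2 v.2, ← (isShuffleChar_pullZ h).map_sh]
    rfl

end KeyFormula

theorem mainTheorem3 (l : Az0) (φ : Series) (hφ : φ ∈ commGroupLike) :
    pairA (lam l) φ =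
      pairB (j2 l) (Ring.inverse (subst φ 2 4 3) * subst φ 2 1 5 * subst φ 5 3 4) := by
  have h := commGroupLike_isShuffleChar hφ
  have h1 := commGroupLike_letter hφ .one
  rw [pairA_lam h h1, ofWords_mapN h h1, inverse_subst_two_four_three h h1,
    subst_two_one_five h h1, ← evHat_mul, pairB_evHat l _ (dec2_j2 l) _ _ h.nil]
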